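/- **Setting.** Let $\mathcal A$ be a finite alphabet, $K:\mathcal A\times\mathcal A\to\mathbb R$ a symmetric matrix and $\mu$ a probability measure on $\mathcal A$ with $\mu(a)>0$ for all $a$. Let $x_1,x_2,\dots$ and $y_1,y_2,\dots$ be $\mathcal A$-valued random variables, all independent with law $\mu$; assume $E[K(x_1,y_1)]<0$ and $\max_{a,b}K(a,b)>0$. Write $\mathbf x_m=x_1\cdots x_m$, $\mathbf y_n=y_1\cdots y_n$. A gap penalty is a nondecreasing function $g:\{0,1,\dots\}\to[0,\infty)$ with $g(0)=0$ and $g(k+1)-g(k)\le g(k)-g(k-1)$ for all $k\ge1$. An alignment of $\mathbf x_m$ and $\mathbf y_n$ is a set $\mathbf z=\{(i(t),j(t)):1\le t\le u\}$ with $u\ge1$, $1\le i(1)<\dots<i(u)\le m$ and $1\le j(1)<\dots<j(u)\le n$; put $|\mathbf z|=u$, $$S_{\mathbf z}(\mathbf x_m,\mathbf y_n)=\sum_{t=1}^{u}K(x_{i(t)},y_{j(t)})-\sum_{t=1}^{u-1}\bigl[g(i(t+1)-i(t)-1)+g(j(t+1)-j(t)-1)\bigr],$$ $$R_{\mathbf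 z}(\mathbf x_m,\mathbf y_n)=S_{\mathbf z}(\mathbf x_m,\mathbf y_n)-g(i(1)-1)-g(j(1)-1)-g(m-i(u))-g(n-j(u)),$$ $H(\mathbf x_m,\mathbf y_n)=\max_{\mathbf z}S_{\mathbf z}(\mathbf x_m,\mathbf y_n)$, and, for $1\le\kappa\le\min(m,n)$, $G_\kappa(\mathbf x_m,\mathbf y_n)=\max\{R_{\mathbf z}(\mathbf x_m,\mathbf y_n):(1,1)\in\mathbf z,\ |\mathbf z|=\kappa\}$. For $\theta>0$ let $$h_\kappa(\theta)=\sum_{m,n\ge\kappa}E\exp[\theta G_\kappa(\mathbf x_m,\mathbf y_n)],\qquad \psi_\kappa(\theta)=\log h_\kappa(\theta).$$ **Theorem 2.** Let $\gamma:\{1,2,\dots\}\to\mathbb R$ satisfy $\gamma(1)=0$ and $\lim_{k\to\infty}\gamma(k)/\log k=\infty$. For $\Delta\in\mathbb R$ let $g(0)=0$ and $g(k)=\Delta+\gamma(k)$ for $k\ge1$, and assume that $g$ is a gap penalty for some $\Delta$ (then it is one for all larger $\Delta$). For every $\Delta$ for which $g$ is a gap penalty, $h_\kappa(\theta)<\infty$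 for all $\kappa\ge1$ and $\theta>0$, the limit $\psi(\theta)=\lim_{\kappa\to\infty}\psi_\kappa(\theta)/\kappa$ exists and is finite for all $\theta>0$, and $\psi$ is convex on $(0,\infty)$. Moreover, for all sufficiently large $\Delta$, $$\psi(\theta)=0\ \text{ has a unique positive root }\tilde\theta.\qquad(\ast)$$ For every $\Delta$ for which $g$ is a gap penalty and $(\ast)$ holds: (a) if $m=m(c)$ and $n=n(c)$ satisfy $\min\{m,n\}/c\to\infty$ and $\log(mn)=o(c)$ as $c\to\infty$, then $\lim_{c\to\infty}-c^{-1}\log P\{H(\mathbf x_m,\mathbf y_n)\ge c\}=\tilde\theta$; (b) $H(\mathbf x_n,\mathbf y_n)/\log n\to2/\tilde\theta$ almost surely as $n\to\infty$. -/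

import Mathlib

open Filter Topology MeasureTheory ProbabilityTheory Asymptotics

namespace LocalAlignment

noncomputable section

/-- The conditions on a gap penalty `g`: it vanishes at `0`, is nondecreasing (hence
nonnegative) and concave. -/
structure IsGapPenalty (g : ℕ → ℝ) : Prop where
  zero : g 0 = 0
  mono : Monotone g
  concave : ∀ k : ℕ, g (k + 2) - g (k + 1) ≤ g (k + 1) - g k

/-- The gap penalty `g(0) = 0`, `g(k) = Δ + γ(k)` for `k ≥ 1`. -/
def gapPenalty (Δ : ℝ) (γ : ℕ → ℝ) (k : ℕ) : ℝ :=
  if k = 0 then 0 else Δ + γ k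

/-- A nonempty candidate alignment `{(i(t), j(t)) : 1 ≤ t ≤ u}` of a word of length `m` with a word
of length `n`, where `i` and `j` are strictly increasing. Positions in words and the index `t` are
counted from `0` here. Candidate alignments that do not fit into the words have score `-∞`
and therefore play no role in the suprema below, so they are left out. -/
structure Alignment (m n : ℕ) where
  /-- the number of matches -/
  u : ℕ
  u_pos : 0 < u
  i : Fin u → Fin m
  j : Fin u → Fin n
  i_strictMono : StrictMono i
  j_strictMono : StrictMono j

namespace Alignment

variable {m n : ℕ}

/-- The index of the first match. -/
def first (z : Alignment m n) : Fin z.u := ⟨0, z.u_pos⟩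

/-- The index of the last match. -/
def last (z : Alignment m n) : Fin z.u := ⟨z.u - 1, Nat.sub_lt z.u_pos Nat.one_pos⟩

/-- The total penalty of the gaps between consecutive matches. The natural-number subtractions
are exact because `i` and `j` are strictly increasing. -/
def innerGaps (g : ℕ → ℝ) (z : Alignment m n) : ℝ :=
  ∑ t : Fin (z.u - 1),
    (g ((z.i ⟨t.1 + 1, by have := t.isLt; omega⟩ : ℕ)
          - (z.i ⟨t.1, by have := t.isLt; omega⟩ : ℕ) - 1)
      + g ((z.j ⟨t.1 + 1, by have := t.isLt; omega⟩ : ℕ)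
          - (z.j ⟨t.1, by have := t.isLt; omega⟩ : ℕ) - 1))

end Alignment

variable {A : Type*} {m n : ℕ}

/-- The score `S_z(x, y)`: similarity scores of the matches minus penalties of the inner gaps. -/
def scoreS (K : A → A → ℝ) (g : ℕ → ℝ) (x : Fin m → A) (y : Fin n → A)
    (z : Alignment m n) : ℝ :=
  (∑ t : Fin z.u, K (x (z.i t)) (y (z.j t))) - z.innerGaps g

/-- The score `R_z(x, y)`, where the unaligned letters before the first and after the last match
are penalized as well. -/
def scoreR (K : A → A → ℝ) (g : ℕ → ℝ) (x : Fin m → A) (y : Fin n → A)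
    (z : Alignment m n) : ℝ :=
  scoreS K g x y z - g (z.i z.first : ℕ) - g (z.j z.first : ℕ)
    - g (m - 1 - (z.i z.last : ℕ)) - g (n - 1 - (z.j z.last : ℕ))

/-- The local alignment score `H(x, y) = sup_z S_z(x, y)`. There are finitely many alignments, and
at least one if both words are nonempty; the value for an empty word is irrelevant. -/
def localScore (K : A → A → ℝ) (g : ℕ → ℝ) (x : Fin m → A) (y : Fin n → A) : ℝ :=
  ⨆ z : Alignment m n, scoreS K g x y z

/-- The alignments with exactly `κ` matches one of which is the match of the two first letters. -/
def anchored (m n κ : ℕ) : Set (Alignment m n) :=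
  {z | (∃ t, (z.i t : ℕ) = 0 ∧ (z.j t : ℕ) = 0) ∧ z.u = κ}

/-- `G_κ(x, y)`, the maximum of `R_z(x, y)` over the alignments with exactly `κ` matches one of
which is the match of the two first letters (used only for words of lengths `≥ κ ≥ 1`). -/
def scoreG (K : A → A → ℝ) (g : ℕ → ℝ) (κ : ℕ) (x : Fin m → A) (y : Fin n → A) : ℝ :=
  ⨆ z : anchored m n κ, scoreR K g x y z.1

variable [Fintype A]

/-- `E exp[θ G_κ(x_m, y_n)]` for independent words `x_m`, `y_n` of lengths `m`, `n` whose letters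
are independent with distribution `μ`. -/
def mgf (K : A → A → ℝ) (g : ℕ → ℝ) (μ : A → ℝ) (κ : ℕ) (θ : ℝ) (m n : ℕ) : ℝ :=
  ∑ x : Fin m → A, ∑ y : Fin n → A,
    (∏ p, μ (x p)) * (∏ q, μ (y q)) * Real.exp (θ * scoreG K g κ x y)

/-- The terms, indexed by the pairs `(m, n)` with `m, n ≥ κ`, whose sum is `h_κ(θ)`. -/
def hTerm (K : A → A → ℝ) (g : ℕ → ℝ) (μ : A → ℝ) (κ : ℕ) (θ : ℝ)
    (p : {p : ℕ × ℕ // κ ≤ p.1 ∧ κ ≤ p.2}) : ℝ :=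
  mgf K g μ κ θ p.1.1 p.1.2

/-- `h_κ(θ) = ∑_{m, n ≥ κ} E exp[θ G_κ(x_m, y_n)]`. -/
def hKappa (K : A → A → ℝ) (g : ℕ → ℝ) (μ : A → ℝ) (κ : ℕ) (θ : ℝ) : ℝ :=
  ∑' p, hTerm K g μ κ θ p

/-- `ψ_κ(θ) = log h_κ(θ)`. -/
def psiKappa (K : A → A → ℝ) (g : ℕ → ℝ) (μ : A → ℝ) (κ : ℕ) (θ : ℝ) : ℝ :=
  Real.log (hKappa K g μ κ θ)

/-- `ψ(θ) = lim_{κ → ∞} ψ_κ(θ) / κ` (an arbitrary number if the limit does not exist). -/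
def psi (K : A → A → ℝ) (g : ℕ → ℝ) (μ : A → ℝ) (θ : ℝ) : ℝ :=
  limUnder atTop (fun κ : ℕ => psiKappa K g μ κ θ / κ)

/-- `θ` is the unique positive root of `f`. -/
def IsUniquePosRoot (f : ℝ → ℝ) (θ : ℝ) : Prop :=
  0 < θ ∧ f θ = 0 ∧ ∀ θ' : ℝ, 0 < θ' → f θ' = 0 → θ' = θ

end

end LocalAlignment

open LocalAlignment

/-!
# Large deviations and the strong law for local alignment scores

Cutting an alignment into pieces that begin with a match makes `G_κ` superadditive, so the moment
generating functions `E exp(θ G_κ(x_m, y_n))` are supermultiplicative in `(κ, m, n)`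
(`mgf_mul_le`). Their maximum over `m, n` (`maxMgf`) therefore has an exponential growth rate in
`κ`, by Fekete's lemma. A concave gap penalty is subadditive, whence `G_κ` is at most
`κ max K - g (m - κ) - g (n - κ)`; as `g` grows faster than the logarithm, `exp(-t g)` is summable
for every `t > 0`, and interpolation between the maximum and this bound shows that `h_κ` has the
same growth rate `ψ` (`hKappa_le`, `exists_tendsto_psiKappa`). Convexity is Hölder's inequality.
As `ψ(θ) ≤ θ max K`, the convex function `ψ` lies below its chords to the origin
(`convexOn_mul_le`), hence it is negative before a unique positive root `θt` and positive after it.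

Upper bounds. If `θ < θt`, then `∑_κ h_κ(θ) < ∞`, and the union bound over the factors of the two
words that an alignment spans gives `P(H ≥ c) ≤ C m n exp(-θ c)`
(`exists_measureReal_le_prefixH_le`).

Lower bounds. If `θ > θt`, then `E exp(θ G_κ(x_m, y_n)) > 1` for some `κ, m, n`
(`exists_one_lt_mgf`). Aligning `r` consecutive pairs of factors of lengths `m, n` reduces the
problem to ungapped scores of words over larger alphabets. The pairs of words that are typical for
the exponentially tilted law (`exists_tilted_typical`) have a score of at least `r D / θ` and
a probability of at least `exp(-r D) / 2`, which gives the large deviation rate. For the strong law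
one needs such pairs, of total score `2 r D / θ`, among the pairs of factors of two words of length
about `exp(r D)`. The second moment method (`wordMean_no_hit_le`) finds one if the
conditional probabilities of a hit, given one of the two words, are about the square root of the
probability of a hit. This holds after symmetrization (`symmetrized`): by the symmetry of `K` the
roles of the two sequences can be exchanged in a second half of the words, and the product of the
two conditional probabilities is controlled because the relative entropy of a joint law is at least
the sum of those of its marginals. Monotonicity of `H` and the Borel–Cantelli lemma along the
powers of two then give the almost sure limit.
-/

namespace LocalAlignment

variable {A : Type*}

/-! ### Anchored alignments, built match by match -/

/-- `AnchoredScore K g x y u m n s`: some alignment of the first `m` letters of `x` with the first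
`n` letters of `y` has exactly `u` matches, matches the two first letters, and has score `s`, the
unaligned letters after the last match being penalized. Such an alignment is a sequence of matches,
each followed by a gap of `a` letters of `x` and `b` letters of `y`; the empty alignment of
two empty words is allowed as a starting point. Infinite words are used so that prefixes and shifts
need no casts. -/
inductive AnchoredScore (K : A → A → ℝ) (g : ℕ → ℝ) (x y : ℕ → A) : ℕ → ℕ → ℕ → ℝ → Prop
  | nil : AnchoredScore K g x y 0 0 0 0
  | snoc {u m n : ℕ} {s : ℝ} (a b : ℕ) (h : AnchoredScore K g x y u m n s) :
      AnchoredScore K g x y (u + 1) (m + 1 + a) (n + 1 + b) (s + (K (x m) (y n) - g a - g b))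

namespace AnchoredScore

variable {K : A → A → ℝ} {g : ℕ → ℝ} {x y : ℕ → A} {u m n : ℕ} {s : ℝ}

lemma append {u' m' n' : ℕ} {s' : ℝ} (h : AnchoredScore K g x y u m n s)
    (h' : AnchoredScore K g (fun k => x (m + k)) (fun k => y (n + k)) u' m' n' s') :
    AnchoredScore K g x y (u + u') (m + m') (n + n') (s + s') := by
  induction h' with
  | nil => simpa using h
  | snoc a b h' ih =>
    have := ih.snoc a b
    convert this using 1 <;> ring

lemma symm (hK : ∀ a b, K a b = K b a) (h : AnchoredScore K g x y u m n s) :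
    AnchoredScore K g y x u n m s := by
  induction h with
  | nil => exact nil
  | snoc a b h ih =>
    have := ih.snoc b a
    convert this using 1
    rw [hK]; ring

lemma le_left (h : AnchoredScore K g x y u m n s) : u ≤ m := by
  induction h with
  | nil => exact le_rfl
  | snoc a b h ih => omega

lemma le_right (h : AnchoredScore K g x y u m n s) : u ≤ n := by
  induction h with
  | nil => exact le_rfl
  | snoc a b h ih => omega

lemma one : AnchoredScore K g x y 1 1 1 (K (x 0) (y 0) - g 0 - g 0) := by
  simpa using (nil (K := K) (g := g) (x := x) (y := y)).snoc 0 0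

lemma exists_diag (u : ℕ) : ∃ s, AnchoredScore K g x y u u u s := by
  induction u with
  | zero => exact ⟨0, nil⟩
  | succ u ih => obtain ⟨s, hs⟩ := ih; exact ⟨_, hs.snoc 0 0⟩

lemma exists_of_le (hu : 0 < u) (hm : u ≤ m) (hn : u ≤ n) : ∃ s, AnchoredScore K g x y u m n s := by
  obtain ⟨v, rfl⟩ : ∃ v, u = v + 1 := ⟨u - 1, by omega⟩
  obtain ⟨s, hs⟩ := exists_diag (K := K) (g := g) (x := x) (y := y) v
  have := hs.snoc (m - (v + 1)) (n - (v + 1))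
  rw [show v + 1 + (m - (v + 1)) = m by omega, show v + 1 + (n - (v + 1)) = n by omega] at this
  exact ⟨_, this⟩

/-- An anchored alignment, described by the increasing positions `i t`, `j t` of its matches,
with `i u` and `j u` the word lengths. -/
lemma exists_positions (h : AnchoredScore K g x y u m n s) :
    ∃ i j : ℕ → ℕ, i 0 = 0 ∧ j 0 = 0 ∧ i u = m ∧ j u = n ∧
      (∀ t < u, i t < i (t + 1) ∧ j t < j (t + 1)) ∧
      s = ∑ t ∈ Finset.range u, (K (x (i t)) (y (j t)) - g (i (t + 1) - i t - 1)
        - g (j (t + 1) - j t - 1)) := by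
  induction h with
  | nil => exact ⟨fun _ => 0, fun _ => 0, by simp⟩
  | @snoc u m n s a b h ih =>
    obtain ⟨i, j, hi0, hj0, hiu, hju, hlt, rfl⟩ := ih
    refine ⟨fun t => if t ≤ u then i t else m + 1 + a, fun t => if t ≤ u then j t else n + 1 + b,
      by simp [hi0], by simp [hj0], by simp, by simp, ?_, ?_⟩
    · intro t ht
      rcases Nat.lt_or_ge t u with h1 | h1
      · have h2 : t + 1 ≤ u := h1
        simpa [h1.le, h2] using hlt t h1
      · have : t = u := by omega
        subst this
        simp only [le_refl, if_true, hiu, hju]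
        have : ¬ (t + 1 ≤ t) := by omega
        simp only [this, if_false]
        omega
    · rw [Finset.sum_range_succ]
      have h1 : ¬ (u + 1 ≤ u) := by omega
      simp only [le_refl, if_true, hiu, hju, h1, if_false]
      congr 1
      · refine Finset.sum_congr rfl fun t ht => ?_
        have ht' : t < u := Finset.mem_range.1 ht
        have h2 : t + 1 ≤ u := ht'
        simp [ht'.le, h2]
      · rw [show m + 1 + a - m - 1 = a by omega, show n + 1 + b - n - 1 = b by omega]

end AnchoredScore

lemma IsGapPenalty.nonneg {g : ℕ → ℝ} (hg : IsGapPenalty g) (k : ℕ) : 0 ≤ g k :=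
  hg.zero ▸ hg.mono (Nat.zero_le k)

lemma IsGapPenalty.succ_sub_antitone {g : ℕ → ℝ} (hg : IsGapPenalty g) :
    Antitone fun k => g (k + 1) - g k :=
  antitone_nat_of_succ_le fun k => hg.concave k

/-- A gap penalty is subadditive, because it is concave and vanishes at `0`. -/
lemma IsGapPenalty.add_le {g : ℕ → ℝ} (hg : IsGapPenalty g) (a b : ℕ) :
    g (a + b) ≤ g a + g b := by
  induction b with
  | zero => simp [hg.zero]
  | succ b ih =>
    have := hg.succ_sub_antitone (Nat.le_add_left b a)
    simp only at this
    rw [← add_assoc]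
    linarith

/-- One long gap costs less than several gaps of the same total length, so the `m - u` and `n - u`
unmatched letters cost at least `g (m - u) + g (n - u)`. -/
lemma AnchoredScore.le_of_isGapPenalty {K : A → A → ℝ} {g : ℕ → ℝ} {x y : ℕ → A} {u m n : ℕ} {s : ℝ}
    (hg : IsGapPenalty g) {k : ℝ} (hk : ∀ a b, K a b ≤ k) (h : AnchoredScore K g x y u m n s) :
    s ≤ u * k - g (m - u) - g (n - u) := by
  induction h with
  | nil => simp [hg.zero]
  | @snoc u m n s a b h ih =>
    have h1 := h.le_left
    have h2 := h.le_right
    rw [show m + 1 + a - (u + 1) = (m - u) + a by omega,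
      show n + 1 + b - (u + 1) = (n - u) + b by omega]
    have := hg.add_le (m - u) a
    have := hg.add_le (n - u) b
    have := hk (x m) (y n)
    push_cast
    linarith

/-! ### Anchored alignments and the scores `G` and `H` -/

instance (m n : ℕ) : Finite (Alignment m n) := by
  have hu : ∀ z : Alignment m n, z.u < m + 1 := fun z => by
    have := Fintype.card_le_of_injective _ z.i_strictMono.injective
    simp at this
    omega
  let f : Alignment m n → Σ u : Fin (m + 1), (Fin u → Fin m) × (Fin u → Fin n) :=
    fun z => ⟨⟨z.u, hu z⟩, z.i, z.j⟩
  refine Finite.of_injective f ?_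
  rintro ⟨u, hu, i, j, hi, hj⟩ ⟨u', hu', i', j', hi', hj'⟩ h
  simp only [f, Sigma.mk.injEq, Fin.mk.injEq] at h
  obtain ⟨rfl, h⟩ := h
  simp only [heq_eq_eq, Prod.mk.injEq] at h
  obtain ⟨rfl, rfl⟩ := h
  rfl

lemma lt_of_forall_lt_succ {f : ℕ → ℕ} {u : ℕ} (h : ∀ t < u, f t < f (t + 1)) {s t : ℕ}
    (hst : s < t) (htu : t ≤ u) : f s < f t := by
  induction t with
  | zero => omega
  | succ t ih =>
    have h1 := h t (by omega)
    rcases Nat.lt_or_ge s t with h2 | h2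
    · exact (ih h2 (by omega)).trans h1
    · have : s = t := by omega
      rwa [this]

/-- An anchored alignment of two factors is an alignment of the whole words, whose score
`scoreS` forgets the penalties of the gaps after the last match. -/
lemma AnchoredScore.exists_alignment {K : A → A → ℝ} {g : ℕ → ℝ} {x y : ℕ → A} {u m n : ℕ} {s : ℝ}
    {a b M N : ℕ} (h : AnchoredScore K g (fun k => x (a + k)) (fun k => y (b + k)) u m n s)
    (hu : 0 < u) (hM : a + m ≤ M) (hN : b + n ≤ N) :
    ∃ z : Alignment M N, z.u = u ∧ (z.i z.first : ℕ) = a ∧ (z.j z.first : ℕ) = b ∧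
      scoreS K g (fun p : Fin M => x p) (fun q : Fin N => y q) z
        = s + g (a + m - 1 - z.i z.last) + g (b + n - 1 - z.j z.last) := by
  obtain ⟨i, j, hi0, hj0, hiu, hju, hlt, rfl⟩ := h.exists_positions
  obtain ⟨v, rfl⟩ : ∃ v, u = v + 1 := ⟨u - 1, by omega⟩
  have hi : ∀ s t, s < t → t ≤ v + 1 → i s < i t := fun s t h1 h2 =>
    lt_of_forall_lt_succ (fun t ht => (hlt t ht).1) h1 h2
  have hj : ∀ s t, s < t → t ≤ v + 1 → j s < j t := fun s t h1 h2 =>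
    lt_of_forall_lt_succ (fun t ht => (hlt t ht).2) h1 h2
  let z : Alignment M N :=
    { u := v + 1
      u_pos := by omega
      i := fun t => ⟨a + i t, by have := hi t (v + 1) t.2 le_rfl; omega⟩
      j := fun t => ⟨b + j t, by have := hj t (v + 1) t.2 le_rfl; omega⟩
      i_strictMono := fun s t hst => by
        have := hi s t hst (by omega)
        simpa using this
      j_strictMono := fun s t hst => by
        have := hj s t hst (by omega)
        simpa using this }
  refine ⟨z, rfl, ?_, ?_, ?_⟩
  · simp [z, Alignment.first, hi0]
  · simp [z, Alignment.first, hj0]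
  · have e1 : scoreS K g (fun p : Fin M => x p) (fun q : Fin N => y q) z
        = ∑ t ∈ Finset.range (v + 1), K (x (a + i t)) (y (b + j t))
          - ∑ t ∈ Finset.range v, (g (i (t + 1) - i t - 1) + g (j (t + 1) - j t - 1)) := by
      rw [Finset.sum_range, Finset.sum_range, scoreS, Alignment.innerGaps]
      congr 1
      refine Finset.sum_congr rfl fun t _ => ?_
      simp only [z]
      rw [show a + i (t + 1) - (a + i t) = i (t + 1) - i t by omega,
        show b + j (t + 1) - (b + j t) = j (t + 1) - j t by omega]
    have e2 : (z.i z.last : ℕ) = a + i v := rfl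
    have e3 : (z.j z.last : ℕ) = b + j v := rfl
    rw [e1, e2, e3, ← hiu, ← hju,
      show a + i (v + 1) - 1 - (a + i v) = i (v + 1) - i v - 1 by omega,
      show b + j (v + 1) - 1 - (b + j v) = j (v + 1) - j v - 1 by omega,
      Finset.sum_range_succ, Finset.sum_range_succ]
    simp only [Finset.sum_sub_distrib, Finset.sum_add_distrib]
    ring

/-- Conversely, an alignment is an anchored alignment of the factors that begin with its
first match; the lengths `e`, `f` of the gaps left after its last match are free. -/
lemma Alignment.anchoredScore {K : A → A → ℝ} {g : ℕ → ℝ} {x y : ℕ → A} {M N : ℕ}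
    (z : Alignment M N) (e f : ℕ) :
    AnchoredScore K g (fun k => x ((z.i z.first : ℕ) + k)) (fun k => y ((z.j z.first : ℕ) + k)) z.u
      ((z.i z.last : ℕ) - z.i z.first + 1 + e) ((z.j z.last : ℕ) - z.j z.first + 1 + f)
      (scoreS K g (fun p : Fin M => x p) (fun q : Fin N => y q) z - g e - g f) := by
  obtain ⟨u, hu, i, j, hi, hj⟩ := z
  obtain ⟨v, rfl⟩ : ∃ v, u = v + 1 := ⟨u - 1, by omega⟩
  set z : Alignment M N := ⟨v + 1, hu, i, j, hi, hj⟩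
  have hf : z.first = (0 : Fin (v + 1)) := rfl
  have hl : z.last = Fin.last v := rfl
  rw [hf, hl]
  have key : ∀ w (hw : w < v + 1),
      AnchoredScore K g (fun k => x ((i 0 : ℕ) + k)) (fun k => y ((j 0 : ℕ) + k)) w
        ((i ⟨w, hw⟩ : ℕ) - i 0) ((j ⟨w, hw⟩ : ℕ) - j 0)
        (∑ t : Fin w, (K (x (i ⟨t, by omega⟩)) (y (j ⟨t, by omega⟩))
          - g ((i ⟨t + 1, by omega⟩ : ℕ) - (i ⟨t, by omega⟩ : ℕ) - 1)
          - g ((j ⟨t + 1, by omega⟩ : ℕ) - (j ⟨t, by omega⟩ : ℕ) - 1))) := by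
    intro w
    induction w with
    | zero => intro hw; simpa using AnchoredScore.nil
    | succ w ih =>
      intro hw
      have hi0 : i 0 ≤ i ⟨w, by omega⟩ := hi.monotone (Fin.zero_le _)
      have hj0 : j 0 ≤ j ⟨w, by omega⟩ := hj.monotone (Fin.zero_le _)
      have hi1 : i ⟨w, by omega⟩ < i ⟨w + 1, hw⟩ := hi (by simp)
      have hj1 : j ⟨w, by omega⟩ < j ⟨w + 1, hw⟩ := hj (by simp)
      rw [Fin.le_def] at hi0 hj0
      rw [Fin.lt_def] at hi1 hj1
      have := (ih (by omega)).snoc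
        ((i ⟨w + 1, hw⟩ : ℕ) - (i ⟨w, by omega⟩ : ℕ) - 1)
        ((j ⟨w + 1, hw⟩ : ℕ) - (j ⟨w, by omega⟩ : ℕ) - 1)
      convert this using 1
      · omega
      · omega
      · rw [Fin.sum_univ_castSucc]
        simp only [Fin.val_castSucc, Fin.val_last]
        rw [show (i 0 : ℕ) + ((i ⟨w, by omega⟩ : ℕ) - i 0) = i ⟨w, by omega⟩ by omega,
          show (j 0 : ℕ) + ((j ⟨w, by omega⟩ : ℕ) - j 0) = j ⟨w, by omega⟩ by omega]
  have := (key v (by omega)).snoc e f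
  have hi0 : i 0 ≤ i (Fin.last v) := hi.monotone (Fin.zero_le _)
  have hj0 : j 0 ≤ j (Fin.last v) := hj.monotone (Fin.zero_le _)
  rw [Fin.le_def] at hi0 hj0
  convert this using 1
  · rfl
  · rfl
  have hs : scoreS K g (fun p : Fin M => x p) (fun q : Fin N => y q) z
      = ∑ t : Fin (v + 1), K (x (i t)) (y (j t)) - ∑ t : Fin v,
        (g ((i ⟨t + 1, by omega⟩ : ℕ) - (i ⟨t, by omega⟩ : ℕ) - 1)
          + g ((j ⟨t + 1, by omega⟩ : ℕ) - (j ⟨t, by omega⟩ : ℕ) - 1)) := rfl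
  rw [hs, Fin.sum_univ_castSucc]
  rw [show (i 0 : ℕ) + ((i ⟨v, by omega⟩ : ℕ) - i 0) = i (Fin.last v) by
      change (i 0 : ℕ) + ((i (Fin.last v) : ℕ) - i 0) = _; omega,
    show (j 0 : ℕ) + ((j ⟨v, by omega⟩ : ℕ) - j 0) = j (Fin.last v) by
      change (j 0 : ℕ) + ((j (Fin.last v) : ℕ) - j 0) = _; omega]
  simp only [Finset.sum_sub_distrib, Finset.sum_add_distrib]
  have e1 : ∀ t : Fin v, t.castSucc = ⟨t, by omega⟩ := fun t => rfl
  simp only [e1]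
  ring

section Scores

variable {K : A → A → ℝ} {g : ℕ → ℝ} {x y : ℕ → A} {u m n : ℕ} {s : ℝ}

/-- `G_κ` of the prefixes of lengths `m` and `n` of two infinite words. -/
noncomputable def prefixG (K : A → A → ℝ) (g : ℕ → ℝ) (κ m n : ℕ) (x y : ℕ → A) : ℝ :=
  scoreG K g κ (fun p : Fin m => x p) (fun q : Fin n => y q)

/-- `H` of the prefixes of lengths `m` and `n` of two infinite words. -/
noncomputable def prefixH (K : A → A → ℝ) (g : ℕ → ℝ) (m n : ℕ) (x y : ℕ → A) : ℝ :=
  localScore K g (fun p : Fin m => x p) (fun q : Fin n => y q)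

lemma AnchoredScore.le_prefixG (hg : g 0 = 0) (hu : 0 < u) (h : AnchoredScore K g x y u m n s) :
    s ≤ prefixG K g u m n x y := by
  obtain ⟨z, hzu, hi, hj, hz⟩ := AnchoredScore.exists_alignment (x := x) (y := y) (a := 0) (b := 0)
    (M := m) (N := n) (by simpa using h) hu (by omega) (by omega)
  have hmem : z ∈ anchored m n u := ⟨⟨z.first, hi, hj⟩, hzu⟩
  refine le_trans (le_of_eq ?_) (le_ciSup (f := fun z : anchored m n u =>
    scoreR K g (fun p : Fin m => x p) (fun q : Fin n => y q) z.1)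
    (Set.finite_range _).bddAbove ⟨z, hmem⟩)
  simp only [scoreR, hz, hi, hj, hg, zero_add]
  ring

lemma anchoredScore_prefixG (hg : g 0 = 0) (hu : 0 < u) (hm : u ≤ m) (hn : u ≤ n) :
    AnchoredScore K g x y u m n (prefixG K g u m n x y) := by
  have hne : Nonempty (anchored m n u) := by
    obtain ⟨s, hs⟩ := AnchoredScore.exists_of_le (K := K) (g := g) (x := x) (y := y) hu hm hn
    obtain ⟨z, hzu, hi, hj, hz⟩ := AnchoredScore.exists_alignment (x := x) (y := y) (a := 0) (b := 0)
      (M := m) (N := n) (by simpa using hs) hu (by omega) (by omega)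
    exact ⟨z, ⟨z.first, hi, hj⟩, hzu⟩
  obtain ⟨⟨z, ⟨t, hti, htj⟩, hzu⟩, hz⟩ := exists_eq_ciSup_of_finite
    (f := fun z : anchored m n u => scoreR K g (fun p : Fin m => x p) (fun q : Fin n => y q) z.1)
  have hle : z.first ≤ t := Fin.mk_le_of_le_val (Nat.zero_le _)
  have hi : (z.i z.first : ℕ) = 0 := by
    have := z.i_strictMono.monotone hle
    rw [Fin.le_def] at this; omega
  have hj : (z.j z.first : ℕ) = 0 := by
    have := z.j_strictMono.monotone hle
    rw [Fin.le_def] at this; omega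
  have := z.anchoredScore (K := K) (g := g) (x := x) (y := y) (m - 1 - z.i z.last)
    (n - 1 - z.j z.last)
  have h1 := (z.i z.last).2
  have h2 := (z.j z.last).2
  rw [hi, hj, hzu] at this
  rw [show (z.i z.last : ℕ) - 0 + 1 + (m - 1 - z.i z.last) = m by omega,
    show (z.j z.last : ℕ) - 0 + 1 + (n - 1 - z.j z.last) = n by omega] at this
  simp only [zero_add] at this
  convert this using 1
  rw [prefixG, scoreG, ← hz]
  simp only [scoreR, hi, hj, hg]
  ring

lemma prefixG_append (hg : g 0 = 0) {u' m' n' : ℕ} (hu : 0 < u) (hm : u ≤ m) (hn : u ≤ n)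
    (hu' : 0 < u') (hm' : u' ≤ m') (hn' : u' ≤ n') :
    prefixG K g u m n x y + prefixG K g u' m' n' (fun k => x (m + k)) (fun k => y (n + k))
      ≤ prefixG K g (u + u') (m + m') (n + n') x y :=
  ((anchoredScore_prefixG hg hu hm hn).append (anchoredScore_prefixG hg hu' hm' hn')).le_prefixG hg
    (by omega)

lemma AnchoredScore.le_prefixH (hg : ∀ k, 0 ≤ g k) {a b M N : ℕ} (hu : 0 < u)
    (hM : a + m ≤ M) (hN : b + n ≤ N)
    (h : AnchoredScore K g (fun k => x (a + k)) (fun k => y (b + k)) u m n s) :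
    s ≤ prefixH K g M N x y := by
  obtain ⟨z, -, -, -, hz⟩ := h.exists_alignment hu hM hN
  refine le_trans ?_ (le_ciSup (f := fun z : Alignment M N =>
    scoreS K g (fun p : Fin M => x p) (fun q : Fin N => y q) z) (Set.finite_range _).bddAbove z)
  rw [hz]
  linarith [hg (a + m - 1 - z.i z.last), hg (b + n - 1 - z.j z.last)]

/-- The local score is attained by an anchored alignment of two factors. -/
lemma exists_anchoredScore_prefixH (hg : g 0 = 0) {M N : ℕ} (hM : 0 < M) (hN : 0 < N) :
    ∃ a b u m n, 0 < u ∧ a + m ≤ M ∧ b + n ≤ N ∧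
      AnchoredScore K g (fun k => x (a + k)) (fun k => y (b + k)) u m n (prefixH K g M N x y) := by
  have hne : Nonempty (Alignment M N) := by
    obtain ⟨z, -⟩ := AnchoredScore.exists_alignment (K := K) (g := g) (x := x) (y := y) (a := 0)
      (b := 0) (M := M) (N := N) AnchoredScore.one one_pos (by omega) (by omega)
    exact ⟨z⟩
  obtain ⟨z, hz⟩ := exists_eq_ciSup_of_finite
    (f := fun z : Alignment M N => scoreS K g (fun p : Fin M => x p) (fun q : Fin N => y q) z)
  have := z.anchoredScore (K := K) (g := g) (x := x) (y := y) 0 0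
  have hle : z.first ≤ z.last := Fin.mk_le_of_le_val (Nat.zero_le _)
  have h1 := z.i_strictMono.monotone hle
  have h2 := z.j_strictMono.monotone hle
  rw [Fin.le_def] at h1 h2
  have h3 := (z.i z.last).2
  have h4 := (z.j z.last).2
  refine ⟨z.i z.first, z.j z.first, z.u, (z.i z.last : ℕ) - z.i z.first + 1 + 0,
    (z.j z.last : ℕ) - z.j z.first + 1 + 0, z.u_pos, by omega, by omega, ?_⟩
  convert this using 1
  rw [hg, prefixH, localScore, ← hz]; ring

lemma prefixH_mono (hg : IsGapPenalty g) {M N M' N' : ℕ} (hM : 0 < M) (hN : 0 < N) (hMM' : M ≤ M')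
    (hNN' : N ≤ N') : prefixH K g M N x y ≤ prefixH K g M' N' x y := by
  obtain ⟨a, b, u, m, n, hu, ham, hbn, h⟩ :=
    exists_anchoredScore_prefixH (K := K) (x := x) (y := y) hg.zero hM hN
  exact h.le_prefixH hg.nonneg hu (by omega) (by omega)

lemma prefixG_le (hg : IsGapPenalty g) {k : ℝ} (hk : ∀ a b, K a b ≤ k) (hu : 0 < u) (hm : u ≤ m)
    (hn : u ≤ n) : prefixG K g u m n x y ≤ u * k - g (m - u) - g (n - u) :=
  (anchoredScore_prefixG hg.zero hu hm hn).le_of_isGapPenalty hg hk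

/-- Removing the last match. -/
lemma exists_prefixG_succ_eq (hg : g 0 = 0) (hm : u + 1 ≤ m) (hn : u + 1 ≤ n) :
    ∃ m' n' s, m' < m ∧ n' < n ∧ AnchoredScore K g x y u m' n' s ∧
      prefixG K g (u + 1) m n x y
        = s + (K (x m') (y n') - g (m - m' - 1) - g (n - n' - 1)) := by
  have h := anchoredScore_prefixG (K := K) (x := x) (y := y) hg u.succ_pos hm hn
  generalize prefixG K g (u + 1) m n x y = r at h
  cases h with
  | @snoc _ m n s a b h =>
    refine ⟨m, n, s, by omega, by omega, h, ?_⟩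
    rw [show m + 1 + a - m - 1 = a by omega, show n + 1 + b - n - 1 = b by omega]

lemma prefixG_one_one (hg : g 0 = 0) : prefixG K g 1 1 1 x y = K (x 0) (y 0) := by
  obtain ⟨m', n', s, hm', hn', h, he⟩ :=
    exists_prefixG_succ_eq (K := K) (x := x) (y := y) (u := 0) hg le_rfl le_rfl
  obtain rfl : m' = 0 := by omega
  obtain rfl : n' = 0 := by omega
  cases h
  simpa [hg] using he

/-- The score of `r` consecutive pairs of factors of lengths `m` and `n`. -/
lemma AnchoredScore.sum_prefixG (hg : g 0 = 0) (hu : 0 < u) (hm : u ≤ m) (hn : u ≤ n) (r : ℕ) :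
    AnchoredScore K g x y (r * u) (r * m) (r * n)
      (∑ t ∈ Finset.range r,
        prefixG K g u m n (fun k => x (t * m + k)) (fun k => y (t * n + k))) := by
  induction r with
  | zero => simpa using AnchoredScore.nil
  | succ r ih =>
    rw [Finset.sum_range_succ, Nat.succ_mul, Nat.succ_mul, Nat.succ_mul]
    exact ih.append (anchoredScore_prefixG hg hu hm hn)

end Scores

/-! ### Expectations over random finite words -/

section WordMean

variable {A : Type*} [Fintype A] {I J : Type*} [Fintype I] [DecidableEq I] [Fintype J]
  [DecidableEq J]

/-- The expectation of `F` for a random word with independent letters of distribution `μ`, whose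
positions form the finite type `I`. -/
noncomputable def wordMean (μ : A → ℝ) (F : (I → A) → ℝ) : ℝ := ∑ x, (∏ i, μ (x i)) * F x

variable {μ : A → ℝ}

lemma sum_prod_eq_one (hs : ∑ a, μ a = 1) : ∑ x : I → A, ∏ i, μ (x i) = 1 := by
  have := (Finset.prod_univ_sum (fun _ : I => (Finset.univ : Finset A)) (fun _ a => μ a)).symm
  rw [Fintype.piFinset_univ] at this
  rw [this, hs, Finset.prod_const_one]

lemma wordMean_const (hs : ∑ a, μ a = 1) (c : ℝ) : wordMean μ (fun _ : I → A => c) = c := by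
  rw [wordMean, ← Finset.sum_mul, sum_prod_eq_one hs, one_mul]

lemma wordMean_mono (hμ : ∀ a, 0 < μ a) {F G : (I → A) → ℝ} (h : ∀ x, F x ≤ G x) :
    wordMean μ F ≤ wordMean μ G :=
  Finset.sum_le_sum fun x _ => mul_le_mul_of_nonneg_left (h x)
    (Finset.prod_nonneg fun i _ => (hμ (x i)).le)

lemma wordMean_pos [Nonempty A] (hμ : ∀ a, 0 < μ a) {F : (I → A) → ℝ} (h : ∀ x, 0 < F x) :
    0 < wordMean μ F :=
  Finset.sum_pos (fun x _ => mul_pos (Finset.prod_pos fun i _ => hμ (x i)) (h x))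
    Finset.univ_nonempty

lemma wordMean_mul_const (F : (I → A) → ℝ) (c : ℝ) :
    wordMean μ (fun x => F x * c) = wordMean μ F * c := by
  simp only [wordMean, Finset.sum_mul, mul_assoc]

lemma wordMean_finset_sum {ι : Type*} (s : Finset ι) (F : ι → (I → A) → ℝ) :
    wordMean μ (fun x => ∑ k ∈ s, F k x) = ∑ k ∈ s, wordMean μ (F k) := by
  simp only [wordMean, Finset.mul_sum]
  exact Finset.sum_comm

lemma wordMean_sum (F : (I ⊕ J → A) → ℝ) :
    wordMean μ F = wordMean μ (fun x : I → A => wordMean μ fun y : J → A => F (Sum.elim x y)) := by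
  simp only [wordMean]
  rw [← (Equiv.sumArrowEquivProdArrow I J A).symm.sum_comp, Fintype.sum_prod_type]
  refine Finset.sum_congr rfl fun x _ => ?_
  rw [Finset.mul_sum]
  refine Finset.sum_congr rfl fun y _ => ?_
  rw [Fintype.prod_sum_type, ← mul_assoc]
  rfl

lemma wordMean_equiv (e : J ≃ I) (F : (I → A) → ℝ) :
    wordMean μ F = wordMean μ fun y : J → A => F (y ∘ e.symm) := by
  simp only [wordMean]
  rw [← (e.arrowCongr (Equiv.refl A)).sum_comp]
  refine Finset.sum_congr rfl fun y _ => ?_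
  congr 1
  rw [← e.prod_comp]
  simp

/-- The letters at distinct positions form a random word. -/
lemma wordMean_comp (hs : ∑ a, μ a = 1) {σ : J → I} (hσ : σ.Injective) (F : (J → A) → ℝ) :
    wordMean μ (fun x : I → A => F (x ∘ σ)) = wordMean μ F := by
  classical
  let e : J ⊕ ((Set.range σ)ᶜ : Set I) ≃ I :=
    ((Equiv.ofInjective σ hσ).sumCongr (Equiv.refl _)).trans (Equiv.Set.sumCompl _)
  have he : ∀ j, e.symm (σ j) = Sum.inl j := fun j => by
    rw [Equiv.symm_apply_eq]; rfl
  rw [wordMean_equiv e, wordMean_sum]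
  have : ∀ (y : J → A) (z : ((Set.range σ)ᶜ : Set I) → A),
      (Sum.elim y z ∘ e.symm) ∘ σ = y := fun y z => by
    funext j; simp [he]
  simp only [this, wordMean_const hs]

/-- Factors at disjoint positions are independent. -/
lemma wordMean_mul (hs : ∑ a, μ a = 1) {L : Type*} [Fintype L] [DecidableEq L] {σ : I → L}
    {τ : J → L} (h : (Sum.elim σ τ).Injective) (F : (I → A) → ℝ) (G : (J → A) → ℝ) :
    wordMean μ (fun x : L → A => F (x ∘ σ) * G (x ∘ τ)) = wordMean μ F * wordMean μ G := by
  have := wordMean_comp (μ := μ) hs h (fun z => F (z ∘ Sum.inl) * G (z ∘ Sum.inr))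
  simp only [Function.comp_assoc, Sum.elim_comp_inl, Sum.elim_comp_inr] at this
  rw [this, wordMean_sum]
  simp only [Sum.elim_comp_inl, Sum.elim_comp_inr]
  simp only [wordMean, Finset.mul_sum, Finset.sum_mul]
  rw [Finset.sum_comm]
  refine Finset.sum_congr rfl fun _ _ => Finset.sum_congr rfl fun _ _ => by ring

end WordMean

/-! ### The moment generating functions of the scores `G_κ` -/

section Mgf

variable {A : Type*} [Fintype A] {K : A → A → ℝ} {g : ℕ → ℝ} {μ : A → ℝ} {κ m n : ℕ} {θ : ℝ}

/-- A finite word, continued arbitrarily to an infinite one. -/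
noncomputable def toSeq [Nonempty A] {N : ℕ} (x : Fin N → A) (k : ℕ) : A :=
  if h : k < N then x ⟨k, h⟩ else Classical.arbitrary A

omit [Fintype A] in
lemma toSeq_of_lt [Nonempty A] {N : ℕ} (x : Fin N → A) {k : ℕ} (h : k < N) :
    toSeq x k = x ⟨k, h⟩ := dif_pos h

lemma mgf_eq_wordMean : mgf K g μ κ θ m n = wordMean μ fun z : Fin m ⊕ Fin n → A =>
    Real.exp (θ * scoreG K g κ (z ∘ Sum.inl) (z ∘ Sum.inr)) := by
  rw [wordMean_sum, mgf]
  simp only [wordMean, Finset.mul_sum, mul_assoc]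
  rfl

/-- Two factors of a pair of words, of lengths `m` and `n` and starting at positions
`a` and `b`. -/
def factorEmb {N a b : ℕ} (hm : a + m ≤ N) (hn : b + n ≤ N) : Fin m ⊕ Fin n → Fin N ⊕ Fin N :=
  Sum.map (fun p => ⟨a + p, by omega⟩) (fun q => ⟨b + q, by omega⟩)

lemma factorEmb_injective {N a b : ℕ} (hm : a + m ≤ N) (hn : b + n ≤ N) :
    (factorEmb hm hn).Injective := by
  refine Function.Injective.sumMap ?_ ?_ <;>
  · intro p q h
    simpa [Fin.ext_iff] using h

omit [Fintype A] in
lemma prefixG_toSeq [Nonempty A] {N a b : ℕ} (hm : a + m ≤ N) (hn : b + n ≤ N)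
    (z : Fin N ⊕ Fin N → A) :
    prefixG K g κ m n (fun k => toSeq (z ∘ Sum.inl) (a + k)) (fun k => toSeq (z ∘ Sum.inr) (b + k))
      = scoreG K g κ ((z ∘ factorEmb hm hn) ∘ Sum.inl) ((z ∘ factorEmb hm hn) ∘ Sum.inr) := by
  rw [prefixG]
  congr 1
  · funext p
    rw [toSeq_of_lt _ (by omega)]
    rfl
  · funext p
    rw [toSeq_of_lt _ (by omega)]
    rfl

lemma mgf_eq_prefix [Nonempty A] (hs : ∑ a, μ a = 1) {N : ℕ} (hm : m ≤ N) (hn : n ≤ N) :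
    mgf K g μ κ θ m n = wordMean μ fun z : Fin N ⊕ Fin N → A =>
      Real.exp (θ * prefixG K g κ m n (toSeq (z ∘ Sum.inl)) (toSeq (z ∘ Sum.inr))) := by
  rw [mgf_eq_wordMean, ← wordMean_comp hs (factorEmb_injective (N := N) (a := 0) (b := 0)
    (by omega) (by omega))]
  refine congrArg _ (funext fun z => ?_)
  have := prefixG_toSeq (K := K) (g := g) (κ := κ) (N := N) (a := 0) (b := 0) (m := m) (n := n)
    (by omega) (by omega) z
  simp only [zero_add] at this
  rw [this]

lemma mgf_pos [Nonempty A] (hμ : ∀ a, 0 < μ a) : 0 < mgf K g μ κ θ m n := by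
  rw [mgf_eq_wordMean]
  exact wordMean_pos hμ fun _ => Real.exp_pos _

lemma mgf_le [Nonempty A] (hμ : ∀ a, 0 < μ a) (hs : ∑ a, μ a = 1) (hg : IsGapPenalty g) {k : ℝ}
    (hk : ∀ a b, K a b ≤ k) (hθ : 0 ≤ θ) (hκ : 0 < κ) (hm : κ ≤ m) (hn : κ ≤ n) :
    mgf K g μ κ θ m n ≤ Real.exp (θ * (κ * k)) * (Real.exp (-θ * g (m - κ)) *
      Real.exp (-θ * g (n - κ))) := by
  rw [← Real.exp_add, ← Real.exp_add, mgf_eq_prefix hs (N := max m n) (le_max_left _ _)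
    (le_max_right _ _)]
  refine (wordMean_mono hμ fun z => ?_).trans (wordMean_const hs _).le
  refine Real.exp_le_exp.2 ?_
  have := mul_le_mul_of_nonneg_left (prefixG_le (x := toSeq (z ∘ Sum.inl))
    (y := toSeq (z ∘ Sum.inr)) hg hk hκ hm hn) hθ
  linarith

/-- Consecutive factors of a pair of random words are independent. -/
lemma wordMean_prefixG_mul [Nonempty A] (hs : ∑ a, μ a = 1) {N κ' m' n' : ℕ} (hm : m + m' ≤ N)
    (hn : n + n' ≤ N) :
    wordMean μ (fun z : Fin N ⊕ Fin N → A =>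
      Real.exp (θ * prefixG K g κ m n (toSeq (z ∘ Sum.inl)) (toSeq (z ∘ Sum.inr)))
        * Real.exp (θ * prefixG K g κ' m' n' (fun k => toSeq (z ∘ Sum.inl) (m + k))
          (fun k => toSeq (z ∘ Sum.inr) (n + k))))
      = mgf K g μ κ θ m n * mgf K g μ κ' θ m' n' := by
  have h1 : 0 + m ≤ N := by omega
  have h2 : 0 + n ≤ N := by omega
  have hinj : (Sum.elim (factorEmb h1 h2) (factorEmb hm hn)).Injective := by
    refine (factorEmb_injective _ _).sumElim (factorEmb_injective _ _) ?_
    rintro (p | p) (q | q) h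
    · have h := Fin.ext_iff.1 (Sum.inl.inj h)
      have := p.2
      simp only at h
      omega
    · simp [factorEmb] at h
    · simp [factorEmb] at h
    · have h := Fin.ext_iff.1 (Sum.inr.inj h)
      have := p.2
      simp only at h
      omega
  rw [mgf_eq_wordMean, mgf_eq_wordMean, ← wordMean_mul hs hinj]
  refine congrArg _ (funext fun z => ?_)
  have e := prefixG_toSeq (K := K) (g := g) (κ := κ) h1 h2 z
  simp only [zero_add] at e
  rw [e, prefixG_toSeq hm hn]

/-- Joining alignments makes the moment generating functions supermultiplicative. -/
lemma mgf_mul_le [Nonempty A] (hμ : ∀ a, 0 < μ a) (hs : ∑ a, μ a = 1) (hg : g 0 = 0) (hθ : 0 ≤ θ)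
    {κ' m' n' : ℕ} (hκ : 0 < κ) (hm : κ ≤ m) (hn : κ ≤ n) (hκ' : 0 < κ') (hm' : κ' ≤ m')
    (hn' : κ' ≤ n') :
    mgf K g μ κ θ m n * mgf K g μ κ' θ m' n' ≤ mgf K g μ (κ + κ') θ (m + m') (n + n') := by
  rw [← wordMean_prefixG_mul hs (le_max_left (m + m') (n + n')) (le_max_right _ _),
    mgf_eq_prefix hs (le_max_left (m + m') (n + n')) (le_max_right _ _)]
  refine wordMean_mono hμ fun z => ?_
  rw [← Real.exp_add, ← mul_add]
  exact Real.exp_le_exp.2 (mul_le_mul_of_nonneg_left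
    (prefixG_append hg hκ hm hn hκ' hm' hn') hθ)

lemma mgf_one_one [Nonempty A] (hg : g 0 = 0) :
    mgf K g μ 1 θ 1 1 = ∑ a, ∑ b, μ a * μ b * Real.exp (θ * K a b) := by
  rw [mgf, ← (Equiv.funUnique (Fin 1) A).symm.sum_comp]
  refine Finset.sum_congr rfl fun a _ => ?_
  rw [← (Equiv.funUnique (Fin 1) A).symm.sum_comp]
  refine Finset.sum_congr rfl fun b _ => ?_
  have : scoreG K g 1 (fun _ : Fin 1 => a) (fun _ : Fin 1 => b) = K a b :=
    prefixG_one_one (K := K) (x := fun _ => a) (y := fun _ => b) hg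
  simp only [Finset.univ_unique, Finset.prod_singleton]
  erw [this]
  rfl

/-- Hölder's inequality. -/
lemma sum_mul_exp_le {ι : Type*} (T : Finset ι) {w f : ι → ℝ} (hw : ∀ i ∈ T, 0 ≤ w i) {s t θ θ' : ℝ}
    (hs : 0 < s) (ht : 0 < t) (hst : s + t = 1) :
    ∑ i ∈ T, w i * Real.exp ((s * θ + t * θ') * f i)
      ≤ (∑ i ∈ T, w i * Real.exp (θ * f i)) ^ s * (∑ i ∈ T, w i * Real.exp (θ' * f i)) ^ t := by
  have hpq : (s⁻¹).HolderConjugate t⁻¹ := by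
    rw [Real.holderConjugate_iff]
    constructor
    · exact (one_lt_inv₀ hs).2 (by linarith)
    · simpa using hst
  have h := Real.inner_le_Lp_mul_Lq_of_nonneg T hpq (f := fun i => (w i * Real.exp (θ * f i)) ^ s)
    (g := fun i => (w i * Real.exp (θ' * f i)) ^ t)
    (fun i hi => Real.rpow_nonneg (mul_nonneg (hw i hi) (Real.exp_pos _).le) _)
    (fun i hi => Real.rpow_nonneg (mul_nonneg (hw i hi) (Real.exp_pos _).le) _)
  have e1 : ∀ i ∈ T, ((w i * Real.exp (θ * f i)) ^ s) ^ s⁻¹ = w i * Real.exp (θ * f i) :=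
    fun i hi => Real.rpow_rpow_inv (mul_nonneg (hw i hi) (Real.exp_pos _).le) hs.ne'
  have e2 : ∀ i ∈ T, ((w i * Real.exp (θ' * f i)) ^ t) ^ t⁻¹ = w i * Real.exp (θ' * f i) :=
    fun i hi => Real.rpow_rpow_inv (mul_nonneg (hw i hi) (Real.exp_pos _).le) ht.ne'
  rw [Finset.sum_congr rfl e1, Finset.sum_congr rfl e2] at h
  simp only [one_div, inv_inv] at h
  refine le_trans (le_of_eq (Finset.sum_congr rfl fun i hi => ?_)) h
  rw [Real.mul_rpow (hw i hi) (Real.exp_pos _).le, Real.mul_rpow (hw i hi) (Real.exp_pos _).le,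
    ← Real.exp_mul, ← Real.exp_mul]
  rcases (hw i hi).eq_or_lt with h0 | h0
  · rw [← h0, Real.zero_rpow hs.ne', Real.zero_rpow ht.ne']; simp
  · calc w i * Real.exp ((s * θ + t * θ') * f i)
        = w i ^ (s + t) * Real.exp (θ * f i * s + θ' * f i * t) := by
          rw [hst, Real.rpow_one]; congr 2; ring
      _ = _ := by rw [Real.rpow_add h0, Real.exp_add]; ring

lemma mgf_convexComb_le (hμ : ∀ a, 0 < μ a) {s t θ' : ℝ} (hs : 0 < s) (ht : 0 < t)
    (hst : s + t = 1) :
    mgf K g μ κ (s * θ + t * θ') m n ≤ mgf K g μ κ θ m n ^ s * mgf K g μ κ θ' m n ^ t := by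
  simp only [mgf_eq_wordMean, wordMean]
  exact sum_mul_exp_le _ (fun z _ => Finset.prod_nonneg fun i _ => (hμ (z i)).le) hs ht hst

end Mgf

section SumBound

variable {A : Type*} [Fintype A] {K : A → A → ℝ} {g : ℕ → ℝ} {μ : A → ℝ} {κ m n : ℕ} {θ : ℝ}

/-- The weight of a gap that fills the positions after `m'` in a word of length `m`. -/
noncomputable def gapWeight (g : ℕ → ℝ) (θ : ℝ) (m m' : ℕ) : ℝ :=
  if m' < m then Real.exp (-θ * g (m - m' - 1)) else 0

lemma gapWeight_nonneg (m m' : ℕ) : 0 ≤ gapWeight g θ m m' := by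
  unfold gapWeight; split_ifs
  · exact (Real.exp_pos _).le
  · exact le_rfl

lemma sum_gapWeight_le {C : ℝ} (hC : ∀ N, ∑ k ∈ Finset.range N, Real.exp (-θ * g k) ≤ C)
    (T : Finset ℕ) (m' : ℕ) : ∑ m ∈ T, gapWeight g θ m m' ≤ C := by
  unfold gapWeight
  rw [← Finset.sum_filter]
  have hinj : Set.InjOn (fun m => m - m' - 1) (T.filter (m' < ·) : Set ℕ) := by
    intro a ha b hb h
    simp at ha hb h
    omega
  have := Finset.sum_image (f := fun k => Real.exp (-θ * g k)) hinj
  rw [← this]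
  refine (Finset.sum_le_sum_of_subset_of_nonneg (t := Finset.range (T.sup id + 1)) ?_
    fun _ _ _ => (Real.exp_pos _).le).trans (hC _)
  intro k hk
  simp only [Finset.mem_image, Finset.mem_filter] at hk
  obtain ⟨m, ⟨hm, _⟩, rfl⟩ := hk
  have : m ≤ T.sup id := Finset.le_sup (f := id) hm
  simp only [Finset.mem_range]
  omega

/-- For `κ = 1` the moment generating function factors into the mean over the matched pair and the
weights of the two final gaps. -/
lemma mgf_one_eq [Nonempty A] (hs : ∑ a, μ a = 1) (hg : g 0 = 0)
    (hm : 1 ≤ m) (hn : 1 ≤ n) :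
    mgf K g μ 1 θ m n = mgf K g μ 1 θ 1 1 * (gapWeight g θ m 0 * gapWeight g θ n 0) := by
  rw [mgf_eq_prefix hs (le_max_left m n) (le_max_right m n),
    mgf_eq_prefix (m := 1) hs (hm.trans (le_max_left m n)) (hn.trans (le_max_right m n)),
    ← wordMean_mul_const]
  refine congrArg _ (funext fun z => ?_)
  obtain ⟨m', n', s, hm', hn', h, he⟩ := exists_prefixG_succ_eq (K := K)
    (x := toSeq (z ∘ Sum.inl)) (y := toSeq (z ∘ Sum.inr)) (u := 0) hg hm hn
  cases h
  rw [zero_add] at he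
  rw [he, prefixG_one_one hg, gapWeight, gapWeight, if_pos hm', if_pos hn', ← Real.exp_add,
    ← Real.exp_add]
  congr 1
  ring

lemma mgf_succ_le [Nonempty A] (hμ : ∀ a, 0 < μ a) (hs : ∑ a, μ a = 1) (hg : g 0 = 0) (hθ : 0 ≤ θ)
    (hκ : 0 < κ) {N : ℕ} (hm : κ + 1 ≤ m) (hn : κ + 1 ≤ n) (hmN : m < N) (hnN : n < N) :
    mgf K g μ (κ + 1) θ m n ≤ ∑ m' ∈ Finset.Ico κ N, ∑ n' ∈ Finset.Ico κ N,
      mgf K g μ κ θ m' n' * mgf K g μ 1 θ 1 1 * (gapWeight g θ m m' * gapWeight g θ n n') := by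
  have h1 : mgf K g μ (κ + 1) θ m n ≤ wordMean μ fun z : Fin N ⊕ Fin N → A =>
      ∑ m' ∈ Finset.Ico κ N, ∑ n' ∈ Finset.Ico κ N,
        (Real.exp (θ * prefixG K g κ m' n' (toSeq (z ∘ Sum.inl)) (toSeq (z ∘ Sum.inr)))
        * Real.exp (θ * prefixG K g 1 1 1 (fun k => toSeq (z ∘ Sum.inl) (m' + k))
          (fun k => toSeq (z ∘ Sum.inr) (n' + k)))) * (gapWeight g θ m m' * gapWeight g θ n n') := by
    rw [mgf_eq_prefix hs hmN.le hnN.le]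
    refine wordMean_mono hμ fun z => ?_
    obtain ⟨m', n', s, hm', hn', h, he⟩ := exists_prefixG_succ_eq (K := K)
      (x := toSeq (z ∘ Sum.inl)) (y := toSeq (z ∘ Sum.inr)) hg hm hn
    have hpos : ∀ a b : ℕ, 0 ≤
        (Real.exp (θ * prefixG K g κ a b (toSeq (z ∘ Sum.inl)) (toSeq (z ∘ Sum.inr)))
        * Real.exp (θ * prefixG K g 1 1 1 (fun k => toSeq (z ∘ Sum.inl) (a + k))
          (fun k => toSeq (z ∘ Sum.inr) (b + k)))) * (gapWeight g θ m a * gapWeight g θ n b) :=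
      fun a b => mul_nonneg (mul_pos (Real.exp_pos _) (Real.exp_pos _)).le
        (mul_nonneg (gapWeight_nonneg _ _) (gapWeight_nonneg _ _))
    refine le_trans ?_ (Finset.single_le_sum (fun a _ => Finset.sum_nonneg fun b _ => hpos a b)
      (Finset.mem_Ico.2 ⟨h.le_left, by omega⟩ : m' ∈ Finset.Ico κ N))
    refine le_trans ?_ (Finset.single_le_sum (fun b _ => hpos m' b)
      (Finset.mem_Ico.2 ⟨h.le_right, by omega⟩ : n' ∈ Finset.Ico κ N))
    rw [he, prefixG_one_one hg, gapWeight, gapWeight, if_pos hm', if_pos hn', ← Real.exp_add,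
      ← Real.exp_add, ← Real.exp_add]
    refine Real.exp_le_exp.2 ?_
    have := mul_le_mul_of_nonneg_left (h.le_prefixG hg hκ) hθ
    simp only [add_zero]
    linarith
  refine h1.trans ?_
  rw [wordMean_finset_sum]
  refine Finset.sum_le_sum fun a ha => ?_
  rw [wordMean_finset_sum]
  refine Finset.sum_le_sum fun b hb => ?_
  rw [wordMean_mul_const, wordMean_prefixG_mul hs (Finset.mem_Ico.1 ha).2 (Finset.mem_Ico.1 hb).2]

/-- Summing over the positions of all matches bounds the moment generating functions of all word
lengths together. -/
lemma sum_mgf_le_pow [Nonempty A] (hμ : ∀ a, 0 < μ a) (hs : ∑ a, μ a = 1) (hg : g 0 = 0)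
    (hθ : 0 ≤ θ) {C : ℝ} (hC : ∀ N, ∑ k ∈ Finset.range N, Real.exp (-θ * g k) ≤ C) (κ N : ℕ) :
    ∑ m ∈ Finset.Ico (κ + 1) N, ∑ n ∈ Finset.Ico (κ + 1) N, mgf K g μ (κ + 1) θ m n
      ≤ (mgf K g μ 1 θ 1 1 * C ^ 2) ^ (κ + 1) := by
  have hC0 : 0 ≤ C := by simpa using hC 0
  have hρ : 0 ≤ mgf K g μ 1 θ 1 1 := (mgf_pos hμ).le
  have hgap : ∀ (S T : Finset ℕ) (a b : ℕ),
      ∑ m ∈ S, ∑ n ∈ T, gapWeight g θ m a * gapWeight g θ n b ≤ C ^ 2 := fun S T a b => by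
    rw [← Finset.sum_mul_sum, sq]
    exact mul_le_mul (sum_gapWeight_le hC S a) (sum_gapWeight_le hC T b)
      (Finset.sum_nonneg fun _ _ => gapWeight_nonneg _ _) hC0
  induction κ with
  | zero =>
    rw [zero_add, pow_one]
    calc ∑ m ∈ Finset.Ico 1 N, ∑ n ∈ Finset.Ico 1 N, mgf K g μ 1 θ m n
        = mgf K g μ 1 θ 1 1 * ∑ m ∈ Finset.Ico 1 N, ∑ n ∈ Finset.Ico 1 N,
          gapWeight g θ m 0 * gapWeight g θ n 0 := by
          simp only [Finset.mul_sum]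
          refine Finset.sum_congr rfl fun m hm => Finset.sum_congr rfl fun n hn => ?_
          exact mgf_one_eq hs hg (Finset.mem_Ico.1 hm).1 (Finset.mem_Ico.1 hn).1
      _ ≤ _ := mul_le_mul_of_nonneg_left (hgap _ _ _ _) hρ
  | succ κ ih =>
    calc ∑ m ∈ Finset.Ico (κ + 1 + 1) N, ∑ n ∈ Finset.Ico (κ + 1 + 1) N,
          mgf K g μ (κ + 1 + 1) θ m n
        ≤ ∑ m ∈ Finset.Ico (κ + 1 + 1) N, ∑ n ∈ Finset.Ico (κ + 1 + 1) N,
          ∑ m' ∈ Finset.Ico (κ + 1) N, ∑ n' ∈ Finset.Ico (κ + 1) N,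
          mgf K g μ (κ + 1) θ m' n' * mgf K g μ 1 θ 1 1
            * (gapWeight g θ m m' * gapWeight g θ n n') := by
          refine Finset.sum_le_sum fun m hm => Finset.sum_le_sum fun n hn => ?_
          rw [Finset.mem_Ico] at hm hn
          exact mgf_succ_le hμ hs hg hθ κ.succ_pos hm.1 hn.1 hm.2 hn.2
      _ = ∑ m' ∈ Finset.Ico (κ + 1) N, ∑ n' ∈ Finset.Ico (κ + 1) N,
          mgf K g μ (κ + 1) θ m' n' * mgf K g μ 1 θ 1 1
            * ∑ m ∈ Finset.Ico (κ + 1 + 1) N, ∑ n ∈ Finset.Ico (κ + 1 + 1) N,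
              gapWeight g θ m m' * gapWeight g θ n n' := by
          simp only [Finset.mul_sum]
          exact (Finset.sum_congr rfl fun _ _ => Finset.sum_comm).trans <|
            Finset.sum_comm.trans <| Finset.sum_congr rfl fun _ _ =>
              (Finset.sum_congr rfl fun _ _ => Finset.sum_comm).trans Finset.sum_comm
      _ ≤ ∑ m' ∈ Finset.Ico (κ + 1) N, ∑ n' ∈ Finset.Ico (κ + 1) N,
          mgf K g μ (κ + 1) θ m' n' * mgf K g μ 1 θ 1 1 * C ^ 2 :=
          Finset.sum_le_sum fun m _ => Finset.sum_le_sum fun n _ =>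
            mul_le_mul_of_nonneg_left (hgap _ _ _ _) (mul_nonneg (mgf_pos hμ).le hρ)
      _ = (∑ m' ∈ Finset.Ico (κ + 1) N, ∑ n' ∈ Finset.Ico (κ + 1) N,
          mgf K g μ (κ + 1) θ m' n') * (mgf K g μ 1 θ 1 1 * C ^ 2) := by
          simp only [Finset.sum_mul, mul_assoc]
      _ ≤ _ := by
          rw [pow_succ]
          exact mul_le_mul_of_nonneg_right ih (mul_nonneg hρ (sq_nonneg _))

end SumBound

/-! ### Existence and convexity of `ψ` -/

section Psi

variable {A : Type*} [Fintype A] [Nonempty A] {K : A → A → ℝ} {g : ℕ → ℝ} {μ : A → ℝ} {κ m n : ℕ}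
  {θ : ℝ}

/-- The largest summand of `h_κ(θ)`. It grows at the same exponential rate as `h_κ(θ)`, and
supermultiplicativity is evident for it. -/
noncomputable def maxMgf (K : A → A → ℝ) (g : ℕ → ℝ) (μ : A → ℝ) (κ : ℕ) (θ : ℝ) : ℝ :=
  ⨆ p : ℕ × ℕ, mgf K g μ κ θ (κ + p.1) (κ + p.2)

section

variable (hμ : ∀ a, 0 < μ a) (hs : ∑ a, μ a = 1) (hg : IsGapPenalty g) {k : ℝ}
  (hk : ∀ a b, K a b ≤ k) (hθ : 0 < θ) (hκ : 0 < κ)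
include hμ hs hg hk hθ hκ

lemma mgf_add_le (p : ℕ × ℕ) : mgf K g μ κ θ (κ + p.1) (κ + p.2) ≤
    Real.exp (θ * (κ * k)) * (Real.exp (-θ * g p.1) * Real.exp (-θ * g p.2)) := by
  simpa using mgf_le (m := κ + p.1) (n := κ + p.2) hμ hs hg hk hθ.le hκ (by omega) (by omega)

lemma mgf_add_le_exp (p : ℕ × ℕ) : mgf K g μ κ θ (κ + p.1) (κ + p.2) ≤ Real.exp (θ * (κ * k)) := by
  refine (mgf_add_le hμ hs hg hk hθ hκ p).trans (mul_le_of_le_one_right (Real.exp_pos _).le ?_)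
  rw [← Real.exp_add, Real.exp_le_one_iff]
  have h1 := mul_nonneg hθ.le (hg.nonneg p.1)
  have h2 := mul_nonneg hθ.le (hg.nonneg p.2)
  linarith

lemma bddAbove_mgf : BddAbove (Set.range fun p : ℕ × ℕ => mgf K g μ κ θ (κ + p.1) (κ + p.2)) :=
  ⟨_, by rintro _ ⟨p, rfl⟩; exact mgf_add_le_exp hμ hs hg hk hθ hκ p⟩

lemma mgf_le_maxMgf (hm : κ ≤ m) (hn : κ ≤ n) : mgf K g μ κ θ m n ≤ maxMgf K g μ κ θ := by
  obtain ⟨a, rfl⟩ := Nat.exists_eq_add_of_le hm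
  obtain ⟨b, rfl⟩ := Nat.exists_eq_add_of_le hn
  exact le_ciSup (bddAbove_mgf hμ hs hg hk hθ hκ) (a, b)

lemma maxMgf_pos : 0 < maxMgf K g μ κ θ :=
  (mgf_pos hμ).trans_le (mgf_le_maxMgf hμ hs hg hk hθ hκ le_rfl le_rfl)

lemma maxMgf_le_exp : maxMgf K g μ κ θ ≤ Real.exp (θ * (κ * k)) :=
  ciSup_le fun p => mgf_add_le_exp hμ hs hg hk hθ hκ p

lemma maxMgf_mul_le {κ' : ℕ} (hκ' : 0 < κ') :
    maxMgf K g μ κ θ * maxMgf K g μ κ' θ ≤ maxMgf K g μ (κ + κ') θ := by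
  rw [← le_div_iff₀ (maxMgf_pos hμ hs hg hk hθ hκ')]
  refine ciSup_le fun p => ?_
  rw [le_div_iff₀ (maxMgf_pos hμ hs hg hk hθ hκ'), mul_comm, ← le_div_iff₀ (mgf_pos hμ)]
  refine ciSup_le fun q => ?_
  rw [le_div_iff₀ (mgf_pos hμ), mul_comm]
  exact (mgf_mul_le hμ hs hg.zero hθ.le hκ (by omega) (by omega) hκ' (by omega) (by omega)).trans
    (mgf_le_maxMgf hμ hs hg hk hθ (by omega) (by omega) (by omega))

lemma maxMgf_convexComb_le {s t θ' : ℝ} (hθ' : 0 < θ') (h0s : 0 < s) (ht : 0 < t)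
    (hst : s + t = 1) :
    maxMgf K g μ κ (s * θ + t * θ') ≤ maxMgf K g μ κ θ ^ s * maxMgf K g μ κ θ' ^ t := by
  refine ciSup_le fun p => (mgf_convexComb_le hμ h0s ht hst).trans ?_
  exact mul_le_mul
    (Real.rpow_le_rpow (mgf_pos hμ).le
      (mgf_le_maxMgf hμ hs hg hk hθ hκ (by omega) (by omega)) h0s.le)
    (Real.rpow_le_rpow (mgf_pos hμ).le
      (mgf_le_maxMgf hμ hs hg hk hθ' hκ (by omega) (by omega)) ht.le)
    (Real.rpow_nonneg (mgf_pos hμ).le _)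
    (Real.rpow_nonneg (maxMgf_pos hμ hs hg hk hθ hκ).le _)

end

/-- Pairs `(m, n)` with `m, n ≥ κ`, described by `(m - κ, n - κ)`. -/
def shiftEquiv (κ : ℕ) : ℕ × ℕ ≃ {p : ℕ × ℕ // κ ≤ p.1 ∧ κ ≤ p.2} where
  toFun p := ⟨(κ + p.1, κ + p.2), by simp⟩
  invFun p := (p.1.1 - κ, p.1.2 - κ)
  left_inv p := by simp
  right_inv p := by
    obtain ⟨⟨a, b⟩, h1, h2⟩ := p
    simp only at h1 h2
    ext <;> simp <;> omega

omit [Nonempty A] in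
lemma hKappa_eq : hKappa K g μ κ θ = ∑' p : ℕ × ℕ, mgf K g μ κ θ (κ + p.1) (κ + p.2) :=
  ((shiftEquiv κ).tsum_eq (hTerm K g μ κ θ)).symm

section

variable (hμ : ∀ a, 0 < μ a) (hs : ∑ a, μ a = 1) (hg : IsGapPenalty g) {k : ℝ}
  (hk : ∀ a b, K a b ≤ k) (hsum : ∀ t : ℝ, 0 < t → Summable fun i => Real.exp (-t * g i))
  (hθ : 0 < θ)
include hμ hs hg hk hsum hθ

lemma summable_mgf (hκ : 0 < κ) :
    Summable fun p : ℕ × ℕ => mgf K g μ κ θ (κ + p.1) (κ + p.2) :=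
  Summable.of_nonneg_of_le (fun _ => (mgf_pos hμ).le) (mgf_add_le hμ hs hg hk hθ hκ)
    (((hsum θ hθ).mul_of_nonneg (hsum θ hθ) (fun _ => (Real.exp_pos _).le)
      fun _ => (Real.exp_pos _).le).mul_left _)

lemma summable_hTerm (hκ : 0 < κ) : Summable (hTerm K g μ κ θ) :=
  (shiftEquiv κ).summable_iff.1 (summable_mgf hμ hs hg hk hsum hθ hκ)

lemma maxMgf_le_hKappa (hκ : 0 < κ) : maxMgf K g μ κ θ ≤ hKappa K g μ κ θ := by
  rw [hKappa_eq]
  exact ciSup_le fun p => (summable_mgf hμ hs hg hk hsum hθ hκ).le_tsum p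
    fun _ _ => (mgf_pos hμ).le

/-- The summands of `h_κ(θ)` are interpolated between their maximum and the summable bound given by
the penalties of the unmatched letters. As the latter is summable with every small exponent `s`,
`h_κ(θ)` is at most its largest summand, up to factors of small exponential growth. -/
lemma hKappa_le (hκ : 0 < κ) {s : ℝ} (h0 : 0 < s) (h1 : s < 1) :
    hKappa K g μ κ θ ≤ maxMgf K g μ κ θ ^ (1 - s) * Real.exp (s * θ * (κ * k)) *
      (∑' i, Real.exp (-(s * θ) * g i)) ^ 2 := by
  have hsθ : 0 < s * θ := mul_pos h0 hθ
  have hprod := (hsum _ hsθ).mul_of_nonneg (hsum _ hsθ) (fun _ => (Real.exp_pos _).le)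
      fun _ => (Real.exp_pos _).le
  rw [hKappa_eq, sq, (hsum _ hsθ).tsum_mul_tsum (hsum _ hsθ) hprod, ← tsum_mul_left]
  refine (summable_mgf hμ hs hg hk hsum hθ hκ).tsum_le_tsum (fun p => ?_) (hprod.mul_left _)
  have hp : 0 < mgf K g μ κ θ (κ + p.1) (κ + p.2) := mgf_pos hμ
  calc mgf K g μ κ θ (κ + p.1) (κ + p.2)
      = mgf K g μ κ θ (κ + p.1) (κ + p.2) ^ (1 - s) * mgf K g μ κ θ (κ + p.1) (κ + p.2) ^ s := by
        rw [← Real.rpow_add hp]; simp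
    _ ≤ maxMgf K g μ κ θ ^ (1 - s) * (Real.exp (θ * (κ * k)) *
          (Real.exp (-θ * g p.1) * Real.exp (-θ * g p.2))) ^ s := by
        exact mul_le_mul
          (Real.rpow_le_rpow hp.le
            (mgf_le_maxMgf hμ hs hg hk hθ hκ (by omega) (by omega)) (by linarith))
          (Real.rpow_le_rpow hp.le (mgf_add_le hμ hs hg hk hθ hκ p) h0.le)
          (Real.rpow_nonneg hp.le _)
          (Real.rpow_nonneg (maxMgf_pos hμ hs hg hk hθ hκ).le _)
    _ = _ := by
        rw [← Real.exp_add, ← Real.exp_add, ← Real.exp_mul, ← Real.exp_add, mul_assoc,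
          ← Real.exp_add]
        congr 2; ring

lemma psiKappa_le (hκ : 0 < κ) {s : ℝ} (h0 : 0 < s) (h1 : s < 1) :
    psiKappa K g μ κ θ ≤ (1 - s) * Real.log (maxMgf K g μ κ θ) + s * θ * (κ * k)
      + 2 * Real.log (∑' i, Real.exp (-(s * θ) * g i)) := by
  have ha := maxMgf_pos hμ hs hg hk hθ hκ
  have hC : 0 < ∑' i, Real.exp (-(s * θ) * g i) :=
    (hsum _ (mul_pos h0 hθ)).tsum_pos (fun _ => (Real.exp_pos _).le) 0 (Real.exp_pos _)
  have := Real.log_le_log (ha.trans_le (maxMgf_le_hKappa hμ hs hg hk hsum hθ hκ))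
    (hKappa_le hμ hs hg hk hsum hθ hκ h0 h1)
  rwa [Real.log_mul (by positivity) (by positivity), Real.log_mul (by positivity) (by positivity),
    Real.log_rpow ha, Real.log_exp, Real.log_pow] at this

lemma exists_tendsto_psiKappa : ∃ L : ℝ,
    Tendsto (fun κ : ℕ => psiKappa K g μ κ θ / κ) atTop (𝓝 L) ∧
    Tendsto (fun κ : ℕ => Real.log (maxMgf K g μ κ θ) / κ) atTop (𝓝 L) ∧
    ∀ κ : ℕ, 0 < κ → Real.log (maxMgf K g μ κ θ) / κ ≤ L := by
  set u : ℕ → ℝ := fun κ => if κ = 0 then 0 else -Real.log (maxMgf K g μ κ θ) with hu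
  have hu' : ∀ κ, 0 < κ → u κ = -Real.log (maxMgf K g μ κ θ) := fun κ h => if_neg h.ne'
  have hsub : Subadditive u := by
    intro a b
    rcases Nat.eq_zero_or_pos a with rfl | ha
    · simp [hu]
    rcases Nat.eq_zero_or_pos b with rfl | hb
    · simp [hu]
    rw [hu' a ha, hu' b hb, hu' (a + b) (by omega)]
    have h1 := maxMgf_pos hμ hs hg hk hθ ha
    have h2 := maxMgf_pos hμ hs hg hk hθ hb
    have := Real.log_le_log (mul_pos h1 h2) (maxMgf_mul_le hμ hs hg hk hθ ha hb)
    rw [Real.log_mul h1.ne' h2.ne'] at this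
    linarith
  have hlog : ∀ κ : ℕ, 0 < κ → Real.log (maxMgf K g μ κ θ) / κ ≤ θ * k := fun κ h => by
    rw [div_le_iff₀ (by exact_mod_cast h),
      Real.log_le_iff_le_exp (maxMgf_pos hμ hs hg hk hθ h)]
    convert maxMgf_le_exp hμ hs hg hk hθ h using 2
    ring
  have hbdd : BddBelow (Set.range fun n => u n / n) := by
    refine ⟨min 0 (-(θ * k)), ?_⟩
    rintro _ ⟨κ, rfl⟩
    rcases Nat.eq_zero_or_pos κ with rfl | h
    · simp
    · simp only
      rw [hu' κ h, neg_div]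
      exact (min_le_right _ _).trans (neg_le_neg (hlog κ h))
  have hlim := (hsub.tendsto_lim hbdd).neg
  have hv : Tendsto (fun κ : ℕ => Real.log (maxMgf K g μ κ θ) / κ) atTop (𝓝 (-hsub.lim)) := by
    refine hlim.congr' ?_
    filter_upwards [eventually_gt_atTop 0] with κ h
    rw [hu' κ h, neg_div, neg_neg]
  refine ⟨-hsub.lim, ?_, hv, ?_⟩
  · set L := -hsub.lim
    rw [tendsto_order]
    constructor
    · intro b hb
      filter_upwards [hv.eventually_const_lt hb, eventually_gt_atTop 0] with κ h hκ
      refine h.trans_le ?_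
      have := Real.log_le_log (maxMgf_pos hμ hs hg hk hθ hκ)
        (maxMgf_le_hKappa hμ hs hg hk hsum hθ hκ)
      exact div_le_div_of_nonneg_right this (Nat.cast_nonneg κ)
    · intro b hb
      obtain ⟨s, hs1, hs0, hs2⟩ : ∃ s : ℝ, (1 - s) * L + s * θ * k < b ∧ 0 < s ∧ s < 1 := by
        have hc : Tendsto (fun s : ℝ => (1 - s) * L + s * θ * k) (𝓝[>] 0) (𝓝 L) := by
          have : Continuous fun s : ℝ => (1 - s) * L + s * θ * k := by fun_prop
          have := this.tendsto 0
          simp only [sub_zero, one_mul, zero_mul, add_zero] at this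
          exact this.mono_left nhdsWithin_le_nhds
        have h1 : ∀ᶠ s : ℝ in 𝓝[>] 0, s < 1 := nhdsWithin_le_nhds (Iio_mem_nhds one_pos)
        exact ((hc.eventually_lt_const hb).and (eventually_mem_nhdsWithin.and h1)).exists
      obtain ⟨C, hC⟩ : ∃ C, C = Real.log (∑' i, Real.exp (-(s * θ) * g i)) := ⟨_, rfl⟩
      have hr : Tendsto (fun κ : ℕ => (1 - s) * (Real.log (maxMgf K g μ κ θ) / κ) + s * θ * k
          + 2 * C / κ) atTop (𝓝 ((1 - s) * L + s * θ * k + 0)) :=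
        ((hv.const_mul _).add_const _).add (tendsto_const_div_atTop_nhds_zero_nat _)
      rw [add_zero] at hr
      filter_upwards [hr.eventually_lt_const hs1, eventually_gt_atTop 0] with κ h hκ
      refine lt_of_le_of_lt ?_ h
      have hκ' : (0 : ℝ) < κ := by exact_mod_cast hκ
      rw [div_le_iff₀ hκ']
      refine (psiKappa_le hμ hs hg hk hsum hθ hκ hs0 hs2).trans (le_of_eq ?_)
      rw [← hC]
      field_simp
  · intro κ h
    have := hsub.lim_le_div hbdd h.ne'
    rw [hu' κ h, neg_div] at this
    linarith

lemma tendsto_psiKappa :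
    Tendsto (fun κ : ℕ => psiKappa K g μ κ θ / κ) atTop (𝓝 (psi K g μ θ)) := by
  obtain ⟨L, h, -, -⟩ := exists_tendsto_psiKappa hμ hs hg hk hsum hθ
  rwa [psi, h.limUnder_eq]

lemma tendsto_log_maxMgf :
    Tendsto (fun κ : ℕ => Real.log (maxMgf K g μ κ θ) / κ) atTop (𝓝 (psi K g μ θ)) := by
  obtain ⟨L, h, h', -⟩ := exists_tendsto_psiKappa hμ hs hg hk hsum hθ
  rwa [psi, h.limUnder_eq]

lemma log_maxMgf_div_le (hκ : 0 < κ) : Real.log (maxMgf K g μ κ θ) / κ ≤ psi K g μ θ := by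
  obtain ⟨L, h, -, h'⟩ := exists_tendsto_psiKappa hμ hs hg hk hsum hθ
  rw [psi, h.limUnder_eq]
  exact h' κ hκ

lemma psi_le : psi K g μ θ ≤ k * θ := by
  refine le_of_tendsto (tendsto_log_maxMgf hμ hs hg hk hsum hθ) ?_
  filter_upwards [eventually_gt_atTop 0] with κ hκ
  rw [div_le_iff₀ (by exact_mod_cast hκ), Real.log_le_iff_le_exp (maxMgf_pos hμ hs hg hk hθ hκ)]
  convert maxMgf_le_exp hμ hs hg hk hθ hκ using 2
  ring

lemma exists_one_lt_mgf (h : 0 < psi K g μ θ) :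
    ∃ κ m n, 0 < κ ∧ κ ≤ m ∧ κ ≤ n ∧ 1 < mgf K g μ κ θ m n := by
  obtain ⟨κ, h1, hκ⟩ := (((tendsto_log_maxMgf hμ hs hg hk hsum hθ).eventually_const_lt h).and
    (eventually_gt_atTop 0)).exists
  have hκ' : (0 : ℝ) < κ := by exact_mod_cast hκ
  rw [lt_div_iff₀ hκ', zero_mul, Real.log_pos_iff (maxMgf_pos hμ hs hg hk hθ hκ).le] at h1
  obtain ⟨p, hp⟩ := exists_lt_of_lt_ciSup h1
  exact ⟨κ, κ + p.1, κ + p.2, hκ, by omega, by omega, hp⟩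

lemma psi_pos_of_one_lt (h : 1 < ∑ a, ∑ b, μ a * μ b * Real.exp (θ * K a b)) :
    0 < psi K g μ θ := by
  rw [← mgf_one_one (g := g) hg.zero] at h
  have := log_maxMgf_div_le hμ hs hg hk hsum hθ one_pos
  rw [Nat.cast_one, div_one] at this
  exact (Real.log_pos (h.trans_le (mgf_le_maxMgf hμ hs hg hk hθ one_pos le_rfl le_rfl))).trans_le
    this

lemma psi_neg_of_lt_one
    (h : (∑ a, ∑ b, μ a * μ b * Real.exp (θ * K a b)) * (∑' i, Real.exp (-θ * g i)) ^ 2 < 1) :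
    psi K g μ θ < 0 := by
  set C := ∑' i, Real.exp (-θ * g i) with hC
  rw [← mgf_one_one (g := g) hg.zero] at h
  set ρ := mgf K g μ 1 θ 1 1 * C ^ 2
  have hC0 : 0 < C := (hsum _ hθ).tsum_pos (fun _ => (Real.exp_pos _).le) 0 (Real.exp_pos _)
  have hρ : 0 < ρ := mul_pos (mgf_pos hμ) (by positivity)
  refine lt_of_le_of_lt ?_ (Real.log_neg hρ h)
  refine le_of_tendsto (tendsto_log_maxMgf hμ hs hg hk hsum hθ) ?_
  filter_upwards [eventually_gt_atTop 0] with κ hκ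
  rw [div_le_iff₀ (by exact_mod_cast hκ), mul_comm, ← Real.log_pow]
  refine Real.log_le_log (maxMgf_pos hμ hs hg hk hθ hκ) (ciSup_le fun p => ?_)
  obtain ⟨κ, rfl⟩ : ∃ v, κ = v + 1 := ⟨κ - 1, by omega⟩
  have := sum_mgf_le_pow (K := K) hμ hs hg.zero hθ.le (C := C)
    (fun N => (hsum _ hθ).sum_le_tsum _ fun _ _ => (Real.exp_pos _).le) κ (κ + 1 + p.1 + p.2 + 1)
  refine le_trans ?_ this
  refine le_trans ?_ (Finset.single_le_sum (fun a _ => Finset.sum_nonneg fun b _ =>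
    (mgf_pos hμ).le) (Finset.mem_Ico.2 ⟨Nat.le_add_right _ p.1, by omega⟩))
  exact Finset.single_le_sum (f := fun n => mgf K g μ (κ + 1) θ (κ + 1 + p.1) n)
    (fun b _ => (mgf_pos hμ).le) (Finset.mem_Ico.2 ⟨Nat.le_add_right _ p.2, by omega⟩)

omit hθ in
lemma convexOn_psi : ConvexOn ℝ (Set.Ioi 0) (psi K g μ) := by
  rw [convexOn_iff_forall_pos]
  refine ⟨convex_Ioi 0, fun θ hθ θ' hθ' s t h0 h1 hst => ?_⟩
  have hθ : 0 < θ := hθ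
  have hθ' : 0 < θ' := hθ'
  simp only [smul_eq_mul]
  have hcomb : 0 < s * θ + t * θ' := by positivity
  refine le_of_tendsto_of_tendsto (tendsto_log_maxMgf hμ hs hg hk hsum hcomb)
    (((tendsto_log_maxMgf hμ hs hg hk hsum hθ).const_mul s).add
      ((tendsto_log_maxMgf hμ hs hg hk hsum hθ').const_mul t)) ?_
  filter_upwards [eventually_gt_atTop 0] with κ hκ
  have h2 := maxMgf_pos hμ hs hg hk hθ hκ
  have h3 := maxMgf_pos hμ hs hg hk hθ' hκ
  have := Real.log_le_log (maxMgf_pos hμ hs hg hk hcomb hκ)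
    (maxMgf_convexComb_le hμ hs hg hk hθ hκ hθ' h0 h1 hst)
  rw [Real.log_mul (by positivity) (by positivity), Real.log_rpow h2, Real.log_rpow h3] at this
  rw [← mul_div_assoc, ← mul_div_assoc, ← add_div]
  exact div_le_div_of_nonneg_right this (Nat.cast_nonneg κ)

end

end Psi

/-! ### The positive root of `ψ` -/

section Root

variable {f : ℝ → ℝ} {k : ℝ}

/-- A convex function on `(0, ∞)` with `f θ ≤ k θ` lies below its chords to the origin, where
its right limit is at most `0`. -/
lemma convexOn_mul_le (hf : ConvexOn ℝ (Set.Ioi 0) f) (hk : ∀ θ, 0 < θ → f θ ≤ k * θ) {c θ : ℝ}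
    (hc0 : 0 < c) (hc1 : c < 1) (hθ : 0 < θ) : f (c * θ) ≤ c * f θ := by
  have hlim : Tendsto (fun ε : ℝ => (1 - (c - ε) / (1 - ε)) * (k * (ε * θ))
      + (c - ε) / (1 - ε) * f θ) (𝓝[>] 0) (𝓝 (c * f θ)) := by
    have : ContinuousAt (fun ε : ℝ => (1 - (c - ε) / (1 - ε)) * (k * (ε * θ))
      + (c - ε) / (1 - ε) * f θ) 0 := by
      have h : ContinuousAt (fun ε : ℝ => (c - ε) / (1 - ε)) 0 :=
        ContinuousAt.div (by fun_prop) (by fun_prop) (by simp)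
      fun_prop
    have h := this.tendsto
    simp only [sub_zero, div_one, zero_mul, mul_zero, zero_add] at h
    exact h.mono_left nhdsWithin_le_nhds
  refine ge_of_tendsto hlim ?_
  filter_upwards [self_mem_nhdsWithin, nhdsWithin_le_nhds (Iio_mem_nhds hc0)] with ε h0 h1
  have h0 : 0 < ε := h0
  have h1 : ε < c := h1
  have ht0 : 0 ≤ (c - ε) / (1 - ε) := div_nonneg (by linarith) (by linarith)
  have ht1 : (c - ε) / (1 - ε) ≤ 1 := (div_le_one (by linarith)).2 (by linarith)
  have hεθ : 0 < ε * θ := mul_pos h0 hθ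
  have h := hf.2 (x := ε * θ) (y := θ) hεθ hθ (sub_nonneg.2 ht1) ht0 (by ring)
  simp only [smul_eq_mul] at h
  have e : (1 - (c - ε) / (1 - ε)) * (ε * θ) + (c - ε) / (1 - ε) * θ = c * θ := by
    have : (1 - ε) ≠ 0 := by linarith
    field_simp
    ring
  rw [e] at h
  have := mul_le_mul_of_nonneg_left (hk _ hεθ) (sub_nonneg.2 ht1)
  linarith

lemma IsUniquePosRoot.neg_of_lt {r θ : ℝ} (hf : ConvexOn ℝ (Set.Ioi 0) f)
    (hk : ∀ θ, 0 < θ → f θ ≤ k * θ) (hr : IsUniquePosRoot f r) (hθ : 0 < θ) (h : θ < r) :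
    f θ < 0 := by
  obtain ⟨hr0, hfr, huniq⟩ := hr
  have := convexOn_mul_le hf hk (div_pos hθ hr0) ((div_lt_one hr0).2 h) hr0
  rw [div_mul_cancel₀ _ hr0.ne', hfr, mul_zero] at this
  exact this.lt_of_ne fun h0 => h.ne (huniq θ hθ h0)

lemma IsUniquePosRoot.pos_of_lt {r θ : ℝ} (hf : ConvexOn ℝ (Set.Ioi 0) f)
    (hk : ∀ θ, 0 < θ → f θ ≤ k * θ) (hr : IsUniquePosRoot f r) (h : r < θ) : 0 < f θ := by
  obtain ⟨hr0, hfr, huniq⟩ := hr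
  have hθ := hr0.trans h
  have := convexOn_mul_le hf hk (div_pos hr0 hθ) ((div_lt_one hθ).2 h) hθ
  rw [div_mul_cancel₀ _ hθ.ne', hfr] at this
  exact (nonneg_of_mul_nonneg_right this (div_pos hr0 hθ)).lt_of_ne
    fun h0 => h.ne' (huniq θ hθ h0.symm)

lemma exists_isUniquePosRoot {θ₀ θ₁ : ℝ} (hf : ConvexOn ℝ (Set.Ioi 0) f)
    (hk : ∀ θ, 0 < θ → f θ ≤ k * θ) (h0 : 0 < θ₀) (h1 : 0 < θ₁) (hf0 : f θ₀ < 0)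
    (hf1 : 0 < f θ₁) : ∃ r, IsUniquePosRoot f r := by
  have hlt : ∀ θ, 0 < θ → 0 ≤ f θ → θ₀ < θ := by
    intro θ hθ h
    by_contra! hle
    rcases hle.eq_or_lt with rfl | hlt
    · linarith
    · have := convexOn_mul_le hf hk (div_pos hθ h0) ((div_lt_one h0).2 hlt) h0
      rw [div_mul_cancel₀ _ h0.ne'] at this
      have := mul_neg_of_pos_of_neg (div_pos hθ h0) hf0
      linarith
  have hcont : ContinuousOn f (Set.Icc θ₀ θ₁) :=
    (hf.continuousOn isOpen_Ioi).mono fun x hx => h0.trans_le hx.1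
  obtain ⟨r, hr, hfr⟩ := intermediate_value_Icc (hlt θ₁ h1 hf1.le).le hcont ⟨hf0.le, hf1.le⟩
  have hr0 : 0 < r := h0.trans_le hr.1
  have key : ∀ a b, 0 < a → f a = 0 → f b = 0 → ¬ a < b := by
    intro a b ha hfa hfb hab
    have ha' := hlt a ha hfa.ge
    have hb' : θ₀ < b := ha'.trans hab
    have hb0 : 0 < b := ha.trans hab
    have h2 : 0 ≤ (b - a) / (b - θ₀) := div_nonneg (by linarith) (by linarith)
    have h3 : 0 ≤ (a - θ₀) / (b - θ₀) := div_nonneg (by linarith) (by linarith)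
    have := hf.2 (x := θ₀) (y := b) h0 hb0 h2 h3 (by
      rw [← add_div, div_eq_one_iff_eq (by linarith)]; ring)
    simp only [smul_eq_mul] at this
    have e : (b - a) / (b - θ₀) * θ₀ + (a - θ₀) / (b - θ₀) * b = a := by
      have : b - θ₀ ≠ 0 := by linarith
      field_simp
      ring
    rw [e, hfa, hfb, mul_zero, add_zero] at this
    have := mul_neg_of_pos_of_neg (div_pos (sub_pos.2 hab) (sub_pos.2 hb')) hf0
    linarith
  refine ⟨r, hr0, hfr, fun θ hθ hfθ => ?_⟩
  rcases lt_trichotomy θ r with h | h | h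
  · exact absurd h (key _ _ hθ hfθ hfr)
  · exact h
  · exact absurd h (key _ _ hr0 hfr hfθ)

end Root

section GapPenalty

variable {γ : ℕ → ℝ} {Δ : ℝ}

lemma gapPenalty_succ (k : ℕ) : gapPenalty Δ γ (k + 1) = Δ + γ (k + 1) := if_neg k.succ_ne_zero

lemma IsGapPenalty.of_le {Δ' : ℝ} (h : IsGapPenalty (gapPenalty Δ γ)) (hΔ : Δ ≤ Δ') :
    IsGapPenalty (gapPenalty Δ' γ) where
  zero := by simp [gapPenalty]
  mono := by
    refine monotone_nat_of_le_succ fun k => ?_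
    have := h.mono k.le_succ
    rcases k with _ | k
    · rw [Nat.succ_eq_add_one, gapPenalty_succ] at *
      simp only [gapPenalty, if_true] at *
      linarith
    · rw [Nat.succ_eq_add_one, gapPenalty_succ, gapPenalty_succ] at *
      linarith
  concave := by
    intro k
    have := h.concave k
    rcases k with _ | k
    · rw [gapPenalty_succ, gapPenalty_succ] at *
      simp only [gapPenalty, if_true] at *
      linarith
    · rw [gapPenalty_succ, gapPenalty_succ, gapPenalty_succ] at *
      linarith

lemma summable_exp_neg_mul (hγ : Tendsto (fun k : ℕ => γ k / Real.log k) atTop atTop) {t : ℝ}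
    (ht : 0 < t) : Summable fun k => Real.exp (-t * γ k) := by
  refine Summable.of_norm_bounded_eventually_nat (Real.summable_nat_pow_inv.2 one_lt_two) ?_
  filter_upwards [hγ.eventually_ge_atTop (2 / t), eventually_ge_atTop 2] with k h hk
  have hk' : (1 : ℝ) < k := by exact_mod_cast hk
  rw [le_div_iff₀ (Real.log_pos hk')] at h
  rw [Real.norm_of_nonneg (Real.exp_pos _).le]
  calc Real.exp (-t * γ k) ≤ Real.exp (-(2 * Real.log k)) := by
        refine Real.exp_le_exp.2 ?_
        have := mul_le_mul_of_nonneg_left h ht.le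
        have e : t * (2 / t * Real.log k) = 2 * Real.log k := by field_simp
        linarith
    _ = ((k : ℝ) ^ 2)⁻¹ := by
        rw [Real.exp_neg, ← Nat.cast_two, ← Real.log_pow, Real.exp_log (by positivity)]

lemma exp_neg_gapPenalty_succ (t : ℝ) (k : ℕ) : Real.exp (-t * gapPenalty Δ γ (k + 1))
    = Real.exp (-t * Δ) * Real.exp (-t * γ (k + 1)) := by
  rw [gapPenalty_succ, ← Real.exp_add]; ring_nf

lemma summable_exp_neg_gapPenalty (hγ : Tendsto (fun k : ℕ => γ k / Real.log k) atTop atTop)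
    {t : ℝ} (ht : 0 < t) : Summable fun k => Real.exp (-t * gapPenalty Δ γ k) := by
  rw [← summable_nat_add_iff 1]
  simp only [exp_neg_gapPenalty_succ]
  exact ((summable_nat_add_iff 1).2 (summable_exp_neg_mul hγ ht)).mul_left _

lemma tsum_exp_neg_gapPenalty (hγ : Tendsto (fun k : ℕ => γ k / Real.log k) atTop atTop)
    {t : ℝ} (ht : 0 < t) : ∑' k, Real.exp (-t * gapPenalty Δ γ k)
      = 1 + Real.exp (-t * Δ) * ∑' k, Real.exp (-t * γ (k + 1)) := by
  rw [(summable_exp_neg_gapPenalty hγ ht).tsum_eq_zero_add, ← tsum_mul_left]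
  simp only [exp_neg_gapPenalty_succ]
  simp [gapPenalty]

end GapPenalty

section ExistsRoot

variable {A : Type*} [Fintype A] {K : A → A → ℝ} {μ : A → ℝ} {γ : ℕ → ℝ}

lemma exists_sum_exp_lt_one (hs : ∑ a, μ a = 1) (hmean : ∑ a, ∑ b, μ a * μ b * K a b < 0) :
    ∃ θ : ℝ, 0 < θ ∧ ∑ a, ∑ b, μ a * μ b * Real.exp (θ * K a b) < 1 := by
  have hd : HasDerivAt (fun θ : ℝ => ∑ a, ∑ b, μ a * μ b * Real.exp (θ * K a b))
      (∑ a, ∑ b, μ a * μ b * K a b) 0 := by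
    refine HasDerivAt.fun_sum fun a _ => HasDerivAt.fun_sum fun b _ => ?_
    have := (((hasDerivAt_id (0 : ℝ)).mul_const (K a b)).exp).const_mul (μ a * μ b)
    simpa using this
  have h := (hasDerivAt_iff_tendsto_slope.1 hd).eventually_lt_const hmean
  have h' : ∀ᶠ θ : ℝ in 𝓝[>] 0, slope (fun θ : ℝ => ∑ a, ∑ b, μ a * μ b * Real.exp (θ * K a b)) 0 θ
      < 0 := h.filter_mono (nhdsWithin_mono _ fun x hx => ne_of_gt hx)
  obtain ⟨θ, h1, h2⟩ := (h'.and self_mem_nhdsWithin).exists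
  have h2 : 0 < θ := h2
  refine ⟨θ, h2, ?_⟩
  rw [slope_def_field, sub_zero, div_lt_iff₀ h2, zero_mul, sub_neg] at h1
  refine h1.trans_le (le_of_eq ?_)
  simp [← Finset.mul_sum, hs]

lemma exists_one_lt_sum_exp (hμ : ∀ a, 0 < μ a) (hmax : ∃ a b, 0 < K a b) :
    ∃ θ : ℝ, 0 < θ ∧ 1 < ∑ a, ∑ b, μ a * μ b * Real.exp (θ * K a b) := by
  obtain ⟨a, b, hab⟩ := hmax
  have hp := mul_pos (hμ a) (hμ b)
  refine ⟨1 / (μ a * μ b * K a b), by positivity, ?_⟩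
  have h1 : μ a * μ b * Real.exp (1 / (μ a * μ b * K a b) * K a b) > 1 := by
    have := Real.add_one_lt_exp (x := 1 / (μ a * μ b * K a b) * K a b) (by positivity)
    calc (1 : ℝ) = μ a * μ b * (1 / (μ a * μ b * K a b) * K a b) := by
          have := (hμ a).ne'
          have := (hμ b).ne'
          field_simp
      _ < μ a * μ b * Real.exp (1 / (μ a * μ b * K a b) * K a b) :=
        mul_lt_mul_of_pos_left (by linarith) hp
  refine h1.trans_le ?_
  have hnn' : ∀ a' b', 0 ≤ μ a' * μ b' * Real.exp (1 / (μ a * μ b * K a b) * K a' b') :=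
    fun a b => mul_nonneg (mul_pos (hμ a) (hμ b)).le (Real.exp_pos _).le
  refine le_trans ?_ (Finset.single_le_sum (fun a' _ => Finset.sum_nonneg fun b' _ => hnn' a' b')
    (Finset.mem_univ a))
  exact Finset.single_le_sum (f := fun b' => μ a * μ b' * Real.exp (1 / (μ a * μ b * K a b)
    * K a b')) (fun b' _ => hnn' a b') (Finset.mem_univ b)

lemma exists_upper_bound (K : A → A → ℝ) : ∃ k : ℝ, ∀ a b, K a b ≤ k := by
  obtain ⟨k, hk⟩ := (Set.finite_range fun p : A × A => K p.1 p.2).bddAbove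
  exact ⟨k, fun a b => hk ⟨(a, b), rfl⟩⟩

/-- For large `Δ` gaps contribute little, so that `ψ` is negative somewhere, because the mean score
of a match is negative; it is eventually positive, because some matches have a positive score. -/
lemma exists_forall_exists_isUniquePosRoot [Nonempty A] (hμ : ∀ a, 0 < μ a) (hs : ∑ a, μ a = 1)
    (hmean : ∑ a, ∑ b, μ a * μ b * K a b < 0) (hmax : ∃ a b, 0 < K a b)
    (hγadm : ∃ Δ : ℝ, IsGapPenalty (gapPenalty Δ γ))
    (hγ : Tendsto (fun k : ℕ => γ k / Real.log k) atTop atTop) :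
    ∃ Δ₀ : ℝ, ∀ Δ : ℝ, Δ₀ ≤ Δ → IsGapPenalty (gapPenalty Δ γ) ∧
      ∃ r : ℝ, IsUniquePosRoot (psi K (gapPenalty Δ γ) μ) r := by
  obtain ⟨k, hk⟩ := exists_upper_bound K
  obtain ⟨Δ₁, hΔ₁⟩ := hγadm
  obtain ⟨θ₀, hθ₀, h₀⟩ := exists_sum_exp_lt_one hs hmean
  obtain ⟨θ₁, hθ₁, h₁⟩ := exists_one_lt_sum_exp hμ hmax
  have hlim : Tendsto (fun Δ : ℝ => (∑ a, ∑ b, μ a * μ b * Real.exp (θ₀ * K a b))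
      * (1 + Real.exp (-θ₀ * Δ) * ∑' k, Real.exp (-θ₀ * γ (k + 1))) ^ 2) atTop
      (𝓝 ((∑ a, ∑ b, μ a * μ b * Real.exp (θ₀ * K a b)) * (1 + 0 * ∑' k,
        Real.exp (-θ₀ * γ (k + 1))) ^ 2)) := by
    have he : Tendsto (fun Δ : ℝ => Real.exp (-θ₀ * Δ)) atTop (𝓝 0) :=
      Real.tendsto_exp_atBot.comp (tendsto_id.const_mul_atTop_of_neg (neg_neg_of_pos hθ₀))
    exact (((he.mul_const _).const_add 1).pow 2).const_mul _
  rw [zero_mul, add_zero, one_pow, mul_one] at hlim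
  obtain ⟨Δ₂, hΔ₂⟩ := eventually_atTop.1 (hlim.eventually_lt_const h₀)
  refine ⟨max Δ₁ Δ₂, fun Δ hΔ => ?_⟩
  have hg := hΔ₁.of_le ((le_max_left _ _).trans hΔ)
  have hsum := fun (t : ℝ) (ht : 0 < t) => summable_exp_neg_gapPenalty (Δ := Δ) hγ ht
  refine ⟨hg, exists_isUniquePosRoot (convexOn_psi hμ hs hg hk hsum)
    (fun θ hθ => psi_le hμ hs hg hk hsum hθ) hθ₀ hθ₁ ?_ ?_⟩
  · refine psi_neg_of_lt_one hμ hs hg hk hsum hθ₀ ?_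
    rw [tsum_exp_neg_gapPenalty hγ hθ₀]
    exact hΔ₂ Δ ((le_max_right _ _).trans hΔ)
  · exact psi_pos_of_one_lt hμ hs hg hk hsum hθ₁ h₁

end ExistsRoot

/-! ### Sums of independent letters: second moments and typical sequences -/

section SecondMoment

variable {Z : Type*} [Fintype Z] {I : Type*} [Fintype I] [DecidableEq I] {μ : Z → ℝ}

lemma wordMean_unit (f : Z → ℝ) :
    wordMean μ (fun x : Unit → Z => f (x ())) = ∑ a, μ a * f a := by
  rw [wordMean, ← (Equiv.funUnique Unit Z).symm.sum_comp]
  simp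

lemma wordMean_apply (hs : ∑ a, μ a = 1) (f : Z → ℝ) (i : I) :
    wordMean μ (fun x : I → Z => f (x i)) = ∑ a, μ a * f a := by
  rw [← wordMean_unit]
  exact wordMean_comp hs (σ := fun _ : Unit => i) (fun _ _ _ => rfl) fun x => f (x ())

lemma wordMean_apply_mul (hs : ∑ a, μ a = 1) (f h : Z → ℝ) {i j : I} (hij : i ≠ j) :
    wordMean μ (fun x : I → Z => f (x i) * h (x j)) = (∑ a, μ a * f a) * ∑ a, μ a * h a := by
  rw [← wordMean_unit, ← wordMean_unit]
  refine wordMean_mul hs (σ := fun _ : Unit => i) (τ := fun _ : Unit => j) ?_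
    (fun x => f (x ())) fun x => h (x ())
  rintro (_ | _) (_ | _) h
  · rfl
  · exact absurd h hij
  · exact absurd h.symm hij
  · rfl

lemma wordMean_add (F G : (I → Z) → ℝ) :
    wordMean μ (fun x => F x + G x) = wordMean μ F + wordMean μ G := by
  simp only [wordMean, mul_add, Finset.sum_add_distrib]

lemma wordMean_sum_sq_of_mean_zero (hs : ∑ a, μ a = 1) {f : Z → ℝ} (hf : ∑ a, μ a * f a = 0) :
    wordMean μ (fun x : I → Z => (∑ i, f (x i)) ^ 2)
      = Fintype.card I * ∑ a, μ a * f a ^ 2 := by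
  simp only [sq, Finset.sum_mul_sum]
  rw [wordMean_finset_sum]
  have : ∀ i : I, wordMean μ (fun x : I → Z => ∑ j, f (x i) * f (x j))
      = ∑ a, μ a * (f a * f a) := by
    intro i
    rw [wordMean_finset_sum, Finset.sum_eq_single i]
    · exact wordMean_apply hs (fun a => f a * f a) i
    · intro j _ hj
      rw [wordMean_apply_mul hs f f hj.symm, hf, zero_mul]
    · simp
  simp only [this, Finset.sum_const, Finset.card_univ, nsmul_eq_mul]

/-- Variance plus squared bias, the variance being bounded by the second moment. -/
lemma wordMean_sum_sub_sq_le (hs : ∑ a, μ a = 1) (f : Z → ℝ) (c : ℝ) :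
    wordMean μ (fun x : I → Z => (∑ i, f (x i) - c) ^ 2)
      ≤ Fintype.card I * ∑ a, μ a * f a ^ 2 + (Fintype.card I * ∑ a, μ a * f a - c) ^ 2 := by
  set m := ∑ a, μ a * f a with hm
  set B : ℝ := (Fintype.card I : ℝ) with hB
  have h0 : ∑ a, μ a * (f a - m) = 0 := by
    simp only [mul_sub, Finset.sum_sub_distrib, ← Finset.sum_mul, hs, ← hm]
    ring
  have h2 : ∑ a, μ a * (f a - m) ^ 2 = ∑ a, μ a * f a ^ 2 - m ^ 2 := by
    have : ∀ a, μ a * (f a - m) ^ 2 = μ a * f a ^ 2 - 2 * m * (μ a * f a) + μ a * m ^ 2 :=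
      fun a => by ring
    simp only [this, Finset.sum_add_distrib, Finset.sum_sub_distrib, ← Finset.mul_sum,
      ← Finset.sum_mul, hs, ← hm]
    ring
  have e : ∀ x : I → Z, (∑ i, f (x i) - c) ^ 2 = (∑ i, (f (x i) - m)) ^ 2
      + (∑ i, (f (x i) - m) * (2 * (B * m - c)) + (B * m - c) ^ 2) := fun x => by
    rw [← Finset.sum_mul, Finset.sum_sub_distrib]
    simp only [Finset.sum_const, Finset.card_univ, nsmul_eq_mul, ← hB]
    ring
  simp only [e]
  rw [wordMean_add, wordMean_add, wordMean_const hs, wordMean_finset_sum,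
    wordMean_sum_sq_of_mean_zero hs h0, h2]
  have : ∀ i : I, wordMean μ (fun x : I → Z => (f (x i) - m) * (2 * (B * m - c))) = 0 := fun i => by
    rw [wordMean_mul_const, wordMean_apply hs (fun a => f a - m), h0, zero_mul]
  simp only [this, Finset.sum_const_zero, ← hB]
  have : 0 ≤ B * m ^ 2 := by positivity
  linarith

/-- The weak law of large numbers, for finitely many functions together. -/
lemma exists_half_le_typical {ι : Type*} [Fintype ι] (hμ : ∀ a, 0 < μ a) (hs : ∑ a, μ a = 1)
    (f : ι → Z → ℝ) {δ : ℝ} (hδ : 0 < δ) : ∃ r₀ : ℕ, ∀ r : ℕ, r₀ ≤ r →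
      1 / 2 ≤ wordMean μ ({z : Fin r → Z | ∀ k, |∑ t, f k (z t) - r * ∑ a, μ a * f k a|
        ≤ r * δ}.indicator 1) := by
  set V := ∑ k, ∑ a, μ a * f k a ^ 2
  have hV : 0 ≤ V := Finset.sum_nonneg fun k _ => Finset.sum_nonneg fun a _ =>
    mul_nonneg (hμ a).le (sq_nonneg _)
  obtain ⟨r₀, hr₀⟩ := exists_nat_gt (2 * V / δ ^ 2)
  refine ⟨r₀ + 1, fun r hr => ?_⟩
  have hr0 : (0 : ℝ) < r := by exact_mod_cast (by omega : 0 < r)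
  set Γ := {z : Fin r → Z | ∀ k, |∑ t, f k (z t) - r * ∑ a, μ a * f k a| ≤ r * δ}
  have h1 : 1 ≤ wordMean μ (Γ.indicator 1) + (∑ k, wordMean μ fun z : Fin r → Z =>
      (∑ t, f k (z t) - r * ∑ a, μ a * f k a) ^ 2) * ((r * δ) ^ 2)⁻¹ := by
    rw [← wordMean_finset_sum, ← wordMean_mul_const, ← wordMean_add]
    refine (wordMean_const hs 1).symm.le.trans (wordMean_mono hμ fun z => ?_)
    have hnn : ∀ k, 0 ≤ (∑ t, f k (z t) - r * ∑ a, μ a * f k a) ^ 2 := fun k => sq_nonneg _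
    by_cases hz : z ∈ Γ
    · rw [Set.indicator_of_mem hz, Pi.one_apply]
      have := mul_nonneg (Finset.sum_nonneg fun k (_ : k ∈ Finset.univ) => hnn k)
        (by positivity : 0 ≤ (((r : ℝ) * δ) ^ 2)⁻¹)
      linarith
    · rw [Set.indicator_of_notMem hz, zero_add, ← div_eq_mul_inv, le_div_iff₀ (by positivity),
        one_mul]
      obtain ⟨k, hk⟩ : ∃ k, r * δ < |∑ t, f k (z t) - r * ∑ a, μ a * f k a| := by
        by_contra! h
        exact hz h
      refine le_trans ?_ (Finset.single_le_sum (fun k _ => hnn k) (Finset.mem_univ k))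
      rw [← sq_abs (∑ t, f k (z t) - _)]
      exact pow_le_pow_left₀ (by positivity) hk.le 2
  have h2 : ∑ k, wordMean μ (fun z : Fin r → Z => (∑ t, f k (z t) - r * ∑ a, μ a * f k a) ^ 2)
      ≤ r * V := by
    rw [Finset.mul_sum]
    refine Finset.sum_le_sum fun k _ => ?_
    have := wordMean_sum_sub_sq_le (I := Fin r) hs (f k) (r * ∑ a, μ a * f k a)
    simpa using this
  have h3 : (∑ k, wordMean μ fun z : Fin r → Z =>
      (∑ t, f k (z t) - r * ∑ a, μ a * f k a) ^ 2) * ((r * δ) ^ 2)⁻¹ ≤ 1 / 2 := by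
    rw [← div_eq_mul_inv, div_le_iff₀ (by positivity)]
    refine h2.trans ?_
    rw [div_lt_iff₀ (by positivity)] at hr₀
    have : (r₀ : ℝ) ≤ r := by exact_mod_cast (by omega : r₀ ≤ r)
    have h4 : 2 * V ≤ r * δ ^ 2 := hr₀.le.trans (by gcongr)
    calc (r : ℝ) * V = r * (2 * V) / 2 := by ring
      _ ≤ r * (r * δ ^ 2) / 2 := by gcongr
      _ = _ := by ring
  linarith

end SecondMoment

section NoHit

variable {U V : Type*} [Fintype U] [Fintype V] {μ : U → ℝ} {ν : V → ℝ}

/-- The second moment method for the `B * B` pairs of letters of two random words of length `B`: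
the probability that no pair belongs to `S`. If all conditional probabilities of a hit, given one
of the two letters, are at most `s`, pairs that share a letter are nearly uncorrelated. -/
lemma wordMean_no_hit_le (hμ : ∀ u, 0 < μ u) (hμs : ∑ u, μ u = 1) (hν : ∀ v, 0 < ν v)
    (hνs : ∑ v, ν v = 1) (S : Set (U × V)) {p s : ℝ}
    (hp : p = ∑ u, μ u * ∑ v, ν v * S.indicator 1 (u, v)) (hp0 : 0 < p)
    (hsU : ∀ u, ∑ v, ν v * S.indicator 1 (u, v) ≤ s)
    (hsV : ∀ v, ∑ u, μ u * S.indicator 1 (u, v) ≤ s) {B : ℕ} (hB : 0 < B) :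
    wordMean μ (fun x : Fin B → U => wordMean ν fun y : Fin B → V =>
      {y | ∀ i j, (x i, y j) ∉ S}.indicator 1 y) ≤ 1 / (B ^ 2 * p) + 2 * s / (B * p) := by
  set e : U → V → ℝ := fun u v => S.indicator 1 (u, v) with he
  have he0 : ∀ u v, 0 ≤ e u v := fun u v => Set.indicator_nonneg (fun _ _ => zero_le_one) _
  have hesq : ∀ u v, e u v ^ 2 = e u v := fun u v => by
    by_cases h : (u, v) ∈ S <;> simp [he, h]
  set eU : U → ℝ := fun u => ∑ v, ν v * e u v with heU
  set eV : V → ℝ := fun v => ∑ u, μ u * e u v with heV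
  have heU0 : ∀ u, 0 ≤ eU u := fun u => Finset.sum_nonneg fun v _ => mul_nonneg (hν v).le (he0 u v)
  have heV0 : ∀ v, 0 ≤ eV v := fun v => Finset.sum_nonneg fun u _ => mul_nonneg (hμ u).le (he0 u v)
  have hpU : ∑ u, μ u * eU u = p := hp.symm
  have hpV : ∑ v, ν v * eV v = p := by
    rw [hp]
    simp only [heV, Finset.mul_sum]
    rw [Finset.sum_comm]
    exact Finset.sum_congr rfl fun u _ => Finset.sum_congr rfl fun v _ => by ring
  have hB' : (0 : ℝ) < B := by exact_mod_cast hB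
  -- the number of hits has mean `B ^ 2 * p`
  have hcheb : ∀ x : Fin B → U, (wordMean ν fun y : Fin B → V =>
      {y | ∀ i j, (x i, y j) ∉ S}.indicator 1 y) ≤ (wordMean ν fun y : Fin B → V =>
      (∑ j, (∑ i, e (x i) (y j)) - B ^ 2 * p) ^ 2) * ((B ^ 2 * p) ^ 2)⁻¹ := fun x => by
    rw [← wordMean_mul_const]
    refine wordMean_mono hν fun y => ?_
    by_cases h : ∀ i j, (x i, y j) ∉ S
    · have : ∀ i j, e (x i) (y j) = 0 := fun i j => Set.indicator_of_notMem (h i j) _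
      rw [Set.indicator_of_mem (show y ∈ {y : Fin B → V | ∀ i j, (x i, y j) ∉ S} from h)]
      simp only [this, Finset.sum_const_zero, zero_sub, neg_sq, Pi.one_apply]
      rw [mul_inv_cancel₀ (by positivity)]
    · rw [Set.indicator_of_notMem (show y ∉ {y : Fin B → V | ∀ i j, (x i, y j) ∉ S} from h)]
      positivity
  have hvar : ∀ x : Fin B → U, (wordMean ν fun y : Fin B → V =>
      (∑ j, (∑ i, e (x i) (y j)) - B ^ 2 * p) ^ 2)
      ≤ B * ∑ v, ν v * (∑ i, e (x i) v - 0) ^ 2 + B ^ 2 * (∑ i, eU (x i) - B * p) ^ 2 := fun x => by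
    have := wordMean_sum_sub_sq_le (I := Fin B) hνs (fun v => ∑ i, e (x i) v) (B ^ 2 * p)
    rw [Fintype.card_fin] at this
    refine this.trans (le_of_eq ?_)
    have h1 : ∑ v, ν v * ∑ i, e (x i) v = ∑ i, eU (x i) := by
      simp only [heU, Finset.mul_sum]
      exact Finset.sum_comm
    simp only [sub_zero]
    rw [h1]
    ring
  have hV : ∀ v, wordMean μ (fun x : Fin B → U => (∑ i, e (x i) v - 0) ^ 2)
      ≤ B * eV v + B ^ 2 * (s * eV v) := fun v => by
    have := wordMean_sum_sub_sq_le (I := Fin B) hμs (fun u => e u v) 0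
    rw [Fintype.card_fin] at this
    refine this.trans ?_
    simp only [hesq, sub_zero]
    change B * eV v + (B * eV v) ^ 2 ≤ _
    have := mul_le_mul_of_nonneg_right (hsV v) (heV0 v)
    have h2 := mul_le_mul_of_nonneg_left this (sq_nonneg (B : ℝ))
    rw [mul_pow, sq (eV v)]
    linarith
  have hU : wordMean μ (fun x : Fin B → U => (∑ i, eU (x i) - B * p) ^ 2) ≤ B * (s * p) := by
    have := wordMean_sum_sub_sq_le (I := Fin B) hμs eU (B * p)
    rw [Fintype.card_fin, hpU, sub_self, zero_pow two_ne_zero, add_zero] at this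
    refine this.trans (mul_le_mul_of_nonneg_left ?_ hB'.le)
    rw [← hpU, Finset.mul_sum]
    refine Finset.sum_le_sum fun u _ => ?_
    have := mul_le_mul_of_nonneg_left (mul_le_mul_of_nonneg_right (hsU u) (heU0 u)) (hμ u).le
    rw [sq]
    linarith
  have htot : wordMean μ (fun x : Fin B → U => wordMean ν fun y : Fin B → V =>
      (∑ j, (∑ i, e (x i) (y j)) - B ^ 2 * p) ^ 2) ≤ B ^ 2 * p + 2 * (B ^ 3 * (s * p)) := by
    refine (wordMean_mono hμ hvar).trans ?_
    have e1 : ∀ x : Fin B → U, B * ∑ v, ν v * (∑ i, e (x i) v - 0) ^ 2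
        + B ^ 2 * (∑ i, eU (x i) - B * p) ^ 2 = (∑ v, (∑ i, e (x i) v - 0) ^ 2 * ν v) * B
        + (∑ i, eU (x i) - B * p) ^ 2 * B ^ 2 := fun x => by
      simp only [mul_comm]
    simp only [e1]
    rw [wordMean_add, wordMean_mul_const, wordMean_mul_const, wordMean_finset_sum]
    simp only [wordMean_mul_const]
    have h1 : ∑ v, wordMean μ (fun x : Fin B → U => (∑ i, e (x i) v - 0) ^ 2) * ν v
        ≤ B * p + B ^ 2 * (s * p) := by
      refine (Finset.sum_le_sum fun v _ => mul_le_mul_of_nonneg_right (hV v) (hν v).le).trans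
        (le_of_eq ?_)
      rw [← hpV]
      simp only [Finset.mul_sum, ← Finset.sum_add_distrib]
      exact Finset.sum_congr rfl fun v _ => by ring
    have h2 := mul_le_mul_of_nonneg_right h1 hB'.le
    have h3 := mul_le_mul_of_nonneg_right hU (sq_nonneg (B : ℝ))
    refine (add_le_add h2 h3).trans (le_of_eq (by ring))
  refine (wordMean_mono hμ hcheb).trans ?_
  rw [wordMean_mul_const, ← div_eq_mul_inv, div_le_iff₀ (by positivity)]
  refine htot.trans (le_of_eq ?_)
  field_simp

end NoHit

/-- Gibbs' inequality: relative entropies are nonnegative. -/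
lemma sum_mul_log_div_nonneg {ι : Type*} [Fintype ι] {α β : ι → ℝ} (hα : ∀ i, 0 < α i)
    (hβ : ∀ i, 0 < β i) (h : ∑ i, β i ≤ ∑ i, α i) : 0 ≤ ∑ i, α i * Real.log (α i / β i) := by
  have : ∀ i, α i - β i ≤ α i * Real.log (α i / β i) := fun i => by
    have h1 := Real.log_le_sub_one_of_pos (div_pos (hβ i) (hα i))
    have h2 := mul_le_mul_of_nonneg_left h1 (hα i).le
    have e : α i * (β i / α i - 1) = β i - α i := by
      have := (hα i).ne'
      field_simp
    have e2 : Real.log (α i / β i) = -Real.log (β i / α i) := by rw [← Real.log_inv, inv_div]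
    rw [e2]
    linarith
  have h3 := Finset.sum_le_sum fun i (_ : i ∈ Finset.univ) => this i
  rw [Finset.sum_sub_distrib] at h3
  linarith

/-! ### Exponential tilting -/

/-- Change of measure: the probability of `S` is compared with that under the product of the
distributions `c i`. -/
lemma wordMean_indicator_le {T I : Type*} [Fintype T] [Fintype I] [DecidableEq I] {ν : T → ℝ}
    (c : I → T → ℝ) (hc0 : ∀ i v, 0 ≤ c i v) (hc : ∀ i, ∑ v, c i v = 1) (S : Set (I → T))
    {q : ℝ} (hq : 0 ≤ q) (h : ∀ y ∈ S, ∏ i, ν (y i) ≤ (∏ i, c i (y i)) * q) :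
    wordMean ν (S.indicator 1) ≤ q := by
  have h1 : ∑ y : I → T, ∏ i, c i (y i) = 1 := by
    have := (Finset.prod_univ_sum (fun _ : I => (Finset.univ : Finset T)) c).symm
    rw [Fintype.piFinset_univ] at this
    rw [this]
    simp [hc]
  calc wordMean ν (S.indicator 1) ≤ ∑ y : I → T, (∏ i, c i (y i)) * q := by
        refine Finset.sum_le_sum fun y _ => ?_
        by_cases hy : y ∈ S
        · simpa [hy] using h y hy
        · simpa [hy] using mul_nonneg (Finset.prod_nonneg fun i _ => hc0 i (y i)) hq
    _ = q := by rw [← Finset.sum_mul, h1, one_mul]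

section Tilt

variable {U V : Type*} [Fintype U] [Fintype V] {μ : U → ℝ} {ν : V → ℝ}

/-- Let `U`, `V` be independent letters with `E exp(θ w(U, V)) > 1`. Then the score `w` of two
words of length `r` reaches `r D / θ` on a set `Γ` of pairs whose probability `p` is at least
`exp(-r D) / 2`. Here `Γ` consists of the pairs that are typical for the tilted distribution `α`,
proportional to `exp(θ w)`. If `H`, `h₁`, `h₂` are the relative entropies of `α` and its two
marginals, then `p ≈ exp(-r H)`, and the conditional probabilities of `Γ`, given one of the words,
are at most about `exp(-r (H - h₁))` and `exp(-r (H - h₂))`. As `h₁ + h₂ ≤ H`, their product is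
at most about `p`. -/
lemma exists_tilted_typical [Nonempty U] [Nonempty V] (hμ : ∀ u, 0 < μ u) (hμs : ∑ u, μ u = 1)
    (hν : ∀ v, 0 < ν v) (hνs : ∑ v, ν v = 1) (w : U → V → ℝ) {θ : ℝ} (hθ : 0 < θ)
    (hM : 1 < ∑ u, ∑ v, μ u * ν v * Real.exp (θ * w u v)) :
    ∃ D : ℝ, 0 < D ∧ ∃ r₀ : ℕ, ∀ r : ℕ, r₀ ≤ r → ∃ Γ : Set ((Fin r → U) × (Fin r → V)),
      (∀ z ∈ Γ, r * D ≤ θ * ∑ t, w (z.1 t) (z.2 t)) ∧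
      ∃ p q₁ q₂ : ℝ,
        p = wordMean μ (fun x => wordMean ν fun y => Γ.indicator 1 (x, y)) ∧
        Real.exp (-(r * D)) / 2 ≤ p ∧
        (∀ x, wordMean ν (fun y => Γ.indicator 1 (x, y)) ≤ q₁) ∧
        (∀ y, wordMean μ (fun x => Γ.indicator 1 (x, y)) ≤ q₂) ∧
        q₁ * q₂ ≤ 4 * Real.exp (r * D) * p ^ 2 := by
  set M := ∑ u, ∑ v, μ u * ν v * Real.exp (θ * w u v) with hMdef
  have hM0 : 0 < M := one_pos.trans hM
  have hlogM : 0 < Real.log M := Real.log_pos hM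
  set α : U × V → ℝ := fun z => μ z.1 * ν z.2 * Real.exp (θ * w z.1 z.2) / M with hα
  have hα0 : ∀ z, 0 < α z := fun z => by
    have := hμ z.1; have := hν z.2; positivity
  have hαs : ∑ z, α z = 1 := by
    rw [Fintype.sum_prod_type]
    simp only [hα, ← Finset.sum_div]
    exact div_self hM0.ne'
  set a : U → ℝ := fun u => ∑ v, α (u, v) with ha
  set b : V → ℝ := fun v => ∑ u, α (u, v) with hb
  have ha0 : ∀ u, 0 < a u := fun u => Finset.sum_pos (fun v _ => hα0 _) Finset.univ_nonempty
  have hb0 : ∀ v, 0 < b v := fun v => Finset.sum_pos (fun u _ => hα0 _) Finset.univ_nonempty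
  have has : ∑ u, a u = 1 := by rw [← hαs, Fintype.sum_prod_type]
  have hbs : ∑ v, b v = 1 := by rw [← hαs, Fintype.sum_prod_type_right]
  set wm := ∑ z, α z * w z.1 z.2 with hwm
  set h₁ := ∑ z : U × V, α z * Real.log (a z.1 / μ z.1) with hh₁
  set h₂ := ∑ z : U × V, α z * Real.log (b z.2 / ν z.2) with hh₂
  set H := θ * wm - Real.log M with hH
  have hh₁0 : 0 ≤ h₁ := by
    have := sum_mul_log_div_nonneg ha0 hμ (by rw [has, hμs])
    rw [hh₁, Fintype.sum_prod_type]
    simpa only [← Finset.sum_mul] using this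
  have hh₂0 : 0 ≤ h₂ := by
    have := sum_mul_log_div_nonneg hb0 hν (by rw [hbs, hνs])
    rw [hh₂, Fintype.sum_prod_type_right]
    simpa only [← Finset.sum_mul] using this
  have hHle : h₁ + h₂ ≤ H := by
    have h0 := sum_mul_log_div_nonneg (β := fun z : U × V => a z.1 * b z.2) hα0
      (fun z => mul_pos (ha0 _) (hb0 _)) (by
        rw [hαs, Fintype.sum_prod_type]
        simp only [← Finset.mul_sum, hbs, mul_one, has, le_refl])
    have e : ∀ z : U × V, α z * Real.log (α z / (a z.1 * b z.2)) = θ * (α z * w z.1 z.2)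
        - α z * Real.log M - α z * Real.log (a z.1 / μ z.1)
        - α z * Real.log (b z.2 / ν z.2) := fun z => by
      have e1 : Real.log (α z) = Real.log (μ z.1) + Real.log (ν z.2) + θ * w z.1 z.2
          - Real.log M := by
        rw [hα]
        simp only
        rw [Real.log_div (by have := hμ z.1; have := hν z.2; positivity) hM0.ne',
          Real.log_mul (mul_pos (hμ _) (hν _)).ne' (Real.exp_pos _).ne', Real.log_exp,
          Real.log_mul (hμ _).ne' (hν _).ne']
      rw [Real.log_div (hα0 z).ne' (mul_pos (ha0 _) (hb0 _)).ne',
        Real.log_mul (ha0 _).ne' (hb0 _).ne', Real.log_div (ha0 _).ne' (hμ _).ne',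
        Real.log_div (hb0 _).ne' (hν _).ne', e1]
      ring
    simp only [e, Finset.sum_sub_distrib, ← Finset.mul_sum, ← Finset.sum_mul, hαs, one_mul] at h0
    linarith
  -- `D` exceeds `H` by the error terms below, and `log M` is what the score has to spare
  set δ := Real.log M / (5 * θ + 2) with hδ
  have hδ0 : 0 < δ := by positivity
  have hδM : Real.log M = (5 * θ + 2) * δ := by rw [hδ]; field_simp
  set D := H + (4 * θ + 2) * δ with hD
  have hD0 : 0 < D := by
    have : 0 < (4 * θ + 2) * δ := by positivity
    linarith
  obtain ⟨r₀, hr₀⟩ := exists_half_le_typical hα0 hαs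
    ![fun z => w z.1 z.2, fun z => Real.log (a z.1 / μ z.1), fun z => Real.log (b z.2 / ν z.2)] hδ0
  refine ⟨D, hD0, r₀, fun r hr => ?_⟩
  have hΓ' := hr₀ r hr
  set Γ : Set ((Fin r → U) × (Fin r → V)) := {z |
    |∑ t, w (z.1 t) (z.2 t) - r * wm| ≤ r * δ ∧
    |∑ t, Real.log (a (z.1 t) / μ (z.1 t)) - r * h₁| ≤ r * δ ∧
    |∑ t, Real.log (b (z.2 t) / ν (z.2 t)) - r * h₂| ≤ r * δ} with hΓ
  have hr0 : (0 : ℝ) ≤ r := Nat.cast_nonneg r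
  -- the tilted probability of `Γ`
  have hhalf : 1 / 2 ≤ ∑ x : Fin r → U, ∑ y : Fin r → V,
      (∏ t, α (x t, y t)) * Γ.indicator 1 (x, y) := by
    refine hΓ'.trans (le_of_eq ?_)
    rw [wordMean, ← (Equiv.arrowProdEquivProdArrow (Fin r) (fun _ => U) (fun _ => V)).symm.sum_comp,
      Fintype.sum_prod_type]
    refine Finset.sum_congr rfl fun x _ => Finset.sum_congr rfl fun y _ => ?_
    congr 1
    simp only [Set.indicator_apply]
    refine if_congr ?_ rfl rfl
    simp only [hΓ, Set.mem_ofPred_eq, Fin.forall_fin_succ]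
    simp [Matrix.cons_val_zero, Matrix.cons_val_one, hwm, hh₁, hh₂]
  have hscore : ∀ z ∈ Γ, r * (H - θ * δ) ≤ θ * ∑ t, w (z.1 t) (z.2 t) - r * Real.log M ∧
      θ * ∑ t, w (z.1 t) (z.2 t) - r * Real.log M ≤ r * (H + θ * δ) := fun z hz => by
    have h := abs_le.1 hz.1
    have h1 := mul_le_mul_of_nonneg_left h.1 hθ.le
    have h2 := mul_le_mul_of_nonneg_left h.2 hθ.le
    rw [hH]
    constructor <;> linarith
  refine ⟨Γ, fun z hz => ?_, _, Real.exp (-(r * (H - h₁ - (θ + 1) * δ))),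
    Real.exp (-(r * (H - h₂ - (θ + 1) * δ))), rfl, ?_⟩
  · have := (hscore z hz).1
    rw [hδM] at this
    rw [hD]
    linarith
  set p := wordMean μ (fun x => wordMean ν fun y => Γ.indicator 1 (x, y)) with hp
  have hletter : ∀ u v, μ u * ν v = α (u, v) * Real.exp (Real.log M - θ * w u v) := fun u v => by
    rw [Real.exp_sub, Real.exp_log hM0]
    simp only [hα]
    field_simp
  have hplow : Real.exp (-(r * (H + θ * δ))) / 2 ≤ p := by
    have e : p = ∑ x : Fin r → U, ∑ y : Fin r → V,
        (∏ t, α (x t, y t)) * Γ.indicator 1 (x, y)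
          * Real.exp (-(θ * ∑ t, w (x t) (y t) - r * Real.log M)) := by
      rw [hp]
      simp only [wordMean, Finset.mul_sum]
      refine Finset.sum_congr rfl fun x _ => Finset.sum_congr rfl fun y _ => ?_
      rw [← mul_assoc, ← Finset.prod_mul_distrib]
      simp only [hletter]
      rw [Finset.prod_mul_distrib, ← Real.exp_sum, Finset.sum_sub_distrib]
      simp only [← Finset.mul_sum, Finset.sum_const, Finset.card_univ, Fintype.card_fin, nsmul_eq_mul, neg_sub]
      ring
    rw [e, div_eq_inv_mul, ← one_div]
    refine (mul_le_mul_of_nonneg_right hhalf (Real.exp_pos _).le).trans ?_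
    simp only [Finset.sum_mul]
    refine Finset.sum_le_sum fun x _ => Finset.sum_le_sum fun y _ => ?_
    by_cases h : (x, y) ∈ Γ
    · refine mul_le_mul_of_nonneg_left (Real.exp_le_exp.2 ?_) (mul_nonneg
        (Finset.prod_nonneg fun t _ => (hα0 _).le)
        (Set.indicator_nonneg (fun _ _ => zero_le_one) _))
      exact neg_le_neg (hscore _ h).2
    · simp [h]
  refine ⟨le_trans ?_ hplow, fun x => ?_, fun y => ?_, ?_⟩
  · have : r * (H + θ * δ) ≤ r * D := by
      refine mul_le_mul_of_nonneg_left ?_ hr0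
      rw [hD]
      have := mul_pos hθ hδ0
      linarith
    have := Real.exp_le_exp.2 (neg_le_neg this)
    linarith
  · refine wordMean_indicator_le (fun t v => α (x t, v) / a (x t))
      (fun t v => (div_pos (hα0 _) (ha0 _)).le)
      (fun t => by rw [← Finset.sum_div]; exact div_self (ha0 _).ne')
      {y | (x, y) ∈ Γ} (Real.exp_pos _).le fun y hy => ?_
    have e : ∀ t, ν (y t) = α (x t, y t) / a (x t) *
        Real.exp (Real.log (a (x t) / μ (x t)) + (Real.log M - θ * w (x t) (y t))) := fun t => by
      rw [Real.exp_add, Real.exp_log (div_pos (ha0 _) (hμ _))]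
      have h1 := hletter (x t) (y t)
      have h2 := (hμ (x t)).ne'
      have h3 := (ha0 (x t)).ne'
      calc ν (y t) = (μ (x t) * ν (y t)) / μ (x t) := by field_simp
        _ = _ := by rw [h1]; field_simp
    rw [Finset.prod_congr rfl fun t _ => e t, Finset.prod_mul_distrib, ← Real.exp_sum]
    refine mul_le_mul_of_nonneg_left (Real.exp_le_exp.2 ?_)
      (Finset.prod_nonneg fun t _ => (div_pos (hα0 _) (ha0 _)).le)
    have h1 := (abs_le.1 hy.2.1).2
    have h2 := (hscore _ hy).1
    simp only [Finset.sum_add_distrib, Finset.sum_sub_distrib, ← Finset.mul_sum, Finset.sum_const,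
      Finset.card_univ, Fintype.card_fin, nsmul_eq_mul]
    simp only at h1 h2
    linarith
  · refine wordMean_indicator_le (fun t u => α (u, y t) / b (y t))
      (fun t v => (div_pos (hα0 _) (hb0 _)).le)
      (fun t => by rw [← Finset.sum_div]; exact div_self (hb0 _).ne')
      {x | (x, y) ∈ Γ} (Real.exp_pos _).le fun x hx => ?_
    have e : ∀ t, μ (x t) = α (x t, y t) / b (y t) *
        Real.exp (Real.log (b (y t) / ν (y t)) + (Real.log M - θ * w (x t) (y t))) := fun t => by
      rw [Real.exp_add, Real.exp_log (div_pos (hb0 _) (hν _))]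
      have h1 := hletter (x t) (y t)
      have h2 := (hν (y t)).ne'
      have h3 := (hb0 (y t)).ne'
      calc μ (x t) = (μ (x t) * ν (y t)) / ν (y t) := by field_simp
        _ = _ := by rw [h1]; field_simp
    rw [Finset.prod_congr rfl fun t _ => e t, Finset.prod_mul_distrib, ← Real.exp_sum]
    refine mul_le_mul_of_nonneg_left (Real.exp_le_exp.2 ?_)
      (Finset.prod_nonneg fun t _ => (div_pos (hα0 _) (hb0 _)).le)
    have h1 := (abs_le.1 hx.2.2).2
    have h2 := (hscore _ hx).1
    simp only [Finset.sum_add_distrib, Finset.sum_sub_distrib, ← Finset.mul_sum, Finset.sum_const,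
      Finset.card_univ, Fintype.card_fin, nsmul_eq_mul]
    simp only at h1 h2
    linarith
  · have h1 := pow_le_pow_left₀ (by positivity) hplow 2
    rw [← Real.exp_add]
    calc Real.exp (-(r * (H - h₁ - (θ + 1) * δ)) + -(r * (H - h₂ - (θ + 1) * δ)))
        ≤ Real.exp (r * D + (-(r * (H + θ * δ)) + -(r * (H + θ * δ)))) := by
          refine Real.exp_le_exp.2 ?_
          have := mul_le_mul_of_nonneg_left hHle hr0
          rw [hD]
          linarith
      _ = 4 * Real.exp (r * D) * (Real.exp (-(r * (H + θ * δ))) / 2) ^ 2 := by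
          rw [Real.exp_add, Real.exp_add]; ring
      _ ≤ _ := by gcongr

end Tilt

/-! ### The upper bound for the tail of the local score -/

section Transfer

variable {A : Type*} [Fintype A] [MeasurableSpace A] [MeasurableSingletonClass A]
  {Ω : Type*} [MeasurableSpace Ω] {P : Measure Ω} [IsProbabilityMeasure P] {μ : A → ℝ}
  {X Y : ℕ → Ω → A}

/-- Letters of the two random sequences at distinct positions form a random word. -/
lemma measureReal_letters_mem (hX : ∀ p, Measurable (X p)) (hY : ∀ q, Measurable (Y q))
    (hindep : iIndepFun (Sum.elim X Y) P)
    (hXlaw : ∀ p a, P.real (X p ⁻¹' {a}) = μ a) (hYlaw : ∀ q a, P.real (Y q ⁻¹' {a}) = μ a)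
    {I : Type*} [Fintype I] [DecidableEq I] {σ : I → ℕ ⊕ ℕ} (hσ : σ.Injective)
    (S : Set (I → A)) :
    P.real {ω | (fun i => Sum.elim X Y (σ i) ω) ∈ S} = wordMean μ (S.indicator 1) := by
  classical
  set Z := Sum.elim X Y with hZ
  have hZm : ∀ i, Measurable (Z i) := by rintro (p | q); exacts [hX p, hY q]
  have hlaw : ∀ i a, P.real (Z i ⁻¹' {a}) = μ a := by rintro (p | q); exacts [hXlaw p, hYlaw q]
  have hword : ∀ x : I → A, P.real {ω | (fun i => Z (σ i) ω) = x} = ∏ i, μ (x i) := by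
    intro x
    have h := (hindep.precomp hσ).measure_inter_preimage_eq_mul Finset.univ
      (sets := fun i => {x i}) (fun i _ => measurableSet_singleton _)
    have e : {ω | (fun i => Z (σ i) ω) = x}
        = ⋂ i ∈ Finset.univ, (fun i => Z (σ i)) i ⁻¹' {x i} := by
      ext ω
      simp [funext_iff]
    rw [Measure.real, e]
    erw [h]
    rw [ENNReal.toReal_prod]
    exact Finset.prod_congr rfl fun i _ => hlaw (σ i) (x i)
  have hmeas : ∀ x : I → A, MeasurableSet {ω | (fun i => Z (σ i) ω) = x} := by
    intro x
    exact (measurable_pi_lambda _ fun i => hZm (σ i)) (measurableSet_singleton x)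
  have e : {ω | (fun i => Z (σ i) ω) ∈ S}
      = ⋃ x ∈ Finset.univ.filter (· ∈ S), {ω | (fun i => Z (σ i) ω) = x} := by
    ext ω
    simp
  rw [e, measureReal_biUnion_finset _ fun x _ => hmeas x]
  · rw [wordMean, Finset.sum_filter]
    refine Finset.sum_congr rfl fun x _ => ?_
    by_cases hx : x ∈ S <;> simp [hx, hword]
  · intro x _ y _ hxy
    refine Set.disjoint_left.2 fun ω h1 h2 => hxy ?_
    exact h1.symm.trans h2

variable (hμ : ∀ a, 0 < μ a) (hs : ∑ a, μ a = 1) (hX : ∀ p, Measurable (X p))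
  (hY : ∀ q, Measurable (Y q)) (hindep : iIndepFun (Sum.elim X Y) P)
  (hXlaw : ∀ p a, P.real (X p ⁻¹' {a}) = μ a) (hYlaw : ∀ q a, P.real (Y q ⁻¹' {a}) = μ a)
  {K : A → A → ℝ} {g : ℕ → ℝ} {θ : ℝ}
include hμ hX hY hindep hXlaw hYlaw

lemma measureReal_le_prefixG_le (hθ : 0 < θ) (c : ℝ) (a b κ m n : ℕ) :
    P.real {ω | c ≤ prefixG K g κ m n (fun k => X (a + k) ω) (fun k => Y (b + k) ω)}
      ≤ Real.exp (-θ * c) * mgf K g μ κ θ m n := by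
  let σ : Fin m ⊕ Fin n → ℕ ⊕ ℕ := Sum.map (fun p => a + p) (fun q => b + q)
  have hσ : σ.Injective := by
    refine Function.Injective.sumMap ?_ ?_ <;>
    · intro p q h
      simpa [Fin.ext_iff] using h
  have := measureReal_letters_mem hX hY hindep hXlaw hYlaw hσ
    {z | c ≤ scoreG K g κ (z ∘ Sum.inl) (z ∘ Sum.inr)}
  refine this.le.trans ?_
  rw [mgf_eq_wordMean, mul_comm, ← wordMean_mul_const]
  refine wordMean_mono hμ fun z => ?_
  rw [← Real.exp_add]
  by_cases h : c ≤ scoreG K g κ (z ∘ Sum.inl) (z ∘ Sum.inr)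
  · rw [Set.indicator_of_mem (show z ∈ {z : Fin m ⊕ Fin n → A |
      c ≤ scoreG K g κ (z ∘ Sum.inl) (z ∘ Sum.inr)} from h)]
    refine Real.one_le_exp ?_
    have := mul_le_mul_of_nonneg_left h hθ.le
    linarith
  · rw [Set.indicator_of_notMem (show z ∉ {z : Fin m ⊕ Fin n → A |
      c ≤ scoreG K g κ (z ∘ Sum.inl) (z ∘ Sum.inr)} from h)]
    exact (Real.exp_pos _).le

variable [Nonempty A] (hg : IsGapPenalty g) {k : ℝ} (hk : ∀ a b, K a b ≤ k)
  (hsum : ∀ t : ℝ, 0 < t → Summable fun i => Real.exp (-t * g i))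
include hs hg hk hsum

lemma measureReal_le_prefixH_le_sum (hθ : 0 < θ) (c : ℝ) {M N : ℕ} (hM : 0 < M) (hN : 0 < N) :
    P.real {ω | c ≤ prefixH K g M N (fun k => X k ω) (fun k => Y k ω)}
      ≤ M * N * Real.exp (-θ * c) * ∑ κ ∈ Finset.range M, hKappa K g μ (κ + 1) θ := by
  set T := (Finset.range M ×ˢ Finset.range N) ×ˢ
    (Finset.range M ×ˢ (Finset.range (M + 1) ×ˢ Finset.range (N + 1)))
  have hsub : {ω | c ≤ prefixH K g M N (fun k => X k ω) (fun k => Y k ω)} ⊆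
      ⋃ t ∈ T, {ω | c ≤ prefixG K g (t.2.1 + 1) (t.2.1 + 1 + t.2.2.1) (t.2.1 + 1 + t.2.2.2)
        (fun k => X (t.1.1 + k) ω) (fun k => Y (t.1.2 + k) ω)} := by
    intro ω hω
    obtain ⟨a, b, u, m, n, hu, ham, hbn, h⟩ := exists_anchoredScore_prefixH (K := K)
      (x := fun k => X k ω) (y := fun k => Y k ω) hg.zero hM hN
    have h1 := h.le_left
    have h2 := h.le_right
    simp only [Set.mem_iUnion]
    refine ⟨((a, b), (u - 1, (m - u, n - u))), ?_, ?_⟩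
    · simp only [T, Finset.mem_product, Finset.mem_range]
      omega
    · simp only [Set.mem_ofPred_eq]
      rw [show u - 1 + 1 = u by omega, show u + (m - u) = m by omega,
        show u + (n - u) = n by omega]
      exact hω.trans (h.le_prefixG hg.zero hu)
  calc P.real {ω | c ≤ prefixH K g M N (fun k => X k ω) (fun k => Y k ω)}
      ≤ ∑ t ∈ T, Real.exp (-θ * c) *
        mgf K g μ (t.2.1 + 1) θ (t.2.1 + 1 + t.2.2.1) (t.2.1 + 1 + t.2.2.2) :=
        (measureReal_mono hsub (measure_ne_top _ _)).trans <| (measureReal_biUnion_finset_le _ _).trans <|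
          Finset.sum_le_sum fun t _ =>
            measureReal_le_prefixG_le hμ hX hY hindep hXlaw hYlaw hθ c _ _ _ _ _
    _ = M * N * Real.exp (-θ * c) * ∑ κ ∈ Finset.range M,
        ∑ p ∈ Finset.range (M + 1) ×ˢ Finset.range (N + 1),
          mgf K g μ (κ + 1) θ (κ + 1 + p.1) (κ + 1 + p.2) := by
        rw [Finset.sum_product]
        dsimp only
        rw [Finset.sum_const, Finset.card_product, Finset.card_range, Finset.card_range,
          ← Finset.mul_sum, nsmul_eq_mul, Finset.sum_product]
        push_cast
        ring
    _ ≤ _ := by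
        refine mul_le_mul_of_nonneg_left (Finset.sum_le_sum fun κ _ => ?_) (by positivity)
        rw [hKappa_eq]
        exact (summable_mgf hμ hs hg hk hsum hθ κ.succ_pos).sum_le_tsum _
          fun _ _ => (mgf_pos hμ).le

/-- If `ψ(θ) < 0`, then `∑_κ h_κ(θ) < ∞`, and the union bound is of the order `mn exp(-θ c)`. -/
lemma exists_measureReal_le_prefixH_le (hθ : 0 < θ) (hψ : psi K g μ θ < 0) :
    ∃ C : ℝ, 0 < C ∧ ∀ (c : ℝ) (M N : ℕ), 0 < M → 0 < N →
      P.real {ω | c ≤ prefixH K g M N (fun k => X k ω) (fun k => Y k ω)}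
        ≤ M * N * Real.exp (-θ * c) * C := by
  have hpos : ∀ κ, 0 < hKappa K g μ (κ + 1) θ := fun κ =>
    (maxMgf_pos hμ hs hg hk hθ κ.succ_pos).trans_le
      (maxMgf_le_hKappa hμ hs hg hk hsum hθ κ.succ_pos)
  have hsumm : Summable fun κ => hKappa K g μ (κ + 1) θ := by
    rw [summable_nat_add_iff 1 (f := fun κ => hKappa K g μ κ θ)]
    refine Summable.of_norm_bounded_eventually_nat (g := fun κ =>
      Real.exp (psi K g μ θ / 2) ^ κ) (summable_geometric_of_lt_one (Real.exp_pos _).le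
        (Real.exp_lt_one_iff.2 (by linarith))) ?_
    filter_upwards [(tendsto_psiKappa hμ hs hg hk hsum hθ).eventually_lt_const
      (show psi K g μ θ < psi K g μ θ / 2 by linarith), eventually_gt_atTop 0] with κ h hκ
    obtain ⟨κ, rfl⟩ : ∃ v, κ = v + 1 := ⟨κ - 1, by omega⟩
    rw [Real.norm_of_nonneg (hpos κ).le, ← Real.exp_nat_mul, ← Real.log_le_iff_le_exp (hpos κ)]
    rw [div_lt_iff₀ (by exact_mod_cast hκ)] at h
    rw [mul_comm]
    exact h.le
  refine ⟨∑' κ, hKappa K g μ (κ + 1) θ, hsumm.tsum_pos (fun κ => (hpos κ).le) 0 (hpos 0),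
    fun c M N hM hN => ?_⟩
  refine (measureReal_le_prefixH_le_sum hμ hs hX hY hindep hXlaw hYlaw hg hk hsum hθ c hM
    hN).trans ?_
  exact mul_le_mul_of_nonneg_left (hsumm.sum_le_tsum _ fun κ _ => (hpos κ).le) (by positivity)

end Transfer

/-! ### The lower bound for the tail of the local score -/

section Symmetrized

variable {A : Type*} [Fintype A] {I J : Type*} [Fintype I] [DecidableEq I] [Fintype J]
  [DecidableEq J] {μ : A → ℝ}

lemma wordMean_curry (F : (I → J → A) → ℝ) :
    wordMean μ (fun x : I × J → A => F fun i j => x (i, j))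
      = wordMean (fun v : J → A => ∏ j, μ (v j)) F := by
  rw [wordMean, wordMean, ← (Equiv.curry I J A).sum_comp]
  refine Finset.sum_congr rfl fun x _ => ?_
  rw [Fintype.prod_prod_type]
  rfl

lemma wordMean_comm (F : (I → A) → (J → A) → ℝ) :
    wordMean μ (fun x => wordMean μ (F x)) = wordMean μ fun y => wordMean μ fun x => F x y := by
  simp only [wordMean, Finset.mul_sum]
  rw [Finset.sum_comm]
  exact Finset.sum_congr rfl fun _ _ => Finset.sum_congr rfl fun _ _ => by ring

/-- The pairs of words `x x'` and `y y'` such that `(x, y)` and `(y', x')` belong to `T`. The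
conditional probabilities of this set, given either word, involve both those of `T` given the first
component and those given the second one. -/
def symmetrized (T : Set ((I → A) × (J → A))) : Set ((I ⊕ J → A) × (J ⊕ I → A)) :=
  {z | (z.1 ∘ Sum.inl, z.2 ∘ Sum.inl) ∈ T ∧ (z.2 ∘ Sum.inr, z.1 ∘ Sum.inr) ∈ T}

omit [Fintype A] [Fintype I] [DecidableEq I] [Fintype J] [DecidableEq J] in
lemma indicator_symmetrized (T : Set ((I → A) × (J → A))) (u : I ⊕ J → A) (v : J ⊕ I → A) :
    (symmetrized T).indicator (1 : (I ⊕ J → A) × (J ⊕ I → A) → ℝ) (u, v)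
      = T.indicator 1 (u ∘ Sum.inl, v ∘ Sum.inl) * T.indicator 1 (v ∘ Sum.inr, u ∘ Sum.inr) := by
  by_cases h1 : (u ∘ Sum.inl, v ∘ Sum.inl) ∈ T <;> by_cases h2 : (v ∘ Sum.inr, u ∘ Sum.inr) ∈ T <;>
    simp [symmetrized, h1, h2]

lemma wordMean_symmetrized_left (hs : ∑ a, μ a = 1) (T : Set ((I → A) × (J → A)))
    (u : I ⊕ J → A) : wordMean μ (fun v => (symmetrized T).indicator 1 (u, v))
      = wordMean μ (fun y => T.indicator 1 (u ∘ Sum.inl, y))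
        * wordMean μ (fun x => T.indicator 1 (x, u ∘ Sum.inr)) := by
  simp only [indicator_symmetrized]
  exact wordMean_mul hs (σ := (Sum.inl : J → J ⊕ I)) (τ := Sum.inr)
    (by rw [Sum.elim_inl_inr]; exact Function.injective_id)
    (fun y => T.indicator 1 (u ∘ Sum.inl, y)) fun x => T.indicator 1 (x, u ∘ Sum.inr)

lemma wordMean_symmetrized_right (hs : ∑ a, μ a = 1) (T : Set ((I → A) × (J → A)))
    (v : J ⊕ I → A) : wordMean μ (fun u => (symmetrized T).indicator 1 (u, v))
      = wordMean μ (fun x => T.indicator 1 (x, v ∘ Sum.inl))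
        * wordMean μ (fun y => T.indicator 1 (v ∘ Sum.inr, y)) := by
  simp only [indicator_symmetrized]
  exact wordMean_mul hs (σ := (Sum.inl : I → I ⊕ J)) (τ := Sum.inr)
    (by rw [Sum.elim_inl_inr]; exact Function.injective_id)
    (fun x => T.indicator 1 (x, v ∘ Sum.inl)) fun y => T.indicator 1 (v ∘ Sum.inr, y)

lemma wordMean_symmetrized (hs : ∑ a, μ a = 1) (T : Set ((I → A) × (J → A))) :
    wordMean μ (fun u => wordMean μ fun v => (symmetrized T).indicator 1 (u, v))
      = (wordMean μ fun x => wordMean μ fun y => T.indicator 1 (x, y)) ^ 2 := by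
  simp only [wordMean_symmetrized_left hs]
  rw [wordMean_mul hs (σ := (Sum.inl : I → I ⊕ J)) (τ := Sum.inr)
    (by rw [Sum.elim_inl_inr]; exact Function.injective_id)
    (fun x => wordMean μ (fun y => T.indicator 1 (x, y)))
    fun y => wordMean μ (fun x => T.indicator 1 (x, y)), sq]
  congr 1
  exact (wordMean_comm _).symm

lemma wordMean_nonneg (hμ : ∀ a, 0 < μ a) {F : (I → A) → ℝ} (h : ∀ x, 0 ≤ F x) :
    0 ≤ wordMean μ F :=
  Finset.sum_nonneg fun x _ => mul_nonneg (Finset.prod_nonneg fun i _ => (hμ (x i)).le) (h x)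

/-- The second moment method for `B` words `x x'` and `B` words `y y'`. -/
lemma wordMean_no_symmetrized_le (hμ : ∀ a, 0 < μ a) (hs : ∑ a, μ a = 1) [Nonempty A]
    (T : Set ((I → A) × (J → A))) {p q₁ q₂ : ℝ}
    (hp : p = wordMean μ fun x => wordMean μ fun y => T.indicator 1 (x, y)) (hp0 : 0 < p)
    (hq₁ : ∀ x, wordMean μ (fun y => T.indicator 1 (x, y)) ≤ q₁)
    (hq₂ : ∀ y, wordMean μ (fun x => T.indicator 1 (x, y)) ≤ q₂) {B : ℕ} (hB : 0 < B) :
    (wordMean μ fun x : Fin B × (I ⊕ J) → A => wordMean μ fun y : Fin B × (J ⊕ I) → A =>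
      {z : (Fin B × (I ⊕ J) → A) × (Fin B × (J ⊕ I) → A) |
        ∀ i j, ((fun l => z.1 (i, l)), fun l => z.2 (j, l)) ∉ symmetrized T}.indicator 1 (x, y))
      ≤ 1 / (B ^ 2 * p ^ 2) + 2 * (q₁ * q₂) / (B * p ^ 2) := by
  have hT0 : ∀ z, 0 ≤ T.indicator (1 : (I → A) × (J → A) → ℝ) z :=
    fun z => Set.indicator_nonneg (fun _ _ => zero_le_one) z
  have hq₁0 : 0 ≤ q₁ := (wordMean_nonneg hμ fun _ => hT0 _).trans
    (hq₁ fun _ => Classical.arbitrary A)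
  have key := wordMean_no_hit_le (μ := fun u : I ⊕ J → A => ∏ i, μ (u i))
    (ν := fun v : J ⊕ I → A => ∏ i, μ (v i))
    (fun u => Finset.prod_pos fun i _ => hμ _) (sum_prod_eq_one hs)
    (fun u => Finset.prod_pos fun i _ => hμ _) (sum_prod_eq_one hs) (symmetrized T)
    (p := p ^ 2) (s := q₁ * q₂) (by rw [hp]; exact (wordMean_symmetrized hs T).symm)
    (by positivity)
    (fun u => by
      refine (wordMean_symmetrized_left hs T u).le.trans ?_
      exact mul_le_mul (hq₁ _) (hq₂ _) (wordMean_nonneg hμ fun _ => hT0 _) hq₁0)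
    (fun v => by
      refine (wordMean_symmetrized_right hs T v).le.trans ?_
      rw [mul_comm]
      exact mul_le_mul (hq₁ _) (hq₂ _) (wordMean_nonneg hμ fun _ => hT0 _) hq₁0) hB
  refine le_trans (le_of_eq ?_) key
  rw [← wordMean_curry]
  refine congrArg _ (funext fun x => ?_)
  exact wordMean_curry (fun y : Fin B → J ⊕ I → A =>
    {y : Fin B → J ⊕ I → A | ∀ i j, ((fun l => x (i, l)), y j) ∉ symmetrized T}.indicator
      (1 : (Fin B → J ⊕ I → A) → ℝ) y)

end Symmetrized

section Positions

/-- The position of the `p`-th letter of the `t`-th factor, for consecutive factors of length `m`. -/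
def factorPos {r m : ℕ} (z : Fin r × Fin m) : ℕ := z.1 * m + z.2

/-- The positions of the letters of `r` factors of length `m`, followed by `r` factors of length `n`. -/
def doublePos {r m n : ℕ} : (Fin r × Fin m) ⊕ (Fin r × Fin n) → ℕ :=
  Sum.elim factorPos fun z => r * m + factorPos z

lemma injective_mul_add {J : Type*} {f : J → ℕ} {l B : ℕ} (hf : f.Injective) (hl : ∀ j, f j < l) :
    Function.Injective fun z : Fin B × J => (z.1 : ℕ) * l + f z.2 := by
  rintro ⟨i, j⟩ ⟨i', j'⟩ h
  simp only at h
  have hpos : 0 < l := (Nat.zero_le _).trans_lt (hl j)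
  have h1 := congrArg (· / l) h
  simp only [mul_comm _ l, Nat.mul_add_div hpos, Nat.div_eq_of_lt (hl _), add_zero] at h1
  rw [h1] at h
  have h2 := hf (Nat.add_left_cancel h)
  rw [Fin.ext h1, h2]

lemma factorPos_lt {r m : ℕ} (z : Fin r × Fin m) : factorPos z < r * m := by
  have h1 : ((z.1 : ℕ) + 1) * m ≤ r * m := Nat.mul_le_mul_right m z.1.2
  have h2 := z.2.2
  rw [factorPos]
  linarith

lemma factorPos_injective {r m : ℕ} : (factorPos : Fin r × Fin m → ℕ).Injective :=
  injective_mul_add Fin.val_injective fun j => j.2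

lemma doublePos_lt {r m n : ℕ} (z : (Fin r × Fin m) ⊕ (Fin r × Fin n)) :
    doublePos z < r * (m + n) := by
  rw [mul_add]
  rcases z with z | z
  · exact (factorPos_lt z).trans_le (Nat.le_add_right _ _)
  · exact Nat.add_lt_add_left (factorPos_lt z) _

lemma doublePos_injective {r m n : ℕ} :
    (doublePos : (Fin r × Fin m) ⊕ (Fin r × Fin n) → ℕ).Injective := by
  refine factorPos_injective.sumElim
    (fun a b h => factorPos_injective (Nat.add_left_cancel h)) fun a b h => ?_
  have := factorPos_lt a
  omega

end Positions

section Lower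

variable {A : Type*} [Fintype A] [MeasurableSpace A] [MeasurableSingletonClass A]
  {Ω : Type*} [MeasurableSpace Ω] {P : Measure Ω} [IsProbabilityMeasure P] {μ : A → ℝ}
  {X Y : ℕ → Ω → A}

lemma measureReal_letters_prod_mem (hX : ∀ p, Measurable (X p)) (hY : ∀ q, Measurable (Y q))
    (hindep : iIndepFun (Sum.elim X Y) P)
    (hXlaw : ∀ p a, P.real (X p ⁻¹' {a}) = μ a) (hYlaw : ∀ q a, P.real (Y q ⁻¹' {a}) = μ a)
    {I J : Type*} [Fintype I] [DecidableEq I] [Fintype J] [DecidableEq J] {σ : I → ℕ} {τ : J → ℕ}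
    (hσ : σ.Injective) (hτ : τ.Injective) (S : Set ((I → A) × (J → A))) :
    P.real {ω | ((fun i => X (σ i) ω), fun j => Y (τ j) ω) ∈ S}
      = wordMean μ fun x => wordMean μ fun y => S.indicator 1 (x, y) := by
  have h := measureReal_letters_mem hX hY hindep hXlaw hYlaw (hσ.sumMap hτ)
    {z | (z ∘ Sum.inl, z ∘ Sum.inr) ∈ S}
  rw [wordMean_sum] at h
  exact h

variable {K : A → A → ℝ} {g : ℕ → ℝ} {κ m n r : ℕ} {θ D : ℝ}

omit [Fintype A] [MeasurableSpace A] [MeasurableSingletonClass A] in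
lemma exists_anchoredScore_of_mem (hg : g 0 = 0) (hθ : 0 < θ) (hκ : 0 < κ) (hm : κ ≤ m)
    (hn : κ ≤ n) {Γ : Set ((Fin r → Fin m → A) × (Fin r → Fin n → A))}
    (hΓ : ∀ z ∈ Γ, r * D ≤ θ * ∑ t, scoreG K g κ (z.1 t) (z.2 t)) {x y : ℕ → A}
    (h : ((fun t p => x (factorPos (t, p))), fun t q => y (factorPos (t, q))) ∈ Γ) :
    ∃ s, r * D / θ ≤ s ∧ AnchoredScore K g x y (r * κ) (r * m) (r * n) s := by
  refine ⟨_, ?_, AnchoredScore.sum_prefixG hg hκ hm hn r⟩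
  rw [Finset.sum_range, div_le_iff₀' hθ]
  have h' := hΓ _ h
  simp only [factorPos] at h'
  exact h'

variable [Nonempty A] (hμ : ∀ a, 0 < μ a) (hs : ∑ a, μ a = 1) (hX : ∀ p, Measurable (X p))
  (hY : ∀ q, Measurable (Y q)) (hindep : iIndepFun (Sum.elim X Y) P)
  (hXlaw : ∀ p a, P.real (X p ⁻¹' {a}) = μ a) (hYlaw : ∀ q a, P.real (Y q ⁻¹' {a}) = μ a)
  (hK : ∀ a b, K a b = K b a) (hg : IsGapPenalty g)
include hμ hs hX hY hindep hXlaw hYlaw hK hg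

omit [Fintype A] [MeasurableSpace A] [MeasurableSingletonClass A] [Nonempty A] hμ hs hX hY hindep
  hXlaw hYlaw in
lemma le_prefixH_of_symmetrized_mem (hθ : 0 < θ) (hκ : 0 < κ) (hm : κ ≤ m) (hn : κ ≤ n)
    (hr : 0 < r) {Γ : Set ((Fin r → Fin m → A) × (Fin r → Fin n → A))}
    (hΓ : ∀ z ∈ Γ, r * D ≤ θ * ∑ t, scoreG K g κ (z.1 t) (z.2 t)) {N a b : ℕ} {x y : ℕ → A}
    (ha : a + r * (m + n) ≤ N) (hb : b + r * (m + n) ≤ N)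
    (h : ((fun l => x (a + doublePos l)), fun l => y (b + doublePos l)) ∈ symmetrized
      {z : (Fin r × Fin m → A) × (Fin r × Fin n → A) |
        ((fun t p => z.1 (t, p)), fun t q => z.2 (t, q)) ∈ Γ}) :
    2 * (r * D / θ) ≤ prefixH K g N N x y := by
  obtain ⟨h1, h2⟩ := h
  obtain ⟨s, hs1, hs2⟩ := exists_anchoredScore_of_mem hg.zero hθ hκ hm hn hΓ
    (x := fun k => x (a + k)) (y := fun k => y (b + k)) h1
  obtain ⟨s', hs1', hs2'⟩ := exists_anchoredScore_of_mem hg.zero hθ hκ hm hn hΓ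
    (x := fun k => y (b + (r * n + k))) (y := fun k => x (a + (r * m + k))) h2
  have := (hs2.append (hs2'.symm hK)).le_prefixH (x := x) (y := y)
    hg.nonneg (M := N) (N := N) (a := a) (b := b)
    (by positivity) (by rw [← mul_add]; exact ha) (by rw [← mul_add, add_comm n m]; exact hb)
  linarith

lemma measureReal_prefixH_lt_le (hθ : 0 < θ) (hκ : 0 < κ) (hm : κ ≤ m) (hn : κ ≤ n) (hr : 0 < r)
    {Γ : Set ((Fin r → Fin m → A) × (Fin r → Fin n → A))}
    (hΓ : ∀ z ∈ Γ, r * D ≤ θ * ∑ t, scoreG K g κ (z.1 t) (z.2 t)) {p q₁ q₂ : ℝ}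
    (hp : p = wordMean (fun x => ∏ i, μ (x i)) (fun x => wordMean (fun y => ∏ i, μ (y i))
      fun y => Γ.indicator 1 (x, y))) (hp0 : 0 < p)
    (hq₁ : ∀ x, wordMean (fun y => ∏ i, μ (y i)) (fun y => Γ.indicator 1 (x, y)) ≤ q₁)
    (hq₂ : ∀ y, wordMean (fun x => ∏ i, μ (x i)) (fun x => Γ.indicator 1 (x, y)) ≤ q₂)
    {B N : ℕ} (hB : 0 < B) (hBN : B * (r * (m + n)) ≤ N) :
    P.real {ω | prefixH K g N N (fun k => X k ω) (fun k => Y k ω) < 2 * (r * D / θ)}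
      ≤ 1 / (B ^ 2 * p ^ 2) + 2 * (q₁ * q₂) / (B * p ^ 2) := by
  set T : Set ((Fin r × Fin m → A) × (Fin r × Fin n → A)) :=
    {z | ((fun t p => z.1 (t, p)), fun t q => z.2 (t, q)) ∈ Γ} with hT
  have hT1 : ∀ x, wordMean μ (fun y => T.indicator 1 (x, y)) ≤ q₁ := fun x =>
    (wordMean_curry (fun y => Γ.indicator (1 : (Fin r → Fin m → A) × (Fin r → Fin n → A) → ℝ)
      ((fun t p => x (t, p)), y))).le.trans (hq₁ fun t p => x (t, p))
  have hT2 : ∀ y, wordMean μ (fun x => T.indicator 1 (x, y)) ≤ q₂ := fun y =>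
    (wordMean_curry (fun x => Γ.indicator (1 : (Fin r → Fin m → A) × (Fin r → Fin n → A) → ℝ)
      (x, fun t p => y (t, p)))).le.trans (hq₂ fun t p => y (t, p))
  have hTp : p = wordMean μ (fun x => wordMean μ fun y => T.indicator 1 (x, y)) := by
    rw [hp, ← wordMean_curry]
    refine congrArg _ (funext fun x => ?_)
    exact (wordMean_curry (fun y => Γ.indicator
      (1 : (Fin r → Fin m → A) × (Fin r → Fin n → A) → ℝ) ((fun t p => x (t, p)), y))).symm
  refine le_trans ?_ (wordMean_no_symmetrized_le hμ hs T hTp hp0 hT1 hT2 hB)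
  -- the pairs of factors of length `r * (m + n)` of the two words
  have h := measureReal_letters_prod_mem hX hY hindep hXlaw hYlaw
    (injective_mul_add (B := B) (doublePos_injective (r := r) (m := m) (n := n))
      fun j => doublePos_lt j)
    (injective_mul_add (B := B) (doublePos_injective (r := r) (m := n) (n := m))
      (l := r * (m + n)) fun j => by rw [add_comm m n]; exact doublePos_lt j)
    {z | ∀ i j, ((fun l => z.1 (i, l)), fun l => z.2 (j, l)) ∉ symmetrized T}
  refine le_trans ?_ h.le
  refine measureReal_mono ?_ (measure_ne_top _ _)
  intro ω hω i j hij
  have hω' : prefixH K g N N (fun k => X k ω) (fun k => Y k ω) < 2 * (r * D / θ) := hω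
  have hb : ∀ i : Fin B, (i : ℕ) * (r * (m + n)) + r * (m + n) ≤ N := fun i => by
    have : ((i : ℕ) + 1) * (r * (m + n)) ≤ B * (r * (m + n)) := Nat.mul_le_mul_right _ i.2
    linarith
  exact hω'.not_ge (le_prefixH_of_symmetrized_mem hK hg hθ hκ hm hn hr hΓ (hb i) (hb j) hij)

/-- If some moment generating function exceeds `1` at `θ`, then the score reaches `c` in words of
length of order `c` with probability about `exp(-θ c)`, and it reaches about `2 log N / θ` in
words of length `N`. Here `c = r D / θ` and `N` is about `exp(r D)`. -/
lemma exists_lower_bounds (hθ : 0 < θ) (hκ : 0 < κ) (hm : κ ≤ m) (hn : κ ≤ n)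
    (hM : 1 < mgf K g μ κ θ m n) :
    ∃ D : ℝ, 0 < D ∧ ∃ r₀ : ℕ, ∀ r : ℕ, r₀ ≤ r → 0 < r →
      (∀ M N : ℕ, r * m ≤ M → r * n ≤ N → Real.exp (-(r * D)) / 2 ≤
        P.real {ω | r * D / θ ≤ prefixH K g M N (fun k => X k ω) (fun k => Y k ω)}) ∧
      (∀ B N : ℕ, 0 < B → B * (r * (m + n)) ≤ N →
        P.real {ω | prefixH K g N N (fun k => X k ω) (fun k => Y k ω) < 2 * (r * D / θ)}
          ≤ 4 * (Real.exp (r * D) / B) ^ 2 + 8 * (Real.exp (r * D) / B)) := by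
  obtain ⟨D, hD, r₀, H⟩ := exists_tilted_typical (μ := fun x : Fin m → A => ∏ i, μ (x i))
    (ν := fun y : Fin n → A => ∏ i, μ (y i)) (fun u => Finset.prod_pos fun i _ => hμ _)
    (sum_prod_eq_one hs) (fun u => Finset.prod_pos fun i _ => hμ _) (sum_prod_eq_one hs)
    (scoreG K g κ) hθ hM
  refine ⟨D, hD, r₀, fun r hr hr0 => ?_⟩
  obtain ⟨Γ, hΓ, p, q₁, q₂, hp, hplow, hq₁, hq₂, hq⟩ := H r hr
  have hp0 : 0 < p := lt_of_lt_of_le (by positivity) hplow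
  constructor
  · intro M N hM hN
    refine hplow.trans ?_
    have h := measureReal_letters_prod_mem hX hY hindep hXlaw hYlaw
      (factorPos_injective (r := r) (m := m)) (factorPos_injective (r := r) (m := n))
      {z | ((fun t p => z.1 (t, p)), fun t q => z.2 (t, q)) ∈ Γ}
    rw [hp, ← wordMean_curry]
    simp only [← wordMean_curry]
    refine h.ge.trans (measureReal_mono ?_ (measure_ne_top _ _))
    intro ω hω
    obtain ⟨s, hs1, hs2⟩ := exists_anchoredScore_of_mem hg.zero hθ hκ hm hn hΓ
      (x := fun k => X k ω) (y := fun k => Y k ω) hω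
    exact hs1.trans (AnchoredScore.le_prefixH hg.nonneg (a := 0) (b := 0) (u := r * κ) (m := r * m)
      (n := r * n) (by positivity) (by omega) (by omega) (by simpa using hs2))
  · intro B N hB hBN
    refine (measureReal_prefixH_lt_le hμ hs hX hY hindep hXlaw hYlaw hK hg hθ hκ hm hn hr0 hΓ hp
      hp0 hq₁ hq₂ hB hBN).trans ?_
    have hB' : (0 : ℝ) < B := by exact_mod_cast hB
    have h1 : 1 / p ^ 2 ≤ 4 * Real.exp (r * D) ^ 2 := by
      have := pow_le_pow_left₀ (by positivity) hplow 2
      rw [div_le_iff₀ (by positivity)]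
      calc (1 : ℝ) = 4 * Real.exp (r * D) ^ 2 * (Real.exp (-(r * D)) / 2) ^ 2 := by
            rw [Real.exp_neg]
            field_simp
            norm_num
        _ ≤ _ := by gcongr
    have h2 : q₁ * q₂ / p ^ 2 ≤ 4 * Real.exp (r * D) := by
      rw [div_le_iff₀ (by positivity)]
      exact hq
    have e1 : 1 / (B ^ 2 * p ^ 2) = (1 / p ^ 2) / B ^ 2 := by field_simp
    have e2 : 2 * (q₁ * q₂) / (B * p ^ 2) = 2 * (q₁ * q₂ / p ^ 2) / B := by field_simp
    have e3 : 4 * (Real.exp (r * D) / B) ^ 2 = 4 * Real.exp (r * D) ^ 2 / B ^ 2 := by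
      rw [div_pow, mul_div_assoc]
    have e4 : 8 * (Real.exp (r * D) / B) = 2 * (4 * Real.exp (r * D)) / B := by ring
    rw [e1, e2, e3, e4]
    gcongr

end Lower

/-! ### The large deviation rate and the strong law -/

/-- A monotone sequence that grows like `v log n` along the powers of two does so throughout. -/
lemma tendsto_div_log_of_dyadic {f : ℕ → ℝ} (hf : ∀ a b, 0 < a → a ≤ b → f a ≤ f b) {v : ℝ}
    {u l : ℕ → ℝ} (hu0 : ∀ j, 0 ≤ u j) (hl0 : ∀ j, 0 ≤ l j) (hu : Tendsto u atTop (𝓝 v))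
    (hl : Tendsto l atTop (𝓝 v))
    (hfu : ∀ j, ∀ᶠ k : ℕ in atTop, f (2 ^ k) ≤ u j * (k * Real.log 2))
    (hfl : ∀ j, ∀ᶠ k : ℕ in atTop, l j * (k * Real.log 2) ≤ f (2 ^ k)) :
    Tendsto (fun n : ℕ => f n / Real.log n) atTop (𝓝 v) := by
  have hlog : Tendsto (fun n : ℕ => Real.log n) atTop atTop :=
    Real.tendsto_log_atTop.comp tendsto_natCast_atTop_atTop
  have hL : 0 < Real.log 2 := Real.log_pos one_lt_two
  have hlim : ∀ a b : ℝ, Tendsto (fun n : ℕ => a + b / Real.log n) atTop (𝓝 a) := fun a b => by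
    simpa using (hlog.const_div_atTop b).const_add a
  have hkn : ∀ n : ℕ, n ≠ 0 → (Nat.log 2 n : ℝ) * Real.log 2 ≤ Real.log n := fun n hn => by
    rw [← Real.log_pow]
    exact Real.log_le_log (by positivity) (by exact_mod_cast Nat.pow_log_le_self 2 hn)
  have hnk : ∀ n : ℕ, n ≠ 0 → Real.log n ≤ ((Nat.log 2 n : ℝ) + 1) * Real.log 2 := fun n hn => by
    rw [← Nat.cast_add_one, ← Real.log_pow]
    exact Real.log_le_log (by exact_mod_cast Nat.pos_of_ne_zero hn)
      (by exact_mod_cast (Nat.lt_pow_succ_log_self one_lt_two n).le)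
  rw [tendsto_order]
  constructor
  · intro b hb
    obtain ⟨j, hj⟩ := (hl.eventually_const_lt hb).exists
    obtain ⟨k₀, hk₀⟩ := eventually_atTop.1 (hfl j)
    filter_upwards [(hlim (l j) (-(l j * Real.log 2))).eventually_const_lt hj,
      eventually_ge_atTop (2 ^ k₀), hlog.eventually_gt_atTop 0] with n h1 h2 h3
    have hn : n ≠ 0 := by have := Nat.two_pow_pos k₀; omega
    refine h1.trans_le ?_
    have h4 := hk₀ _ (Nat.le_log_of_pow_le one_lt_two h2)
    have h5 := hf _ _ (Nat.two_pow_pos _) (Nat.pow_log_le_self 2 hn)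
    have h6 := mul_le_mul_of_nonneg_left (hnk n hn) (hl0 j)
    rw [le_div_iff₀ h3, add_mul, div_mul_cancel₀ _ h3.ne']
    linarith
  · intro b hb
    obtain ⟨j, hj⟩ := (hu.eventually_lt_const hb).exists
    obtain ⟨k₀, hk₀⟩ := eventually_atTop.1 (hfu j)
    filter_upwards [(hlim (u j) (u j * Real.log 2)).eventually_lt_const hj,
      eventually_ge_atTop (2 ^ k₀), hlog.eventually_gt_atTop 0] with n h1 h2 h3
    have hn : n ≠ 0 := by have := Nat.two_pow_pos k₀; omega
    refine lt_of_le_of_lt ?_ h1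
    have h4 := hk₀ _ ((Nat.le_log_of_pow_le one_lt_two h2).trans (Nat.le_succ _))
    have h5 := hf _ _ (Nat.pos_of_ne_zero hn) (Nat.lt_pow_succ_log_self one_lt_two n).le
    have h6 := mul_le_mul_of_nonneg_left (hkn n hn) (hu0 j)
    rw [div_le_iff₀ h3, add_mul, div_mul_cancel₀ _ h3.ne']
    push_cast at h4
    linarith

lemma ae_eventually_notMem_of_summable {Ω : Type*} [MeasurableSpace Ω] {P : Measure Ω}
    [IsProbabilityMeasure P] {s : ℕ → Set Ω} (h : Summable fun k => P.real (s k)) :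
    ∀ᵐ ω ∂P, ∀ᶠ k in atTop, ω ∉ s k := by
  refine ae_eventually_notMem ?_
  have : ∀ k, P (s k) = ENNReal.ofReal (P.real (s k)) := fun k => by
    rw [ofReal_measureReal]
  simp only [this]
  exact h.tsum_ofReal_ne_top

section Limits

variable {A : Type*} [Fintype A] [MeasurableSpace A] [MeasurableSingletonClass A] [Nonempty A]
  {Ω : Type*} [MeasurableSpace Ω] {P : Measure Ω} [IsProbabilityMeasure P] {μ : A → ℝ}
  {X Y : ℕ → Ω → A} {K : A → A → ℝ} {g : ℕ → ℝ} {κ m n r : ℕ} {θ : ℝ}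
  (hμ : ∀ a, 0 < μ a) (hs : ∑ a, μ a = 1) (hX : ∀ p, Measurable (X p))
  (hY : ∀ q, Measurable (Y q)) (hindep : iIndepFun (Sum.elim X Y) P)
  (hXlaw : ∀ p a, P.real (X p ⁻¹' {a}) = μ a) (hYlaw : ∀ q a, P.real (Y q ⁻¹' {a}) = μ a)
  (hg : IsGapPenalty g) (hsum : ∀ t : ℝ, 0 < t → Summable fun i => Real.exp (-t * g i))
include hμ hs hX hY hindep hXlaw hYlaw hg hsum

/-- The upper half of the large deviation estimate. -/
lemma eventually_lt_rate (hθ : 0 < θ) (hψ : psi K g μ θ < 0) {M N : ℝ → ℕ} {b : ℝ} (hb : b < θ)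
    (hMN : (fun c : ℝ => Real.log ((M c : ℝ) * (N c : ℝ))) =o[atTop] (fun c : ℝ => c))
    (hpos : ∀ᶠ c in atTop, 0 < M c ∧ 0 < N c ∧
      0 < P.real {ω | c ≤ prefixH K g (M c) (N c) (fun k => X k ω) (fun k => Y k ω)}) :
    ∀ᶠ c in atTop, b < -c⁻¹ * Real.log (P.real {ω | c ≤
      prefixH K g (M c) (N c) (fun k => X k ω) (fun k => Y k ω)}) := by
  obtain ⟨k, hk⟩ := exists_upper_bound K
  obtain ⟨C, hC, H⟩ := exists_measureReal_le_prefixH_le hμ hs hX hY hindep hXlaw hYlaw hg hk hsum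
    hθ hψ
  have hlim : Tendsto (fun c : ℝ => θ - Real.log ((M c : ℝ) * (N c : ℝ)) / c - Real.log C / c)
      atTop (𝓝 (θ - 0 - 0)) :=
    (hMN.tendsto_div_nhds_zero.const_sub θ).sub (tendsto_id.const_div_atTop _)
  rw [sub_zero, sub_zero] at hlim
  filter_upwards [hlim.eventually_const_lt hb, hpos, eventually_gt_atTop 0] with c h1 h2 hc
  obtain ⟨hM, hN, hP⟩ := h2
  refine h1.trans_le ?_
  have hM' : (0 : ℝ) < M c := by exact_mod_cast hM
  have hN' : (0 : ℝ) < N c := by exact_mod_cast hN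
  have h3 := Real.log_le_log hP (H c _ _ hM hN)
  rw [Real.log_mul (by positivity) hC.ne', Real.log_mul (by positivity) (Real.exp_pos _).ne',
    Real.log_exp] at h3
  have h4 := mul_le_mul_of_nonneg_left h3 (inv_pos.2 hc).le
  have e : c⁻¹ * (Real.log (M c * N c) + -θ * c + Real.log C)
      = -(θ - Real.log (M c * N c) / c - Real.log C / c) := by
    field_simp
    ring
  rw [e] at h4
  linarith

lemma eventually_prefixH_two_pow_le (hθ : 0 < θ) (hψ : psi K g μ θ < 0) {u : ℝ} (hu : 2 < θ * u) :
    ∀ᵐ ω ∂P, ∀ᶠ k : ℕ in atTop,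
      prefixH K g (2 ^ k) (2 ^ k) (fun k => X k ω) (fun k => Y k ω) ≤ u * (k * Real.log 2) := by
  obtain ⟨k, hk⟩ := exists_upper_bound K
  obtain ⟨C, hC, H⟩ := exists_measureReal_le_prefixH_le hμ hs hX hY hindep hXlaw hYlaw hg hk hsum
    hθ hψ
  have hL : 0 < Real.log 2 := Real.log_pos one_lt_two
  have hS : Summable fun k : ℕ => P.real {ω | u * (k * Real.log 2) ≤
      prefixH K g (2 ^ k) (2 ^ k) (fun k => X k ω) (fun k => Y k ω)} := by
    have hgeom : Summable fun k : ℕ => Real.exp ((2 - θ * u) * Real.log 2) ^ k * C :=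
      (summable_geometric_of_lt_one (Real.exp_pos _).le (Real.exp_lt_one_iff.2
        (mul_neg_of_neg_of_pos (by linarith) hL))).mul_right C
    refine Summable.of_nonneg_of_le (fun _ => measureReal_nonneg) (fun k => ?_) hgeom
    refine (H _ _ _ (Nat.two_pow_pos k) (Nat.two_pow_pos k)).trans (le_of_eq ?_)
    congr 1
    have e : ((2 ^ k : ℕ) : ℝ) = Real.exp (k * Real.log 2) := by
      rw [Real.exp_nat_mul, Real.exp_log two_pos]
      norm_num
    rw [e, ← Real.exp_add, ← Real.exp_add, ← Real.exp_nat_mul]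
    congr 1
    ring
  filter_upwards [ae_eventually_notMem_of_summable hS] with ω hω
  filter_upwards [hω] with k hk
  exact (not_le.1 hk).le

omit hsum in
/-- The lower half of the large deviation estimate. -/
lemma exists_le_measureReal_prefixH (hK : ∀ a b, K a b = K b a) (hθ : 0 < θ) (hκ : 0 < κ)
    (hm : κ ≤ m) (hn : κ ≤ n) (hM : 1 < mgf K g μ κ θ m n) :
    ∃ C₁ C₂ c₀ : ℝ, 0 < C₁ ∧ ∀ c : ℝ, c₀ ≤ c → ∀ M N : ℕ, C₂ * c ≤ M → C₂ * c ≤ N →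
      C₁ * Real.exp (-θ * c) ≤
        P.real {ω | c ≤ prefixH K g M N (fun k => X k ω) (fun k => Y k ω)} := by
  obtain ⟨D, hD, r₀, H⟩ := exists_lower_bounds hμ hs hX hY hindep hXlaw hYlaw hK hg hθ hκ hm hn hM
  refine ⟨Real.exp (-D) / 2, (θ / D + 1) * (m + n), max 1 (D / θ * r₀), by positivity,
    fun c hc M N hMc hNc => ?_⟩
  have hc1 : 1 ≤ c := (le_max_left _ _).trans hc
  have hc2 : D / θ * r₀ ≤ c := (le_max_right _ _).trans hc
  have hcθ : 0 < c * θ / D := by positivity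
  set r := ⌈c * θ / D⌉₊
  have hr0 : 0 < r := Nat.ceil_pos.2 hcθ
  have hr1 : c * θ / D ≤ r := Nat.le_ceil _
  have hr2 : (r : ℝ) ≤ c * θ / D + 1 := (Nat.ceil_lt_add_one hcθ.le).le
  have hrr₀ : r₀ ≤ r := by
    have : (r₀ : ℝ) ≤ r := by
      refine le_trans ?_ hr1
      rw [le_div_iff₀ hD]
      rw [div_mul_eq_mul_div, div_le_iff₀ hθ] at hc2
      linarith
    exact_mod_cast this
  have hlen : (r : ℝ) * (m + n) ≤ (θ / D + 1) * (m + n) * c := by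
    have : (r : ℝ) ≤ (θ / D + 1) * c := hr2.trans (by
      have : c * θ / D = θ / D * c := by ring
      linarith)
    have := mul_le_mul_of_nonneg_right this (by positivity : (0 : ℝ) ≤ (m : ℝ) + n)
    linarith
  have hm' : r * m ≤ M := by
    have h1 : (r : ℝ) * m ≤ M := by
      have : (0 : ℝ) ≤ r * n := by positivity
      linarith
    exact_mod_cast h1
  have hn' : r * n ≤ N := by
    have h1 : (r : ℝ) * n ≤ N := by
      have : (0 : ℝ) ≤ r * m := by positivity
      linarith
    exact_mod_cast h1
  have h1 := (H r hrr₀ hr0).1 M N hm' hn'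
  have h2 : Real.exp (-D) / 2 * Real.exp (-θ * c) ≤ Real.exp (-(r * D)) / 2 := by
    rw [div_mul_eq_mul_div, ← Real.exp_add]
    refine div_le_div_of_nonneg_right (Real.exp_le_exp.2 ?_) two_pos.le
    have := mul_le_mul_of_nonneg_right hr2 hD.le
    rw [add_mul, div_mul_cancel₀ _ hD.ne'] at this
    linarith
  refine (h2.trans h1).trans (measureReal_mono (fun ω hω => ?_) (measure_ne_top _ _))
  have hω' : r * D / θ ≤ prefixH K g M N (fun k => X k ω) (fun k => Y k ω) := hω
  refine le_trans ?_ hω'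
  rw [le_div_iff₀ hθ]
  rwa [div_le_iff₀ hD] at hr1

omit hsum in
lemma eventually_le_prefixH_two_pow (hK : ∀ a b, K a b = K b a) (hθ : 0 < θ) (hκ : 0 < κ)
    (hm : κ ≤ m) (hn : κ ≤ n) (hM : 1 < mgf K g μ κ θ m n) {l : ℝ} (hl0 : 0 < l)
    (hl : θ * l < 2) :
    ∀ᵐ ω ∂P, ∀ᶠ k : ℕ in atTop,
      l * (k * Real.log 2) ≤ prefixH K g (2 ^ k) (2 ^ k) (fun k => X k ω) (fun k => Y k ω) := by
  obtain ⟨D, hD, r₀, H⟩ := exists_lower_bounds hμ hs hX hY hindep hXlaw hYlaw hK hg hθ hκ hm hn hM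
  have hL : 0 < Real.log 2 := Real.log_pos one_lt_two
  obtain ⟨q, hq1, hq2⟩ := exists_between (show θ * l / 2 < 1 by linarith)
  have hq0 : 0 < q := lt_trans (by positivity) hq1
  -- the score is built from `r k` factors, found among `B k * B k` pairs of long factors
  set r : ℕ → ℕ := fun k => ⌊q * (k * Real.log 2) / D⌋₊ with hr
  set L := m + n
  have hL0 : 0 < L := by omega
  set B : ℕ → ℕ := fun k => 2 ^ k / (r k * L) with hB
  have hx0 : ∀ k : ℕ, 0 ≤ q * (k * Real.log 2) / D := fun k => by positivity
  have hr1 : ∀ k, (r k : ℝ) ≤ q * (k * Real.log 2) / D := fun k => Nat.floor_le (hx0 k)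
  have hr2 : ∀ k, q * (k * Real.log 2) / D < r k + 1 := fun k => Nat.lt_floor_add_one _
  have hkL : Tendsto (fun k : ℕ => (k : ℝ) * Real.log 2) atTop atTop :=
    tendsto_natCast_atTop_atTop.atTop_mul_const hL
  have hrtop : Tendsto r atTop atTop :=
    tendsto_nat_floor_atTop.comp ((hkL.const_mul_atTop hq0).atTop_div_const hD)
  set σ := Real.exp (-((1 - q) * Real.log 2)) with hσ
  have hσ1 : σ < 1 := Real.exp_lt_one_iff.2 (by
    have := mul_pos (sub_pos.2 hq2) hL
    linarith)
  set C : ℝ := 2 * (q * Real.log 2 / D * L)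
  have hbig : ∀ᶠ k : ℕ in atTop, r k * L ≤ 2 ^ k := by
    have h1 := (tendsto_pow_const_div_const_pow_of_one_lt 1 (one_lt_two (α := ℝ))).const_mul C
    rw [mul_zero] at h1
    filter_upwards [h1.eventually_lt_const one_pos] with k hk
    have h2 : (r k : ℝ) * L ≤ 2 ^ k := by
      rw [pow_one, ← mul_div_assoc, div_lt_one (by positivity)] at hk
      have h3 := mul_le_mul_of_nonneg_right (hr1 k) (Nat.cast_nonneg L)
      have h4 : (0 : ℝ) ≤ q * (k * Real.log 2) / D * L := mul_nonneg (hx0 k) (Nat.cast_nonneg L)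
      have e : C * k = 2 * (q * (k * Real.log 2) / D * L) := by simp only [C]; ring
      linarith
    exact_mod_cast h2
  have hscore : ∀ᶠ k : ℕ in atTop, l * (k * Real.log 2) ≤ 2 * (r k * D / θ) := by
    have h1 : Tendsto (fun k : ℕ => (2 * q - θ * l) * (k * Real.log 2)) atTop atTop :=
      hkL.const_mul_atTop (by linarith)
    filter_upwards [h1.eventually_ge_atTop (2 * D)] with k hk
    have h2 := mul_lt_mul_of_pos_right (hr2 k) hD
    rw [div_mul_cancel₀ _ hD.ne'] at h2
    rw [← mul_div_assoc, le_div_iff₀ hθ]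
    linarith
  have hratio : ∀ᶠ k : ℕ in atTop, 0 < r k ∧ 0 < B k ∧
      Real.exp (r k * D) / B k ≤ C * (k * σ ^ k) := by
    filter_upwards [hbig, hrtop.eventually_gt_atTop 0] with k hk hrk
    have hrL : 0 < r k * L := Nat.mul_pos hrk hL0
    have hBk : 0 < B k := Nat.div_pos hk hrL
    refine ⟨hrk, hBk, ?_⟩
    have hB' : (0 : ℝ) < B k := by exact_mod_cast hBk
    have h1 : (2 : ℝ) ^ k ≤ r k * L * (2 * B k) := by
      have h2 : 2 ^ k < r k * L * (B k + 1) := Nat.lt_mul_div_succ _ hrL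
      have h3 : r k * L * (B k + 1) ≤ r k * L * (2 * B k) := Nat.mul_le_mul_left _ (by omega)
      exact_mod_cast h2.le.trans h3
    rw [div_le_iff₀ hB']
    have h4 : Real.exp (r k * D) ≤ σ ^ k * 2 ^ k := by
      have e : (2 : ℝ) ^ k = Real.exp (k * Real.log 2) := by
        rw [Real.exp_nat_mul, Real.exp_log two_pos]
      rw [hσ, e, ← Real.exp_nat_mul, ← Real.exp_add]
      refine Real.exp_le_exp.2 ?_
      have := hr1 k
      rw [le_div_iff₀ hD] at this
      linarith
    have hσk : 0 ≤ σ ^ k := pow_nonneg (Real.exp_pos _).le k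
    calc Real.exp (r k * D) ≤ σ ^ k * (r k * L * (2 * B k)) :=
          h4.trans (mul_le_mul_of_nonneg_left h1 hσk)
      _ ≤ σ ^ k * (q * (k * Real.log 2) / D * L * (2 * B k)) := by
          gcongr
          exact hr1 k
      _ = C * (k * σ ^ k) * B k := by simp only [C]; ring
  have hS : Summable fun k : ℕ => P.real {ω |
      prefixH K g (2 ^ k) (2 ^ k) (fun k => X k ω) (fun k => Y k ω) < 2 * (r k * D / θ)} := by
    have hσ0 : 0 < σ := Real.exp_pos _
    have hS1 : Summable fun k : ℕ => (k : ℝ) ^ 1 * σ ^ k :=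
      summable_pow_mul_geometric_of_norm_lt_one 1 (by rwa [Real.norm_of_nonneg hσ0.le])
    have hS2 : Summable fun k : ℕ => (k : ℝ) ^ 2 * (σ ^ 2) ^ k :=
      summable_pow_mul_geometric_of_norm_lt_one 2 (by
        rw [Real.norm_of_nonneg (by positivity)]
        exact pow_lt_one₀ hσ0.le hσ1 two_ne_zero)
    refine Summable.of_norm_bounded_eventually_nat
      ((hS2.mul_left (4 * C ^ 2)).add (hS1.mul_left (8 * C))) ?_
    filter_upwards [hratio, hrtop.eventually_ge_atTop r₀] with k hk hrk
    obtain ⟨h1, h2, h3⟩ := hk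
    rw [Real.norm_of_nonneg measureReal_nonneg]
    refine ((H (r k) hrk h1).2 (B k) (2 ^ k) h2 (Nat.div_mul_le_self _ _)).trans ?_
    have h4 := pow_le_pow_left₀ (by positivity) h3 2
    have e : (C * (k * σ ^ k)) ^ 2 = C ^ 2 * ((k : ℝ) ^ 2 * (σ ^ 2) ^ k) := by
      rw [← pow_mul, mul_comm 2 k, pow_mul]; ring
    rw [e] at h4
    rw [pow_one]
    linarith
  filter_upwards [ae_eventually_notMem_of_summable hS] with ω hω
  filter_upwards [hω, hscore] with k h1 h2
  exact h2.trans (not_lt.1 h1)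

end Limits

end LocalAlignment

theorem theorem2 {A : Type*} [Fintype A] [MeasurableSpace A] [MeasurableSingletonClass A]
    {Ω : Type*} [MeasurableSpace Ω] (P : Measure Ω) [IsProbabilityMeasure P]
    -- the symmetric similarity score matrix and the letter distribution
    (K : A → A → ℝ) (hKsymm : ∀ a b, K a b = K b a)
    (μ : A → ℝ) (hμpos : ∀ a, 0 < μ a) (hμsum : ∑ a, μ a = 1)
    (hmean : ∑ a, ∑ b, μ a * μ b * K a b < 0) (hmax : ∃ a b, 0 < K a b)
    -- the two independent sequences of i.i.d. letters (`X p` is the letter number `p + 1`)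
    (X Y : ℕ → Ω → A) (hX : ∀ p, Measurable (X p)) (hY : ∀ q, Measurable (Y q))
    (hindep : iIndepFun (Sum.elim X Y) P)
    (hXlaw : ∀ p a, P.real (X p ⁻¹' {a}) = μ a) (hYlaw : ∀ q a, P.real (Y q ⁻¹' {a}) = μ a)
    -- the gap penalties
    (γ : ℕ → ℝ) (hγ1 : γ 1 = 0) (hγadm : ∃ Δ : ℝ, IsGapPenalty (gapPenalty Δ γ))
    (hγlog : Tendsto (fun k : ℕ => γ k / Real.log k) atTop atTop) :
    -- `ψ` is well defined, finite and convex on `(0, ∞)`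
    (∀ Δ : ℝ, IsGapPenalty (gapPenalty Δ γ) →
      (∀ κ : ℕ, 1 ≤ κ → ∀ θ : ℝ, 0 < θ → Summable (hTerm K (gapPenalty Δ γ) μ κ θ)) ∧
      (∀ θ : ℝ, 0 < θ →
        Tendsto (fun κ : ℕ => psiKappa K (gapPenalty Δ γ) μ κ θ / κ) atTop
          (𝓝 (psi K (gapPenalty Δ γ) μ θ))) ∧
      ConvexOn ℝ (Set.Ioi 0) (psi K (gapPenalty Δ γ) μ)) ∧
    -- for all large `Δ`, there is a unique positive root
    (∃ Δ₀ : ℝ, ∀ Δ : ℝ, Δ₀ ≤ Δ →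
      IsGapPenalty (gapPenalty Δ γ) ∧
      ∃ θt : ℝ, IsUniquePosRoot (psi K (gapPenalty Δ γ) μ) θt) ∧
    -- whenever there is a unique positive root, large deviations and strong law
    (∀ Δ : ℝ, IsGapPenalty (gapPenalty Δ γ) →
      ∀ θt : ℝ, IsUniquePosRoot (psi K (gapPenalty Δ γ) μ) θt →
      (∀ m n : ℝ → ℕ,
        Tendsto (fun c : ℝ => ((min (m c) (n c) : ℕ) : ℝ) / c) atTop atTop →
        (fun c : ℝ => Real.log ((m c : ℝ) * (n c : ℝ))) =o[atTop] (fun c : ℝ => c) →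
        Tendsto (fun c : ℝ => -c⁻¹ * Real.log (P.real {ω | c ≤
            localScore K (gapPenalty Δ γ) (fun p : Fin (m c) => X p ω)
              (fun q : Fin (n c) => Y q ω)}))
          atTop (𝓝 θt)) ∧
      (∀ᵐ ω ∂P, Tendsto (fun n : ℕ =>
          localScore K (gapPenalty Δ γ) (fun p : Fin n => X p ω) (fun q : Fin n => Y q ω)
            / Real.log n)
        atTop (𝓝 (2 / θt)))) := by
  have : Nonempty A := ⟨hmax.choose⟩
  obtain ⟨k, hk⟩ := exists_upper_bound K
  have hsum := fun (Δ t : ℝ) (ht : 0 < t) => summable_exp_neg_gapPenalty (Δ := Δ) hγlog ht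
  refine ⟨fun Δ hg => ⟨fun κ hκ θ hθ => summable_hTerm hμpos hμsum hg hk (hsum Δ) hθ hκ,
    fun θ hθ => tendsto_psiKappa hμpos hμsum hg hk (hsum Δ) hθ,
    convexOn_psi hμpos hμsum hg hk (hsum Δ)⟩,
    exists_forall_exists_isUniquePosRoot hμpos hμsum hmean hmax hγadm hγlog,
    fun Δ hg θt hθt => ?_⟩
  have hconv := convexOn_psi hμpos hμsum hg hk (hsum Δ)
  have hle := fun θ hθ => psi_le hμpos hμsum hg hk (hsum Δ) (θ := θ) hθ
  have hθt0 : 0 < θt := hθt.1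
  have hneg : ∀ θ, 0 < θ → θ < θt → psi K (gapPenalty Δ γ) μ θ < 0 :=
    fun θ hθ h => hθt.neg_of_lt hconv hle hθ h
  have hmgf : ∀ θ, θt < θ → ∃ κ m n, 0 < κ ∧ κ ≤ m ∧ κ ≤ n ∧
      1 < mgf K (gapPenalty Δ γ) μ κ θ m n := fun θ h =>
    exists_one_lt_mgf hμpos hμsum hg hk (hsum Δ) (hθt0.trans h) (hθt.pos_of_lt hconv hle h)
  constructor
  · intro m n hmin hlog
    have hlow : ∀ θ, θt < θ → ∃ C₁ : ℝ, 0 < C₁ ∧ ∀ᶠ c in atTop, C₁ * Real.exp (-θ * c) ≤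
        P.real {ω | c ≤ prefixH K (gapPenalty Δ γ) (m c) (n c) (fun k => X k ω)
          (fun k => Y k ω)} := by
      intro θ hθ
      obtain ⟨κ, m', n', hκ, hm', hn', h1⟩ := hmgf θ hθ
      obtain ⟨C₁, C₂, c₀, hC₁, H⟩ := exists_le_measureReal_prefixH hμpos hμsum hX hY hindep hXlaw
        hYlaw hg hKsymm (hθt0.trans hθ) hκ hm' hn' h1
      refine ⟨C₁, hC₁, ?_⟩
      filter_upwards [hmin.eventually_ge_atTop C₂, eventually_ge_atTop c₀, eventually_gt_atTop 0]
        with c h2 h3 h4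
      rw [le_div_iff₀ h4] at h2
      exact H c h3 _ _ (h2.trans (by exact_mod_cast min_le_left _ _))
        (h2.trans (by exact_mod_cast min_le_right _ _))
    have hpos : ∀ᶠ c in atTop, 0 < m c ∧ 0 < n c ∧ 0 < P.real {ω | c ≤
        prefixH K (gapPenalty Δ γ) (m c) (n c) (fun k => X k ω) (fun k => Y k ω)} := by
      obtain ⟨C₁, hC₁, H⟩ := hlow (θt + 1) (by linarith)
      filter_upwards [H, hmin.eventually_gt_atTop 0, eventually_gt_atTop 0] with c h1 h2 h3
      rw [lt_div_iff₀ h3, zero_mul] at h2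
      have h4 : 0 < min (m c) (n c) := by exact_mod_cast h2
      exact ⟨h4.trans_le (min_le_left _ _), h4.trans_le (min_le_right _ _),
        lt_of_lt_of_le (by positivity) h1⟩
    rw [tendsto_order]
    constructor
    · intro b hb
      obtain ⟨θ, h1, h2⟩ := exists_between (max_lt hb hθt0)
      have hθ : 0 < θ := (le_max_right _ _).trans_lt h1
      exact eventually_lt_rate hμpos hμsum hX hY hindep hXlaw hYlaw hg (hsum Δ) hθ (hneg θ hθ h2)
        ((le_max_left _ _).trans_lt h1) hlog hpos
    · intro b hb
      obtain ⟨θ, h1, h2⟩ := exists_between hb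
      obtain ⟨C₁, hC₁, H⟩ := hlow θ h1
      have hlim : Tendsto (fun c : ℝ => θ - Real.log C₁ / c) atTop (𝓝 (θ - 0)) :=
        (tendsto_id.const_div_atTop _).const_sub θ
      rw [sub_zero] at hlim
      filter_upwards [hlim.eventually_lt_const h2, H, eventually_gt_atTop 0] with c h3 h4 hc
      refine lt_of_le_of_lt ?_ h3
      have h5 := Real.log_le_log (by positivity) h4
      rw [Real.log_mul hC₁.ne' (Real.exp_pos _).ne', Real.log_exp] at h5
      have h6 := mul_le_mul_of_nonneg_left h5 (inv_pos.2 hc).le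
      have e : c⁻¹ * (Real.log C₁ + -θ * c) = -(θ - Real.log C₁ / c) := by
        field_simp
        ring
      rw [e] at h6
      have h7 : P.real {ω | c ≤ localScore K (gapPenalty Δ γ) (fun p : Fin (m c) => X p ω)
          (fun q : Fin (n c) => Y q ω)} = P.real {ω | c ≤ prefixH K (gapPenalty Δ γ) (m c) (n c)
            (fun k => X k ω) (fun k => Y k ω)} := rfl
      rw [h7]
      linarith
  · -- constants that approach `2 / θt` from above and from below
    set u : ℕ → ℝ := fun j => 2 / θt * (1 + 1 / ((j : ℝ) + 1)) with hu
    set l : ℕ → ℝ := fun j => 2 / θt * (1 - 1 / ((j : ℝ) + 1 + 1)) with hl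
    have hj : ∀ j : ℕ, 0 < 1 / ((j : ℝ) + 1) := fun j => by positivity
    have hj' : ∀ j : ℕ, 0 < 1 / ((j : ℝ) + 1 + 1) ∧ 1 / ((j : ℝ) + 1 + 1) < 1 := fun j =>
      ⟨by positivity, (div_lt_one (by positivity)).2 (by
        have : (0 : ℝ) ≤ j := Nat.cast_nonneg j
        linarith)⟩
    have hv : 0 < 2 / θt := by positivity
    have hu0 : ∀ j, 0 < u j := fun j => mul_pos hv (by linarith [hj j])
    have hl0 : ∀ j, 0 < l j := fun j => mul_pos hv (by linarith [(hj' j).2])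
    have hutend : Tendsto u atTop (𝓝 (2 / θt)) := by
      simpa [hu] using (tendsto_one_div_add_atTop_nhds_zero_nat (𝕜 := ℝ)).const_add 1 |>.const_mul
        (2 / θt)
    have hltend : Tendsto l atTop (𝓝 (2 / θt)) := by
      have := (tendsto_one_div_add_atTop_nhds_zero_nat (𝕜 := ℝ)).comp (tendsto_add_atTop_nat 1)
      have := (this.const_sub 1).const_mul (2 / θt)
      simpa [hl, Function.comp_def] using this
    have hupper : ∀ᵐ ω ∂P, ∀ j, ∀ᶠ k : ℕ in atTop, prefixH K (gapPenalty Δ γ) (2 ^ k) (2 ^ k)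
        (fun k => X k ω) (fun k => Y k ω) ≤ u j * (k * Real.log 2) := by
      refine ae_all_iff.2 fun j => ?_
      have h1 : 2 / u j < θt := by
        rw [div_lt_iff₀ (hu0 j)]
        have : θt * u j = 2 + 2 * (1 / ((j : ℝ) + 1)) := by simp only [hu]; field_simp
        linarith [hj j]
      obtain ⟨θ, h2, h3⟩ := exists_between h1
      have hθ : 0 < θ := (div_pos two_pos (hu0 j)).trans h2
      exact eventually_prefixH_two_pow_le hμpos hμsum hX hY hindep hXlaw hYlaw hg (hsum Δ) hθ
        (hneg θ hθ h3) ((div_lt_iff₀ (hu0 j)).1 h2)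
    have hlower : ∀ᵐ ω ∂P, ∀ j, ∀ᶠ k : ℕ in atTop, l j * (k * Real.log 2) ≤
        prefixH K (gapPenalty Δ γ) (2 ^ k) (2 ^ k) (fun k => X k ω) (fun k => Y k ω) := by
      refine ae_all_iff.2 fun j => ?_
      have h1 : θt < 2 / l j := by
        rw [lt_div_iff₀ (hl0 j)]
        have : θt * l j = 2 - 2 * (1 / ((j : ℝ) + 1 + 1)) := by simp only [hl]; field_simp
        linarith [(hj' j).1]
      obtain ⟨θ, h2, h3⟩ := exists_between h1
      obtain ⟨κ, m, n, hκ, hm, hn, h4⟩ := hmgf θ h2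
      exact eventually_le_prefixH_two_pow hμpos hμsum hX hY hindep hXlaw hYlaw hg hKsymm
        (hθt0.trans h2) hκ hm hn h4 (hl0 j) ((lt_div_iff₀ (hl0 j)).1 h3)
    filter_upwards [hupper, hlower] with ω h1 h2
    exact tendsto_div_log_of_dyadic (f := fun n => prefixH K (gapPenalty Δ γ) n n (fun k => X k ω)
      (fun k => Y k ω)) (fun a b ha hab => prefixH_mono hg ha ha hab hab) (fun j => (hu0 j).le)
      (fun j => (hl0 j).le) hutend hltend h1 h2
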